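/- A strict operadic category is a category $\mathtt O$ with a cardinality functor $|-|:\mathtt O\to\mathtt{Fin}$ to the skeletal category of finite ordinals $\bar n=\{1,\dots,n\}$ and all maps, a chosen terminal object $U_c$ in each connected component $c\in\pi_0(\mathtt O)$, an object $f^{-1}(i)$ (the $i$th fiber) with $|f^{-1}(i)|=|f|^{-1}(i)$ for every $f:T\to S$ and $i\in|S|$, and, for every commutative triangle $h=g\circ f$ with $f:T\to S$, $g:S\to R$ and every $i\in|R|$, a morphism $f_i:h^{-1}(i)\to g^{-1}(i)$ over the map $|h|^{-1}(i)\to|g|^{-1}(i)$ induced by $|f|$, such that: $|U_c|=1$; all fibers of an identity are chosen terminal objects; $\mathrm{Fib}_i:\mathtt O/R\to\mathtt O$, $(f:h\to g)\mapsto f_i$, is a functor, which is the domain functor if $R=U_c$; $f^{-1}(j)=f_{|g|(j)}^{-1}(j)$ for $j\in|S|$; and $f_j=(f_i)_j$ whenever $f:T\to S$ is a morphism over $Q$, $Q\to R$ is a morphism, $j\in|Q|$, and $i\in|R|$ is the image of $j$. An $\mathtt O$-operad in a symmetric monoidal category $(\mathtt V,\otimes,I)$ is a family $\mathcal P(T)\in\mathtt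 V$, $T\in\mathtt O$, with units $I\to\mathcal P(U_c)$ and structure maps $\gamma_f:\bigotimes_{i\in|S|}\mathcal P(f^{-1}(i))\otimes\mathcal P(S)\to\mathcal P(T)$ for all $f:T\to S$, which are associative for all composable pairs of morphisms and unital with respect to the identities $1_T$ and the morphisms $!_T:T\to U_c$; morphisms of operads are families of morphisms of $\mathtt V$ commuting with these operations. A set-valued operad is an operad in $(\mathrm{Set},\times)$. The terminal $\mathtt O$-operad $\mathsf 1_{\mathtt O}$ is the set-valued operad all of whose components are one-point sets. An algebra in $\mathtt V$ over a set-valued $\mathtt O$-operad $\mathcal P$ is a family $A_c\in\mathtt V$, $c\in\pi_0(\mathtt O)$, with maps $\mathcal P(T)\to\mathtt V\big(A_{c_1}\otimes\cdots\otimes A_{c_n},A_c\big)$, $T\in\mathtt O$, where $c_i$ is the component of the $i$th fiber of $1_T$ and $c$ is the component of $T$, compatible with units and composition, i.e. with a map of operads from $\mathcal P$ to the endomorphism operad of $A$. For a set $\mathfrak C$, the operadic category $\mathtt{Bq}(\mathfrak C)$ of bouquets has the tuples $(c_1,\dots,c_n;c)$, $n\ge 0$, of elements of $\mathfrak C$ as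 objects; a morphism from $(c_1,\dots,c_n;c)$ to $(d_1,\dots,d_m;d)$ is any map $\bar n\to\bar m$ if $c=d$, and does not exist otherwise; the fiber of $\phi$ over $i$ consists of the $c_j$ with $\phi(j)=i$, in order, with root $d_i$. Its operads are the classical (symmetric) $\mathfrak C$-coloured operads. For a set-valued $\mathtt P$-operad $\mathcal Q$, the operadic Grothendieck construction $\int_{\mathtt P}\mathcal Q$ is the operadic category whose objects are the elements $t\in\mathcal Q(T)$, $T\in\mathtt P$, and whose morphisms from $t\in\mathcal Q(T)$ to $s\in\mathcal Q(S)$ are the pairs $(\varepsilon,f)$ of a morphism $f:T\to S$ and $\varepsilon\in\prod_{i\in|S|}\mathcal Q(f^{-1}(i))$ with $\gamma_f(\varepsilon,s)=t$; the fibers of $(\varepsilon,f)$ are the $\varepsilon_i$, and the chosen terminal objects are the units of $\mathcal Q$. Let $\mathtt O$ be a strict operadic category, and let $\mathcal P(\mathtt O)$ be the set-valued classical coloured operad with the objects of $\mathtt O$ as colours which is generated by an operation $\Gamma_f$ with inputs $S,F_1,\dots,F_k$ and output $T$ for each morphism $f:T\to S$ with fibers $F_1,\dots,F_k$, and an operation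 $\Gamma_U$ with no inputs and output $U$ for each chosen terminal object $U$, subject to the relations (where $e_T$ denotes the unit of the colour $T$): 1. for $T\xrightarrow{f}S\xrightarrow{g}R$ and $h=g\circ f$, $\Gamma_f(\Gamma_g,e_{F_1},e_{F_2},\dots)=\Gamma_h(e_R,\Gamma_{f_1},\dots,\Gamma_{f_k})$ up to the permutation of inputs which identifies the fibers $F_j$ of $f$ with the fibers of $f_1,\dots,f_k$; 2. $\Gamma_{1_T}(e_T,\Gamma_{U_1},\dots,\Gamma_{U_n})=e_T$, where $U_1,\dots,U_n$ are the fibers of $1_T$; 3. $\Gamma_{!_T}(\Gamma_{U},e_T)=e_T$ for the unique morphism $!_T:T\to U$ to the chosen terminal object of the component of $T$. **Theorem.** For every strict operadic category $\mathtt O$, the domain $\mathtt O^+:=\int_{\mathtt{Bq}(\mathrm{Ob}\,\mathtt O)}\mathcal P(\mathtt O)$ of the operadic Grothendieck construction $\int_{\mathtt{Bq}(\mathrm{Ob}\,\mathtt O)}\mathcal P(\mathtt O)\to\mathtt{Bq}(\mathrm{Ob}\,\mathtt O)$ is a $+$-construction on $\mathtt O$: it is an operadic category such that, for every symmetric monoidal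 category $\mathtt V$, the category of $\mathtt O$-operads in $\mathtt V$ is equivalent to the category of algebras in $\mathtt V$ over the terminal $\mathtt O^+$-operad $\mathsf 1_{\mathtt O^+}$. -/

import Mathlib

open CategoryTheory MonoidalCategory

universe u v w u' v'

noncomputable section

namespace OperadicCat

section Fin

/-! ### Fibers in the skeletal category of finite sets -/

/-- The order-preserving inclusion of the fiber of `φ : {0,…,n-1} → {0,…,m-1}` over `i`, where the
fiber is replaced by the isomorphic finite ordinal `{0,…,k-1}`. -/
def fiberEmb {n m k : ℕ} (φ : Fin n → Fin m) (i : Fin m)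
    (h : k = (Finset.univ.filter (fun t => φ t = i)).card) : Fin k ↪o Fin n :=
  Finset.orderEmbOfFin _ h.symm

variable {n m k : ℕ} {φ : Fin n → Fin m} {i : Fin m}
  {h : k = (Finset.univ.filter (fun t => φ t = i)).card}

theorem map_fiberEmb (x : Fin k) : φ (fiberEmb φ i h x) = i := by
  have := Finset.orderEmbOfFin_mem _ h.symm x
  exact (Finset.mem_filter.1 this).2

theorem exists_fiberEmb_eq {t : Fin n} (ht : φ t = i) : ∃ x, fiberEmb φ i h x = t := by
  have := Finset.range_orderEmbOfFin (Finset.univ.filter (fun t => φ t = i)) h.symm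
  have h2 : t ∈ Set.range (fiberEmb φ i h) := by
    unfold fiberEmb; rw [this]; simpa using ht
  exact h2

/-- A strictly monotone enumeration of the fiber is the canonical one. -/
theorem fiberEmb_unique {e : Fin k → Fin n} (he : StrictMono e) (hφ : ∀ x, φ (e x) = i) :
    e = fiberEmb φ i h :=
  Finset.orderEmbOfFin_unique h.symm (fun x => by simpa using hφ x) he

theorem card_fiber_of_enum {e : Fin k → Fin n} (he : Function.Injective e)
    (hφ : ∀ t, φ t = i ↔ ∃ x, e x = t) :
    k = (Finset.univ.filter (fun t => φ t = i)).card := by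
  have : (Finset.univ.filter (fun t => φ t = i)) = Finset.univ.image e := by
    ext t; simp [hφ]
  rw [this, Finset.card_image_of_injective _ he]; simp

/-- The element of the fiber (as a finite ordinal) which corresponds to an element `t` of the
preimage. -/
def fiberIdx (h : k = (Finset.univ.filter (fun t => φ t = i)).card) (t : Fin n)
    (ht : φ t = i) : Fin k :=
  (exists_fiberEmb_eq (h := h) ht).choose

@[simp] theorem fiberEmb_fiberIdx (t : Fin n) (ht : φ t = i) :
    fiberEmb φ i h (fiberIdx h t ht) = t :=
  (exists_fiberEmb_eq (h := h) ht).choose_spec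

end Fin

/-! ### Strict operadic categories -/

/-- The set of connected components of a category. -/
abbrev π₀ (O : Type u) [Category.{v} O] : Type u := CategoryTheory.ConnectedComponents O

/-- The connected component of an object. -/
abbrev comp₀ {O : Type u} [Category.{v} O] (T : O) : π₀ O :=
  CategoryTheory.ConnectedComponents.mk T

theorem comp₀_eq_of_hom {O : Type u} [Category.{v} O] {T S : O} (f : T ⟶ S) : comp₀ T = comp₀ S :=
  Quotient.sound' (s₁ := Zigzag.setoid O) (Zigzag.of_hom f)

/-- A strict operadic category. The cardinality functor to the skeletal category of finite sets is
given by `card` and `cardMap`. A commutative triangle `f ≫ g = h` over `R` induces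
`fiberMap f g h w i : h⁻¹(i) ⟶ g⁻¹(i)` for every `i ∈ |R|`. -/
class OperadicCategory (O : Type u) [Category.{v} O] where
  /-- cardinality on objects -/
  card : O → ℕ
  /-- cardinality on morphisms -/
  cardMap : ∀ {T S : O}, (T ⟶ S) → Fin (card T) → Fin (card S)
  cardMap_id : ∀ (T : O) (t : Fin (card T)), cardMap (𝟙 T) t = t
  cardMap_comp : ∀ {T S R : O} (f : T ⟶ S) (g : S ⟶ R) (t : Fin (card T)),
    cardMap (f ≫ g) t = cardMap g (cardMap f t)
  /-- the chosen local terminal objects -/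
  U : π₀ O → O
  comp_U : ∀ c, comp₀ (U c) = c
  U_terminal : ∀ T : O, Nonempty (Unique (T ⟶ U (comp₀ T)))
  card_U : ∀ c, card (U c) = 1
  /-- the fibers of a morphism -/
  fiber : ∀ {T S : O}, (T ⟶ S) → Fin (card S) → O
  card_fiber : ∀ {T S : O} (f : T ⟶ S) (i : Fin (card S)),
    card (fiber f i) = (Finset.univ.filter (fun t => cardMap f t = i)).card
  fiber_id : ∀ (T : O) (i : Fin (card T)), ∃ d, fiber (𝟙 T) i = U d
  /-- the maps induced on the fibers -/
  fiberMap : ∀ {T S R : O} (f : T ⟶ S) (g : S ⟶ R) (h : T ⟶ R), f ≫ g = h →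
    ∀ i : Fin (card R), fiber h i ⟶ fiber g i
  cardMap_fiberMap : ∀ {T S R : O} (f : T ⟶ S) (g : S ⟶ R) (h : T ⟶ R) (w : f ≫ g = h)
    (i : Fin (card R)) (x : Fin (card (fiber h i))),
    fiberEmb (cardMap g) i (card_fiber g i) (cardMap (fiberMap f g h w i) x) =
      cardMap f (fiberEmb (cardMap h) i (card_fiber h i) x)
  fiberMap_id : ∀ {T R : O} (h : T ⟶ R) (i : Fin (card R)),
    fiberMap (𝟙 T) h h (Category.id_comp h) i = 𝟙 (fiber h i)
  fiberMap_comp : ∀ {T S S' R : O} (f : T ⟶ S) (f' : S ⟶ S') (h : T ⟶ R) (g : S ⟶ R)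
    (g' : S' ⟶ R) (w : f ≫ g = h) (w' : f' ≫ g' = g) (w'' : (f ≫ f') ≫ g' = h)
    (i : Fin (card R)),
    fiberMap (f ≫ f') g' h w'' i = fiberMap f g h w i ≫ fiberMap f' g' g w' i
  fiber_U : ∀ {T : O} {c : π₀ O} (h : T ⟶ U c) (i : Fin (card (U c))),
    fiber h i = T
  fiberMap_U : ∀ {T S : O} {c : π₀ O} (f : T ⟶ S) (g : S ⟶ U c) (h : T ⟶ U c)
    (w : f ≫ g = h) (i : Fin (card (U c))), HEq (fiberMap f g h w i) f
  fiber_fiberMap : ∀ {T S R : O} (f : T ⟶ S) (g : S ⟶ R) (h : T ⟶ R) (w : f ≫ g = h)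
    (i : Fin (card R)) (j : Fin (card (fiber g i))),
    fiber (fiberMap f g h w i) j = fiber f (fiberEmb (cardMap g) i (card_fiber g i) j)
  fiberMap_fiberMap : ∀ {T S Q R : O} (f : T ⟶ S) (a : S ⟶ Q) (b : T ⟶ Q) (c : Q ⟶ R)
    (g : S ⟶ R) (h : T ⟶ R) (hb : f ≫ a = b) (hg : a ≫ c = g) (hh : f ≫ g = h) (hh' : b ≫ c = h)
    (i : Fin (card R))
    (hi : fiberMap f g h hh i ≫ fiberMap a c g hg i = fiberMap b c h hh' i)
    (j : Fin (card (fiber c i))),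
    HEq (fiberMap (fiberMap f g h hh i) (fiberMap a c g hg i) (fiberMap b c h hh' i) hi j)
      (fiberMap f a b hb (fiberEmb (cardMap c) i (card_fiber c i) j))

namespace OperadicCategory

variable {O : Type u} [Category.{v} O] [OperadicCategory O]

/-- The inclusion of the elements of the fiber `f⁻¹(i)` into the elements of the domain of `f`. -/
def incl {T S : O} (f : T ⟶ S) (i : Fin (card S)) : Fin (card (fiber f i)) ↪o Fin (card T) :=
  fiberEmb (cardMap f) i (card_fiber f i)

theorem cardMap_incl {T S : O} (f : T ⟶ S) (i : Fin (card S)) (x : Fin (card (fiber f i))) :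
    cardMap f (incl f i x) = i := map_fiberEmb x

theorem exists_incl_eq {T S : O} (f : T ⟶ S) {i : Fin (card S)} {t : Fin (card T)}
    (ht : cardMap f t = i) : ∃ x, incl f i x = t := exists_fiberEmb_eq ht

theorem fiber_fiberMap' {T S R : O} (f : T ⟶ S) (g : S ⟶ R) (h : T ⟶ R) (w : f ≫ g = h)
    (i : Fin (card R)) (j : Fin (card (fiber g i))) :
    fiber (fiberMap f g h w i) j = fiber f (incl g i j) := fiber_fiberMap f g h w i j

theorem U_comp₀_fiber_id (T : O) (i : Fin (card T)) :
    U (comp₀ (fiber (𝟙 T) i)) = fiber (𝟙 T) i := by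
  obtain ⟨d, hd⟩ := fiber_id T i
  rw [hd, comp_U]

/-- The colour of the `i`th source of `T`: the connected component of the `i`th fiber of the
identity of `T`. -/
def src (T : O) (i : Fin (card T)) : π₀ O := comp₀ (fiber (𝟙 T) i)

theorem src_fiber {T S : O} (f : T ⟶ S) (i : Fin (card S)) (x : Fin (card (fiber f i))) :
    src T (incl f i x) = src (fiber f i) x := by
  have h1 := fiber_fiberMap' (𝟙 T) f f (Category.id_comp f) i x
  rw [fiberMap_id] at h1
  simp [src, h1]

theorem comp₀_fiber {T S : O} (f : T ⟶ S) (i : Fin (card S)) :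
    comp₀ (fiber f i) = src S i :=
  comp₀_eq_of_hom (fiberMap f (𝟙 S) f (Category.comp_id f) i)

theorem src_U (c : π₀ O) (i : Fin (card (U c))) : src (U c) i = c := by
  simp only [src, fiber_U]
  exact comp_U c

end OperadicCategory

open OperadicCategory

/-! ### Finite ordered tensor products in a symmetric monoidal category -/

section Tensor

variable {V : Type u'} [Category.{v'} V] [MonoidalCategory V] {ι κ : Type}

/-- The tensor product `X a₁ ⊗ (X a₂ ⊗ (⋯ ⊗ 𝟙))` along the list `a₁, a₂, …`. -/
def tensorList (X : ι → V) : List ι → V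
  | [] => 𝟙_ V
  | a :: l => X a ⊗ tensorList X l

/-- Tensor products are functorial. -/
def tensorListMap {X Y : ι → V} (f : ∀ i, X i ⟶ Y i) :
    ∀ l : List ι, tensorList X l ⟶ tensorList Y l
  | [] => 𝟙 _
  | a :: l => f a ⊗ₘ tensorListMap f l

/-- `𝟙 ≅ 𝟙 ⊗ ⋯ ⊗ 𝟙`. -/
def tensorListUnit : ∀ l : List ι, 𝟙_ V ≅ tensorList (fun _ => 𝟙_ V) l
  | [] => Iso.refl _
  | _ :: l => (λ_ (𝟙_ V)).symm ≪≫ whiskerLeftIso (𝟙_ V) (tensorListUnit l)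

/-- The tensor product over a concatenated list. -/
def tensorListAppend (X : ι → V) : ∀ l l' : List ι,
    tensorList X (l ++ l') ≅ tensorList X l ⊗ tensorList X l'
  | [], l' => (λ_ (tensorList X l')).symm
  | a :: l, l' => whiskerLeftIso (X a) (tensorListAppend X l l') ≪≫
      (α_ (X a) (tensorList X l) (tensorList X l')).symm

theorem tensorList_map (X : ι → V) (e : κ → ι) (l : List κ) :
    tensorList X (l.map e) = tensorList (fun x => X (e x)) l := by
  induction l with
  | nil => rfl
  | cons a l ih => simp [tensorList, ih]

/-- The tensor product over a list of lists. -/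
def tensorListFlatMap (X : ι → V) (L : κ → List ι) : ∀ l : List κ,
    tensorList X (l.flatMap L) ≅ tensorList (fun i => tensorList X (L i)) l
  | [] => Iso.refl _
  | a :: l => tensorListAppend X (L a) (l.flatMap L) ≪≫
      whiskerLeftIso (tensorList X (L a)) (tensorListFlatMap X L l)

variable [SymmetricCategory V]

/-- `(⊗ X i) ⊗ (⊗ Y i) ⟶ ⊗ (X i ⊗ Y i)`. -/
def tensorListShuffle (X Y : ι → V) : ∀ l : List ι,
    tensorList X l ⊗ tensorList Y l ⟶ tensorList (fun i => X i ⊗ Y i) l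
  | [] => (λ_ (𝟙_ V)).hom
  | a :: l => tensorμ (X a) (tensorList X l) (Y a) (tensorList Y l) ≫
      ((X a ⊗ Y a) ◁ tensorListShuffle X Y l)

variable [DecidableEq ι]

/-- The symmetry isomorphism which moves the factor `X a` to the front. -/
def tensorListPull (X : ι → V) (a : ι) : ∀ l : List ι, a ∈ l →
    (tensorList X l ≅ X a ⊗ tensorList X (l.erase a))
  | [], h => absurd h List.not_mem_nil
  | b :: l, h =>
    if hb : b = a then
      eqToIso (by subst hb; simp [tensorList])
    else
      whiskerLeftIso (X b)
          (tensorListPull X a l ((List.mem_cons.1 h).resolve_left (fun e => hb e.symm))) ≪≫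
        (α_ (X b) (X a) (tensorList X (l.erase a))).symm ≪≫
        whiskerRightIso (β_ (X b) (X a)) (tensorList X (l.erase a)) ≪≫
        α_ (X a) (X b) (tensorList X (l.erase a)) ≪≫
        eqToIso (by rw [List.erase_cons_tail (by simpa using hb)]; rfl)

/-- The symmetry isomorphism between the tensor products along two orderings `l` and `l'` of the
same elements. -/
def tensorListPerm (X : ι → V) : ∀ l l' : List ι, l.Perm l' → (tensorList X l ≅ tensorList X l')
  | [], l', h => eqToIso (by rw [h.nil_eq])
  | a :: l, l', h =>
      whiskerLeftIso (X a) (tensorListPerm X l (l'.erase a)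
        (List.cons_perm_iff_perm_erase.1 h).2) ≪≫
      (tensorListPull X a l' (List.cons_perm_iff_perm_erase.1 h).1).symm

end Tensor

section TensorFin

variable {V : Type u'} [Category.{v'} V] [MonoidalCategory V]

/-- The tensor product `X 0 ⊗ X 1 ⊗ ⋯ ⊗ X (n - 1)`. -/
abbrev tensorFin {n : ℕ} (X : Fin n → V) : V := tensorList X (List.finRange n)

/-- Functoriality of `tensorFin`. -/
abbrev tensorFinMap {n : ℕ} {X Y : Fin n → V} (f : ∀ i, X i ⟶ Y i) :
    tensorFin X ⟶ tensorFin Y := tensorListMap f (List.finRange n)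

/-- A tensor product with a single factor. -/
def tensorFinOne {n : ℕ} (hn : n = 1) (X : Fin n → V) (Y : V) (h : ∀ i, X i = Y) :
    tensorFin X ≅ Y :=
  eqToIso (by
    subst hn
    obtain rfl : X = fun _ => Y := funext h
    simp [tensorFin, List.finRange_succ, tensorList]) ≪≫ ρ_ Y

theorem regroup_perm {n m : ℕ} {k : Fin m → ℕ} (φ : Fin n → Fin m)
    (h : ∀ i, k i = (Finset.univ.filter (fun t => φ t = i)).card) :
    (List.finRange n).Perm ((List.finRange m).flatMap
      (fun i => (List.finRange (k i)).map (fiberEmb φ i (h i)))) := by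
  rw [List.perm_ext_iff_of_nodup (List.nodup_finRange n)]
  · intro t
    simp only [List.mem_finRange, List.mem_flatMap, List.mem_map, true_and, true_iff]
    exact ⟨φ t, exists_fiberEmb_eq rfl⟩
  · rw [List.nodup_flatMap]
    refine ⟨fun i _ => (List.nodup_finRange _).map (fiberEmb φ i (h i)).injective, ?_⟩
    refine (List.nodup_finRange m).imp ?_
    intro a b hab
    simp only [Function.onFun, List.disjoint_left, List.mem_map, not_exists, not_and]
    rintro t ⟨x, -, rfl⟩ y - hy
    apply hab
    rw [← map_fiberEmb (h := h a) x, ← map_fiberEmb (h := h b) y, hy]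

variable [SymmetricCategory V]

/-- The canonical isomorphism between `⊗_t X t` and the tensor product, over all `i`, of the tensor
products of the `X t` with `t` in the fiber of `φ` over `i`. -/
def regroup {n m : ℕ} {k : Fin m → ℕ} (φ : Fin n → Fin m)
    (h : ∀ i, k i = (Finset.univ.filter (fun t => φ t = i)).card) (X : Fin n → V) :
    tensorFin X ≅ tensorFin (fun i => tensorFin (fun x => X (fiberEmb φ i (h i) x))) :=
  tensorListPerm X _ _ (regroup_perm φ h) ≪≫
    tensorListFlatMap X (fun i => (List.finRange (k i)).map (fiberEmb φ i (h i)))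
      (List.finRange m) ≪≫
    eqToIso (by simp only [tensorList_map])

end TensorFin

/-! ### Operads over an operadic category, with values in a symmetric monoidal category -/

section Operad

variable (O : Type u) [Category.{v} O] [OperadicCategory O]
  (V : Type u') [Category.{v'} V] [MonoidalCategory V] [SymmetricCategory V]

variable {O V} in
/-- The object `P(f) = ⊗_{i ∈ |S|} P(f⁻¹(i))`, for `f : T ⟶ S`. -/
abbrev fiberTensor (P : O → V) {T S : O} (f : T ⟶ S) : V := tensorFin (fun i => P (fiber f i))

variable {O V} in
/-- For `T ⟶ S ⟶ R`, the isomorphism `⊗_{i ∈ |R|} P(f_i) ≅ P(f)` which regroups the factors,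
using the equalities of the fibers of `f_i` with the fibers of `f`. -/
def fiberTensorIso (P : O → V) {T S R : O} (f : T ⟶ S) (g : S ⟶ R) (h : T ⟶ R) (w : f ≫ g = h) :
    tensorFin (fun i => fiberTensor P (fiberMap f g h w i)) ≅ fiberTensor P f :=
  eqToIso (by simp only [fiberTensor, fiber_fiberMap' f g h w]; rfl) ≪≫
    (regroup (cardMap g) (card_fiber g) (fun j => P (fiber f j))).symm

/-- An `O`-operad with values in `V`. -/
structure Operad where
  /-- the underlying collection -/
  obj : O → V
  /-- the units -/
  unit : ∀ c : π₀ O, 𝟙_ V ⟶ obj (U c)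
  /-- the structure maps -/
  γ : ∀ {T S : O} (f : T ⟶ S), fiberTensor obj f ⊗ obj S ⟶ obj T
  assoc : ∀ {T S R : O} (f : T ⟶ S) (g : S ⟶ R) (h : T ⟶ R) (w : f ≫ g = h),
    ((tensorListShuffle (fun i => fiberTensor obj (fiberMap f g h w i)) (fun i => obj (fiber g i))
          (List.finRange (card R)) ≫
        tensorFinMap (fun i => γ (fiberMap f g h w i))) ▷ obj R) ≫ γ h =
      (α_ _ _ _).hom ≫
        (tensorFin (fun i => fiberTensor obj (fiberMap f g h w i)) ◁ γ g) ≫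
        ((fiberTensorIso obj f g h w).hom ▷ obj S) ≫ γ f
  unit_left : ∀ T : O,
    (λ_ (obj T)).inv ≫
      (((tensorListUnit (List.finRange (card T))).hom ≫
        tensorFinMap (fun i => unit (comp₀ (fiber (𝟙 T) i)) ≫
          eqToHom (congrArg obj (U_comp₀_fiber_id T i)))) ▷ obj T) ≫ γ (𝟙 T) = 𝟙 (obj T)
  unit_right : ∀ {T : O} {c : π₀ O} (f : T ⟶ U c),
    (ρ_ (obj T)).inv ≫ (obj T ◁ unit c) ≫
      ((tensorFinOne (card_U c) (fun i => obj (fiber f i)) (obj T)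
        (fun i => congrArg obj (fiber_U f i))).inv ▷ obj (U c)) ≫ γ f = 𝟙 (obj T)

namespace Operad

variable {O V}

/-- A morphism of operads: a collection of morphisms which commutes with the structure
operations. -/
@[ext] structure Hom (P Q : Operad O V) where
  /-- the components -/
  app : ∀ T : O, P.obj T ⟶ Q.obj T
  unit : ∀ c, P.unit c ≫ app (U c) = Q.unit c
  γ : ∀ {T S : O} (f : T ⟶ S),
    P.γ f ≫ app T = (tensorFinMap (fun i => app (fiber f i)) ⊗ₘ app S) ≫ Q.γ f

end Operad

end Operad

section OperadCategory

variable {V : Type u'} [Category.{v'} V] [MonoidalCategory V]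

theorem tensorListMap_id {ι : Type} (X : ι → V) (l : List ι) :
    tensorListMap (fun i => 𝟙 (X i)) l = 𝟙 _ := by
  induction l with
  | nil => rfl
  | cons a l ih => simp [tensorListMap, ih, tensorList]

theorem tensorListMap_comp {ι : Type} {X Y Z : ι → V} (f : ∀ i, X i ⟶ Y i) (g : ∀ i, Y i ⟶ Z i)
    (l : List ι) :
    tensorListMap (fun i => f i ≫ g i) l = tensorListMap f l ≫ tensorListMap g l := by
  induction l with
  | nil => exact (Category.id_comp _).symm
  | cons a l ih => rw [tensorListMap, ih]; exact (tensorHom_comp_tensorHom _ _ _ _).symm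

theorem tensorFinMap_id {n : ℕ} (X : Fin n → V) : tensorFinMap (fun i => 𝟙 (X i)) = 𝟙 _ :=
  tensorListMap_id X _

theorem tensorFinMap_comp {n : ℕ} {X Y Z : Fin n → V} (f : ∀ i, X i ⟶ Y i)
    (g : ∀ i, Y i ⟶ Z i) :
    tensorFinMap (fun i => f i ≫ g i) = tensorFinMap f ≫ tensorFinMap g :=
  tensorListMap_comp f g _

variable {O : Type u} [Category.{v} O] [OperadicCategory O] [SymmetricCategory V]

/-- The category of `O`-operads with values in `V`. -/
instance : Category (Operad O V) where
  Hom := Operad.Hom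
  id P :=
    { app := fun T => 𝟙 _
      unit := by simp
      γ := by intros; simp [tensorFinMap_id] }
  comp a b :=
    { app := fun T => a.app T ≫ b.app T
      unit := by intro c; rw [← Category.assoc, a.unit, b.unit]
      γ := by
        intro T S f
        rw [← Category.assoc, a.γ, Category.assoc, b.γ, tensorFinMap_comp, ← Category.assoc,
          tensorHom_comp_tensorHom] }
  id_comp _ := Operad.Hom.ext (by funext T; simp)
  comp_id _ := Operad.Hom.ext (by funext T; simp)
  assoc _ _ _ := Operad.Hom.ext (by funext T; simp)

end OperadCategory

/-! ### Set-valued operads and their algebras in a symmetric monoidal category -/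

/-- A set-valued `O`-operad. The identifications of the fibers of `f_i` with fibers of `f` etc. are
expressed through heterogeneous equality. -/
structure SetOperad (O : Type u) [Category.{v} O] [OperadicCategory O] where
  /-- the underlying collection -/
  obj : O → Type w
  /-- the units -/
  unit : ∀ c : π₀ O, obj (U c)
  /-- the structure maps -/
  γ : ∀ {T S : O} (f : T ⟶ S), (∀ i, obj (fiber f i)) → obj S → obj T
  assoc : ∀ {T S R : O} (f : T ⟶ S) (g : S ⟶ R) (h : T ⟶ R) (w : f ≫ g = h)
    (ε' : ∀ i j, obj (fiber (fiberMap f g h w i) j)) (ε : ∀ j, obj (fiber f j))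
    (δ : ∀ i, obj (fiber g i)) (r : obj R), (∀ i j, HEq (ε' i j) (ε (incl g i j))) →
    γ h (fun i => γ (fiberMap f g h w i) (ε' i) (δ i)) r = γ f ε (γ g δ r)
  unit_left : ∀ (T : O) (ε : ∀ i, obj (fiber (𝟙 T) i)) (t : obj T),
    (∀ i, HEq (ε i) (unit (comp₀ (fiber (𝟙 T) i)))) → γ (𝟙 T) ε t = t
  unit_right : ∀ {T : O} {c : π₀ O} (f : T ⟶ U c) (ε : ∀ i, obj (fiber f i)) (t : obj T),
    (∀ i, HEq (ε i) t) → γ f ε (unit c) = t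

/-- The terminal set-valued operad. -/
def SetOperad.terminal (O : Type u) [Category.{v} O] [OperadicCategory O] : SetOperad.{u, v, w} O where
  obj _ := PUnit
  unit _ := PUnit.unit
  γ _ _ _ := PUnit.unit
  assoc _ _ _ _ _ _ _ _ _ := rfl
  unit_left _ _ _ _ := rfl
  unit_right _ _ _ _ := rfl

section Algebra

variable {O : Type u} [Category.{v} O] [OperadicCategory O]
  {V : Type u'} [Category.{v'} V] [MonoidalCategory V]

/-- The components of the endomorphism operad of a collection `A`: the component at `T` is the
component of the classical coloured endomorphism operad at the arity `(s₁,…,sₙ;c)` of `T`, where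
`sᵢ` are the colours of the sources of `T`, and `c` is the connected component of `T`. -/
abbrev EndObj (A : π₀ O → V) (T : O) : Type v' :=
  tensorFin (fun t => A (src T t)) ⟶ A (comp₀ T)

/-- The units of the endomorphism operad: the identities. -/
def endUnit (A : π₀ O → V) (c : π₀ O) : EndObj A (U c) :=
  (tensorFinOne (card_U c) (fun t => A (src (U c) t)) (A (comp₀ (U c)))
    (fun t => by rw [src_U, comp_U])).hom

variable [SymmetricCategory V]

/-- The structure maps of the endomorphism operad: the simultaneous composition. -/
def endComp (A : π₀ O → V) {T S : O} (f : T ⟶ S) (φ : ∀ i, EndObj A (fiber f i))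
    (ψ : EndObj A S) : EndObj A T :=
  (regroup (cardMap f) (card_fiber f) (fun t => A (src T t))).hom ≫
    tensorFinMap (fun i =>
      eqToHom (congrArg tensorFin (funext fun x => congrArg A (src_fiber f i x))) ≫ φ i ≫
        eqToHom (congrArg A (comp₀_fiber f i))) ≫
    ψ ≫ eqToHom (congrArg A (comp₀_eq_of_hom f).symm)

/-- An algebra in `V` over a set-valued operad `P`: a collection of objects of `V`, indexed by the
connected components, with a map of operads from `P` to its endomorphism operad. -/
structure SetOperad.Algebra (P : SetOperad.{u, v, w} O)
    (V : Type u') [Category.{v'} V] [MonoidalCategory V] [SymmetricCategory V] where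
  /-- the underlying collection -/
  carrier : π₀ O → V
  /-- the action -/
  act : ∀ {T : O}, P.obj T → EndObj carrier T
  act_unit : ∀ c : π₀ O, act (P.unit c) = endUnit carrier c
  act_γ : ∀ {T S : O} (f : T ⟶ S) (p : ∀ i, P.obj (fiber f i)) (s : P.obj S),
    act (P.γ f p s) = endComp carrier f (fun i => act (p i)) (act s)

/-- A morphism of algebras. -/
@[ext] structure SetOperad.Algebra.Hom {P : SetOperad.{u, v, w} O} (A B : P.Algebra V) where
  /-- the components -/
  app : ∀ c : π₀ O, A.carrier c ⟶ B.carrier c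
  act : ∀ {T : O} (p : P.obj T),
    A.act p ≫ app (comp₀ T) = tensorFinMap (fun t => app (src T t)) ≫ B.act p

/-- The category of algebras in `V` over a set-valued operad. -/
instance (P : SetOperad.{u, v, w} O) : Category (P.Algebra V) where
  Hom := SetOperad.Algebra.Hom
  id A :=
    { app := fun c => 𝟙 _
      act := by intros; simp [tensorFinMap_id] }
  comp a b :=
    { app := fun c => a.app c ≫ b.app c
      act := by
        intro T p
        rw [← Category.assoc, a.act, Category.assoc, b.act, tensorFinMap_comp, Category.assoc] }
  id_comp _ := SetOperad.Algebra.Hom.ext (by funext T; simp)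
  comp_id _ := SetOperad.Algebra.Hom.ext (by funext T; simp)
  assoc _ _ _ := SetOperad.Algebra.Hom.ext (by funext T; simp)

end Algebra

/-! ### The operadic category of bouquets -/

/-- A `C`-bouquet: a tuple `(c₁,…,cₙ;c)` of elements of `C`. -/
structure Bouquet (C : Type u) where
  /-- the cardinality of the underlying set -/
  n : ℕ
  /-- the colours of the elements of the underlying set -/
  col : Fin n → C
  /-- the root colour -/
  root : C

namespace Bouquet

variable {C : Type u}

/-- Maps of bouquets: the root colours coincide, and the map of the underlying sets is
arbitrary. -/
@[ext] structure Hom (b c : Bouquet C) where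
  /-- the map of the underlying sets -/
  map : Fin b.n → Fin c.n
  root_eq : b.root = c.root

instance : Category.{0} (Bouquet C) where
  Hom := Hom
  id b := ⟨id, rfl⟩
  comp f g := ⟨g.map ∘ f.map, f.root_eq.trans g.root_eq⟩

@[simp] theorem id_map (b : Bouquet C) : Hom.map (𝟙 b) = id := rfl
@[simp] theorem comp_map {b c d : Bouquet C} (f : b ⟶ c) (g : c ⟶ d) :
    (f ≫ g).map = g.map ∘ f.map := rfl

/-- The fiber of a map of bouquets over an element `i`: its root colour is the colour of `i`. -/
def fib {b c : Bouquet C} (f : b ⟶ c) (i : Fin c.n) : Bouquet C where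
  n := (Finset.univ.filter (fun t => f.map t = i)).card
  col x := b.col (fiberEmb f.map i rfl x)
  root := c.col i

/-- The inclusion of the fiber. -/
def inc {b c : Bouquet C} (f : b ⟶ c) (i : Fin c.n) : Fin (fib f i).n ↪o Fin b.n :=
  fiberEmb f.map i rfl

theorem map_inc {b c : Bouquet C} (f : b ⟶ c) (i : Fin c.n) (x) : f.map (inc f i x) = i :=
  map_fiberEmb x

theorem fib_col {b c : Bouquet C} (f : b ⟶ c) (i : Fin c.n) (x) :
    (fib f i).col x = b.col (inc f i x) := rfl

/-- The map induced on fibers by a commutative triangle. -/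
def fibMap {T S R : Bouquet C} (f : T ⟶ S) (g : S ⟶ R) (h : T ⟶ R) (w : f ≫ g = h)
    (i : Fin R.n) : fib h i ⟶ fib g i where
  map x := fiberIdx rfl (f.map (inc h i x)) (by
    subst w; exact map_inc (f ≫ g) i x)
  root_eq := rfl

theorem inc_fibMap {T S R : Bouquet C} (f : T ⟶ S) (g : S ⟶ R) (h : T ⟶ R) (w : f ≫ g = h)
    (i : Fin R.n) (x) : inc g i ((fibMap f g h w i).map x) = f.map (inc h i x) :=
  fiberEmb_fiberIdx _ (by subst w; exact map_inc (f ≫ g) i x)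

/-- The bouquet `(c;c)`. -/
def corolla (c : C) : Bouquet C := ⟨1, fun _ => c, c⟩

/-- A bouquet which enumerates a fiber in an order-preserving way is equal to the fiber. -/
theorem fib_eq {b c : Bouquet C} (f : b ⟶ c) (i : Fin c.n) (d : Bouquet C)
    (e : Fin d.n → Fin b.n) (he : StrictMono e) (hf : ∀ t, f.map t = i ↔ ∃ x, e x = t)
    (hcol : ∀ x, d.col x = b.col (e x)) (hroot : d.root = c.col i) : fib f i = d := by
  obtain ⟨n, col, root⟩ := d
  obtain rfl : n = _ := card_fiber_of_enum he.injective hf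
  obtain rfl : e = fiberEmb f.map i rfl := fiberEmb_unique he (fun x => (hf _).2 ⟨x, rfl⟩)
  obtain rfl : col = fun x => b.col (fiberEmb f.map i rfl x) := funext hcol
  subst hroot
  rfl

theorem inc_eq {b c : Bouquet C} (f : b ⟶ c) (i : Fin c.n) {k : ℕ}
    (e : Fin k → Fin b.n) (he : StrictMono e) (hf : ∀ t, f.map t = i ↔ ∃ x, e x = t)
    (x : Fin k) (y : Fin (fib f i).n) (hxy : x.val = y.val) : inc f i y = e x := by
  obtain rfl : k = _ := card_fiber_of_enum he.injective hf
  obtain rfl : e = fiberEmb f.map i rfl := fiberEmb_unique he (fun x => (hf _).2 ⟨x, rfl⟩)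
  obtain rfl : x = y := Fin.ext hxy
  rfl

theorem hom_heq {b b' c c' : Bouquet C} (hb : b = b') (hc : c = c') (f : b ⟶ c) (f' : b' ⟶ c')
    (h : ∀ x x', x.val = x'.val → (f.map x).val = (f'.map x').val) : HEq f f' := by
  subst hb; subst hc
  exact heq_of_eq (Hom.ext (funext fun x => Fin.ext (h x x rfl)))

/-- The root colour of a connected component. -/
def compRoot : π₀ (Bouquet C) → C :=
  Quotient.lift (s := Zigzag.setoid (Bouquet C)) root (by
    intro a b hab
    induction hab with
    | refl => rfl
    | tail _ h ih => exact ih.trans (h.elim (fun ⟨f⟩ => f.root_eq) (fun ⟨f⟩ => f.root_eq.symm)))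

@[simp] theorem compRoot_comp₀ (b : Bouquet C) : compRoot (comp₀ b) = b.root := rfl

theorem fib_fibMap_range {T S R : Bouquet C} (f : T ⟶ S) (g : S ⟶ R) (h : T ⟶ R) (w : f ≫ g = h)
    (i : Fin R.n) (j : Fin (fib g i).n) (t : Fin T.n) :
    f.map t = inc g i j ↔ ∃ x, inc h i (inc (fibMap f g h w i) j x) = t := by
  constructor
  · intro ht
    have h1 : h.map t = i := by
      subst w; simp only [comp_map, Function.comp, ht]; exact map_inc g i j
    obtain ⟨y, rfl⟩ : ∃ y, inc h i y = t := exists_fiberEmb_eq h1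
    have h2 : (fibMap f g h w i).map y = j := by
      apply (inc g i).injective
      rw [inc_fibMap, ht]
    obtain ⟨x, rfl⟩ : ∃ x, inc (fibMap f g h w i) j x = y := exists_fiberEmb_eq h2
    exact ⟨x, rfl⟩
  · rintro ⟨x, rfl⟩
    rw [← inc_fibMap f g h w, map_inc]

theorem fib_fibMap {T S R : Bouquet C} (f : T ⟶ S) (g : S ⟶ R) (h : T ⟶ R) (w : f ≫ g = h)
    (i : Fin R.n) (j : Fin (fib g i).n) : fib (fibMap f g h w i) j = fib f (inc g i j) :=
  (fib_eq f (inc g i j) _ (fun x => inc h i (inc (fibMap f g h w i) j x))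
    (fun _ _ hxy => (inc h i).strictMono ((inc _ j).strictMono hxy))
    (fib_fibMap_range f g h w i j) (fun _ => rfl) rfl).symm

theorem inc_inc {T S R : Bouquet C} (f : T ⟶ S) (g : S ⟶ R) (h : T ⟶ R) (w : f ≫ g = h)
    (i : Fin R.n) (j : Fin (fib g i).n) (x : Fin (fib (fibMap f g h w i) j).n)
    (y : Fin (fib f (inc g i j)).n) (hxy : x.val = y.val) :
    inc f (inc g i j) y = inc h i (inc (fibMap f g h w i) j x) :=
  inc_eq f (inc g i j) (fun x => inc h i (inc (fibMap f g h w i) j x))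
    (fun _ _ hxy => (inc h i).strictMono ((inc _ j).strictMono hxy))
    (fib_fibMap_range f g h w i j) x y hxy

theorem fib_corolla {T : Bouquet C} {c : C} (h : T ⟶ corolla c) (i : Fin 1) :
    fib h i = T :=
  fib_eq h i T id strictMono_id (fun t => ⟨fun _ => ⟨t, rfl⟩, fun _ => Subsingleton.elim (α := Fin 1) _ _⟩)
    (fun _ => rfl) h.root_eq

theorem inc_corolla {T : Bouquet C} {c : C} (h : T ⟶ corolla c) (i : Fin 1)
    (x : Fin T.n) (y : Fin (fib h i).n) (hxy : x.val = y.val) : inc h i y = x :=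
  inc_eq h i id strictMono_id
    (fun t => ⟨fun _ => ⟨t, rfl⟩, fun _ => Subsingleton.elim (α := Fin 1) _ _⟩) x y hxy

theorem fib_id (T : Bouquet C) (i : Fin T.n) : fib (𝟙 T) i = corolla (T.col i) :=
  fib_eq (𝟙 T) i _ (fun _ => i) (Subsingleton.strictMono (α := Fin 1) _)
    (fun _ => ⟨fun h => ⟨(0 : Fin 1), h.symm⟩, fun ⟨_, h⟩ => h.symm⟩) (fun _ => rfl) rfl

instance : OperadicCategory (Bouquet C) where
  card := n
  cardMap f := f.map
  cardMap_id _ _ := rfl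
  cardMap_comp _ _ _ := rfl
  U c := corolla (compRoot c)
  comp_U := by
    intro c
    induction c using Quotient.inductionOn' with
    | h b =>
      exact (comp₀_eq_of_hom (show b ⟶ corolla b.root from ⟨fun _ => (0 : Fin 1), rfl⟩)).symm
  U_terminal T := ⟨⟨⟨fun _ => (0 : Fin 1), rfl⟩⟩, fun f =>
    Hom.ext (funext fun _ => Subsingleton.elim (α := Fin 1) _ _)⟩
  card_U _ := rfl
  fiber f i := fib f i
  card_fiber _ _ := rfl
  fiber_id T i := ⟨comp₀ (corolla (T.col i)), fib_id T i⟩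
  fiberMap f g h w i := fibMap f g h w i
  cardMap_fiberMap f g h w i x := inc_fibMap f g h w i x
  fiberMap_id h i := Hom.ext (funext fun x => (inc h i).injective (inc_fibMap _ _ _ _ i x))
  fiberMap_comp f f' h g g' w w' w'' i := Hom.ext (funext fun x => (inc g' i).injective (by
    rw [inc_fibMap, comp_map, comp_map, Function.comp, Function.comp, inc_fibMap, inc_fibMap]))
  fiber_U h i := fib_corolla h i
  fiberMap_U f g h w i := hom_heq (fib_corolla h i) (fib_corolla g i) _ _ (by
    intro x x' hx
    have h1 := inc_fibMap f g h w i x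
    rw [inc_corolla h i x' x hx.symm] at h1
    rw [← h1, inc_corolla g i
      (Fin.cast (congrArg n (fib_corolla g i)) ((fibMap f g h w i).map x)) _ rfl]
    rfl)
  fiber_fiberMap f g h w i j := fib_fibMap f g h w i j
  fiberMap_fiberMap f a b c g h hb hg hh hh' i hi j :=
    hom_heq (fib_fibMap b c h hh' i j) (fib_fibMap a c g hg i j) _ _ (by
      intro x x' hx
      have e1 := inc_inc b c h hh' i j x x' hx
      have e2 := inc_fibMap f a b hb (inc c i j) x'
      rw [e1, ← inc_fibMap f g h hh i, ← inc_fibMap _ _ _ hi j] at e2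
      have e3 := inc_inc a c g hg i j ((fibMap _ _ _ hi j).map x)
        (Fin.cast (congrArg n (fib_fibMap a c g hg i j)) ((fibMap _ _ _ hi j).map x)) rfl
      rw [← e3] at e2
      exact congrArg Fin.val ((inc _ _).injective e2).symm)

end Bouquet

/-! ### The operadic Grothendieck construction -/

namespace OperadicCategory

variable {O : Type u} [Category.{v} O] [OperadicCategory O]

theorem incl_incl {T S R : O} (f : T ⟶ S) (g : S ⟶ R) (h : T ⟶ R) (w : f ≫ g = h)
    (i : Fin (card R)) (j : Fin (card (fiber g i)))
    (x : Fin (card (fiber (fiberMap f g h w i) j))) (y : Fin (card (fiber f (incl g i j))))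
    (hxy : x.val = y.val) :
    incl h i (incl (fiberMap f g h w i) j x) = incl f (incl g i j) y := by
  have hc : card (fiber (fiberMap f g h w i) j) = card (fiber f (incl g i j)) :=
    congrArg card (fiber_fiberMap' f g h w i j)
  have key := fiberEmb_unique (φ := cardMap f) (i := incl g i j)
    (h := card_fiber f (incl g i j))
    (e := fun y => incl h i (incl (fiberMap f g h w i) j (Fin.cast hc.symm y)))
    (fun a b hab => (incl h i).strictMono ((incl _ j).strictMono hab))
    (fun z => by
      have := cardMap_fiberMap f g h w i (incl (fiberMap f g h w i) j (Fin.cast hc.symm z))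
      rw [cardMap_incl] at this
      exact this.symm)
  have h2 := congrFun key y
  have h3 : Fin.cast hc.symm y = x := Fin.ext hxy.symm
  rw [h3] at h2
  exact h2

theorem incl_id (T : O) (i : Fin (card T)) (j : Fin (card (fiber (𝟙 T) i))) :
    incl (𝟙 T) i j = i := by
  have := cardMap_incl (𝟙 T) i j
  rwa [cardMap_id] at this

end OperadicCategory

section Groth

variable {O : Type u} [Category.{v} O] [OperadicCategory O]

namespace SetOperad

variable (P : SetOperad.{u, v, w} O)

theorem γ_heq {T T' S S' : O} (hT : T = T') (hS : S = S') {f : T ⟶ S} {f' : T' ⟶ S'}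
    (hf : HEq f f') {ε : ∀ i, P.obj (fiber f i)} {ε' : ∀ i, P.obj (fiber f' i)}
    (hε : ∀ i i', i.val = i'.val → HEq (ε i) (ε' i')) {s : P.obj S} {s' : P.obj S'}
    (hs : HEq s s') : HEq (P.γ f ε s) (P.γ f' ε' s') := by
  subst hT hS
  obtain rfl := eq_of_heq hf
  obtain rfl := eq_of_heq hs
  obtain rfl : ε = ε' := funext fun i => eq_of_heq (hε i i rfl)
  rfl

theorem unit_heq {c d : π₀ O} (h : c = d) : HEq (P.unit c) (P.unit d) := by subst h; rfl

theorem γ_id {T S : O} (hS : T = S) (f : T ⟶ S) (hf : HEq f (𝟙 T)) (ε : ∀ i, P.obj (fiber f i))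
    (hε : ∀ i, HEq (ε i) (P.unit (comp₀ (fiber f i)))) (s : P.obj S) : HEq (P.γ f ε s) s := by
  subst hS
  obtain rfl := eq_of_heq hf
  exact heq_of_eq (P.unit_left _ _ _ hε)

theorem γ_U {T S : O} {c : π₀ O} (hS : S = U c) (f : T ⟶ S) (ε : ∀ i, P.obj (fiber f i))
    (t : P.obj T) (hε : ∀ i, HEq (ε i) t) (s : P.obj S) (hs : HEq s (P.unit c)) :
    P.γ f ε s = t := by
  subst hS
  obtain rfl := eq_of_heq hs
  exact P.unit_right _ _ _ hε

/-- Objects of the operadic Grothendieck construction: elements `t ∈ P(T)` for some `T`. -/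
structure Groth where
  /-- the underlying object `T` -/
  base : O
  /-- the element `t ∈ P(T)` -/
  elt : P.obj base

namespace Groth

variable {P}

theorem ext' {X Y : Groth P} (h : X.base = Y.base) (h' : HEq X.elt Y.elt) : X = Y := by
  obtain ⟨T, t⟩ := X
  obtain ⟨S, s⟩ := Y
  subst h
  obtain rfl := eq_of_heq h'
  rfl

/-- A morphism from `t ∈ P(T)` to `s ∈ P(S)`: a pair of a morphism `f : T ⟶ S` and
`ε ∈ ∏ P(f⁻¹(i))` such that `γ_f(ε, s) = t`. -/
structure Hom (X Y : Groth P) where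
  /-- the underlying morphism -/
  base : X.base ⟶ Y.base
  /-- the elements over the fibers -/
  ε : ∀ i, P.obj (fiber base i)
  eq : P.γ base ε Y.elt = X.elt

theorem Hom.ext' {X Y : Groth P} {f g : Hom X Y} (h : f.base = g.base)
    (h' : ∀ i, HEq (f.ε i) (g.ε i)) : f = g := by
  obtain ⟨f, ε, _⟩ := f
  obtain ⟨g, δ, _⟩ := g
  obtain rfl : f = g := h
  obtain rfl : ε = δ := funext fun i => eq_of_heq (h' i)
  rfl

theorem Hom.heq {X X' Y Y' : Groth P} (hX : X = X') (hY : Y = Y') {f : Hom X Y} {g : Hom X' Y'}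
    (h : HEq f.base g.base) (h' : ∀ i i', i.val = i'.val → HEq (f.ε i) (g.ε i')) : HEq f g := by
  subst hX hY
  exact heq_of_eq (Hom.ext' (eq_of_heq h) (fun i => h' i i rfl))

theorem ε_heq {X Y : Groth P} {f g : Hom X Y} (h : f = g) {i i' : Fin (card Y.base)}
    (hi : i = i') : HEq (f.ε i) (g.ε i') := by
  subst h hi; rfl

/-- The family of elements over the fibers of `f_i`, obtained from a family of elements over the
fibers of `f`. -/
def res {T S R : O} (f : T ⟶ S) (g : S ⟶ R) (h : T ⟶ R) (w : f ≫ g = h)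
    (ε : ∀ j, P.obj (fiber f j)) (i : Fin (card R)) (j : Fin (card (fiber g i))) :
    P.obj (fiber (fiberMap f g h w i) j) :=
  cast (congrArg P.obj (fiber_fiberMap' f g h w i j).symm) (ε (incl g i j))

theorem res_heq {T S R : O} (f : T ⟶ S) (g : S ⟶ R) (h : T ⟶ R) (w : f ≫ g = h)
    (ε : ∀ j, P.obj (fiber f j)) (i : Fin (card R)) (j : Fin (card (fiber g i))) :
    HEq (res f g h w ε i j) (ε (incl g i j)) := cast_heq _ _

/-- The identity morphism: the elements over the fibers are the units. -/
def Hom.id (X : Groth P) : Hom X X where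
  base := 𝟙 X.base
  ε i := cast (congrArg P.obj (U_comp₀_fiber_id X.base i)) (P.unit (comp₀ (fiber (𝟙 X.base) i)))
  eq := P.unit_left _ _ _ (fun _ => cast_heq _ _)

/-- The composition of morphisms. -/
def Hom.comp {X Y Z : Groth P} (f : Hom X Y) (g : Hom Y Z) : Hom X Z where
  base := f.base ≫ g.base
  ε i := P.γ (fiberMap f.base g.base _ rfl i) (res f.base g.base _ rfl f.ε i) (g.ε i)
  eq := by
    rw [P.assoc f.base g.base _ rfl _ f.ε _ _ (fun i j => res_heq _ _ _ _ _ i j), g.eq, f.eq]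

theorem fiberMap_congr {T S R : O} {f : T ⟶ S} {g : S ⟶ R} {h h' : T ⟶ R} (w : f ≫ g = h)
    (w' : f ≫ g = h') (i : Fin (card R)) : HEq (fiberMap f g h w i) (fiberMap f g h' w' i) := by
  subst w; subst w'; rfl

instance : Category (Groth P) where
  Hom := Hom
  id := Hom.id
  comp := Hom.comp
  id_comp {X Y} f := Hom.ext' (Category.id_comp f.base) (fun i => by
    have hT : fiber (𝟙 X.base ≫ f.base) i = fiber f.base i := by rw [Category.id_comp]
    refine P.γ_id hT _ ?_ _ ?_ _
    · have h1 := fiberMap_id f.base i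
      have h2 : HEq (𝟙 (fiber (𝟙 X.base ≫ f.base) i)) (𝟙 (fiber f.base i)) := by rw [hT]
      refine HEq.trans ?_ ((heq_of_eq h1).trans h2.symm)
      exact fiberMap_congr rfl _ i
    · intro j
      refine (res_heq _ _ _ _ _ i j).trans ((cast_heq _ _).trans (P.unit_heq ?_))
      exact congrArg comp₀ (fiber_fiberMap' _ _ _ _ i j).symm)
  comp_id {X Y} f := Hom.ext' (Category.comp_id f.base) (fun i => by
    have hT : fiber (f.base ≫ 𝟙 Y.base) i = fiber f.base i := by rw [Category.comp_id]
    refine HEq.trans (heq_of_eq ?_) (cast_heq (congrArg P.obj hT.symm) (f.ε i))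
    refine P.γ_U (U_comp₀_fiber_id Y.base i).symm _ _ _ ?_ _ (cast_heq _ _)
    intro j
    refine (res_heq _ _ _ _ _ i j).trans ((ε_heq rfl (incl_id _ _ _)).trans (cast_heq _ _).symm))
  assoc {X Y Z W} f g k := Hom.ext' (Category.assoc f.base g.base k.base) (fun i => by
    have hT : (f.base ≫ g.base) ≫ k.base = f.base ≫ (g.base ≫ k.base) := Category.assoc _ _ _
    have w := fiberMap_comp f.base g.base (f.base ≫ (g.base ≫ k.base)) _ k.base rfl rfl hT i
    have := P.assoc (fiberMap f.base (g.base ≫ k.base) _ rfl i) (fiberMap g.base k.base _ rfl i)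
      (fiberMap (f.base ≫ g.base) k.base _ hT i) w.symm
      (fun j x => res _ _ _ w.symm (res f.base (g.base ≫ k.base) _ rfl f.ε i) j x)
      (res f.base (g.base ≫ k.base) _ rfl f.ε i)
      (res g.base k.base _ rfl g.ε i) (k.ε i) (fun j x => res_heq _ _ _ _ _ j x)
    refine HEq.trans ?_ (heq_of_eq this)
    refine P.γ_heq (congrArg (fun q => fiber q i) hT) rfl (fiberMap_congr _ _ i) ?_ HEq.rfl
    intro j j' hj
    obtain rfl : j = j' := Fin.ext hj
    refine (res_heq _ _ _ _ _ i j).trans ?_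
    refine P.γ_heq ?_ ?_ ?_ ?_ (res_heq _ _ _ _ _ i j).symm
    · exact (fiber_fiberMap' _ _ _ _ i j).symm
    · exact (fiber_fiberMap' _ _ _ _ i j).symm
    · exact (fiberMap_fiberMap f.base g.base _ k.base _ _ rfl rfl rfl hT i w.symm j).symm
    · intro x x' hx
      refine (res_heq _ _ _ _ _ _ x).trans (HEq.trans ?_ (res_heq _ _ _ _ _ _ x').symm)
      refine HEq.trans ?_ (res_heq _ _ _ _ _ _ _).symm
      exact ε_heq rfl (incl_incl g.base k.base _ rfl i j x' x hx.symm).symm)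

theorem comp_base {X Y Z : Groth P} (f : X ⟶ Y) (g : Y ⟶ Z) :
    Hom.base (f ≫ g) = Hom.base f ≫ Hom.base g := rfl

theorem id_base (X : Groth P) : Hom.base (𝟙 X) = 𝟙 X.base := rfl

variable (P) in
/-- The projection of the Grothendieck construction to `O`. -/
def proj : Groth P ⥤ O where
  obj := base
  map := Hom.base

/-- The chosen local terminal objects are the units of the operad. -/
def unitObj (c : π₀ O) : Groth P := ⟨U c, P.unit c⟩

/-- The unique morphism to a chosen local terminal object. -/
def toUnit (X : Groth P) : X ⟶ unitObj (comp₀ X.base) where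
  base := (U_terminal X.base).some.default
  ε i := cast (congrArg P.obj (fiber_U _ i).symm) X.elt
  eq := P.unit_right _ _ _ (fun _ => cast_heq _ _)

theorem toUnit_unique {X : Groth P} (f : X ⟶ unitObj (comp₀ X.base)) : f = toUnit X := by
  have hb : f.base = (toUnit X).base := (U_terminal X.base).some.uniq _
  refine Hom.ext' hb (fun i => ?_)
  refine HEq.trans ?_ (cast_heq _ _).symm
  have hT : fiber f.base i = X.base := fiber_U (c := comp₀ X.base) f.base i
  have h1 : P.γ f.base f.ε (P.unit _) = X.elt := f.eq
  have h2 := P.unit_right (c := comp₀ X.base) f.base f.ε (cast (congrArg P.obj hT) (f.ε i)) (by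
    intro j
    have : Subsingleton (Fin (card (U (comp₀ X.base)))) := by rw [card_U]; infer_instance
    exact (ε_heq rfl (Subsingleton.elim j i)).trans (cast_heq _ _).symm)
  exact (cast_heq (congrArg P.obj hT) (f.ε i)).symm.trans (heq_of_eq (h2.symm.trans h1))

/-- The fibers of a morphism in the Grothendieck construction. -/
def fib {X Y : Groth P} (f : X ⟶ Y) (i : Fin (card Y.base)) : Groth P := ⟨fiber f.base i, f.ε i⟩

/-- The maps induced on the fibers. -/
def fibMap {X Y Z : Groth P} (f : X ⟶ Y) (g : Y ⟶ Z) (h : X ⟶ Z) (w : f ≫ g = h)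
    (i : Fin (card Z.base)) : fib h i ⟶ fib g i where
  base := fiberMap f.base g.base h.base (congrArg Hom.base w) i
  ε := res f.base g.base h.base (congrArg Hom.base w) f.ε i
  eq := by subst w; rfl

theorem fib_unitObj {X : Groth P} {c : π₀ O} (f : X ⟶ unitObj c) (i : Fin (card (U c))) :
    fib f i = X := by
  have hc : c = comp₀ X.base := ((comp₀_eq_of_hom f.base).trans (comp_U c)).symm
  subst hc
  rw [toUnit_unique f]
  exact ext' (fiber_U _ i) (cast_heq _ _)

theorem fib_fibMap {X Y Z : Groth P} (f : X ⟶ Y) (g : Y ⟶ Z) (h : X ⟶ Z) (w : f ≫ g = h)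
    (i : Fin (card Z.base)) (j : Fin (card (fiber g.base i))) :
    fib (fibMap f g h w i) j = fib f (incl g.base i j) :=
  ext' (fiber_fiberMap' _ _ _ _ i j) (res_heq _ _ _ _ _ i j)

instance : OperadicCategory (Groth P) where
  card X := card X.base
  cardMap f := cardMap f.base
  cardMap_id X t := cardMap_id X.base t
  cardMap_comp f g t := cardMap_comp f.base g.base t
  U c := unitObj ((proj P).mapConnectedComponents c)
  comp_U := by
    intro c
    induction c using Quotient.inductionOn' with
    | h X => exact (comp₀_eq_of_hom (toUnit X)).symm
  U_terminal X := ⟨⟨⟨toUnit X⟩, toUnit_unique⟩⟩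
  card_U c := card_U _
  fiber f i := fib f i
  card_fiber f i := card_fiber f.base i
  fiber_id X i := ⟨comp₀ (unitObj (comp₀ (fiber (𝟙 X.base) i))), ext'
    ((U_comp₀_fiber_id X.base i).symm.trans (congrArg U (comp_U _).symm))
    ((cast_heq _ _).trans (P.unit_heq (comp_U _).symm))⟩
  fiberMap f g h w i := fibMap f g h w i
  cardMap_fiberMap f g h w i x := cardMap_fiberMap f.base g.base h.base (congrArg Hom.base w) i x
  fiberMap_id h i := Hom.ext' (fiberMap_id h.base i) (fun j => by
    refine (res_heq _ _ _ _ _ i j).trans ((cast_heq _ _).trans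
      (HEq.trans (P.unit_heq ?_) (cast_heq _ _).symm))
    exact src_fiber h.base i j)
  fiberMap_comp f f' h g g' w w' w'' i :=
    Hom.ext' (fiberMap_comp f.base f'.base h.base g.base g'.base (congrArg Hom.base w)
      (congrArg Hom.base w') (congrArg Hom.base w'') i) (fun j => by
    refine (res_heq _ _ _ _ _ i j).trans ?_
    subst w'
    have w0 := fiberMap_comp f.base f'.base h.base _ g'.base (congrArg Hom.base w)
      rfl (congrArg Hom.base w'') i
    have h5 := fiberMap_fiberMap f.base f'.base _ g'.base _ h.base rfl rfl
      (congrArg Hom.base w) (congrArg Hom.base w'') i w0.symm j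
    have h6 : HEq (fiberMap _ _ _ w0.symm j) (fiberMap (fiberMap f.base _ h.base
      (congrArg Hom.base w) i) (fiberMap f'.base g'.base _ rfl i) _ rfl j) :=
      fiberMap_congr _ _ j
    refine P.γ_heq ?_ ?_ (h5.symm.trans h6) ?_ (res_heq _ _ _ _ _ i j).symm
    · exact (fiber_fiberMap' _ _ _ (congrArg Hom.base w'') i j).symm.trans
        (congrArg (fun q => fiber q j) w0)
    · exact (fiber_fiberMap' _ _ _ _ i j).symm
    · intro x x' hx
      refine (res_heq _ _ _ _ _ _ x).trans (HEq.trans ?_ (res_heq _ _ _ _ _ _ x').symm)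
      refine HEq.trans ?_ (res_heq _ _ _ _ _ _ _).symm
      exact ε_heq rfl (incl_incl f'.base g'.base _ rfl i j x' x hx.symm).symm)
  fiber_U h i := fib_unitObj h i
  fiberMap_U {T S c} f g h w i := Hom.heq (fib_unitObj h i) (fib_unitObj g i)
    (fiberMap_U f.base g.base h.base (congrArg Hom.base w) i) (by
      intro j j' hj
      refine (res_heq _ _ _ _ _ i j).trans (ε_heq rfl ?_)
      have key := fiberEmb_unique (φ := cardMap g.base) (i := i) (h := card_fiber g.base i)
        (e := Fin.cast (congrArg card (fiber_U g.base i))) (fun a b hab => hab)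
        (fun z => by
          have e := card_U ((proj P).mapConnectedComponents c)
          have h1 := (cardMap g.base
            (Fin.cast (congrArg card (fiber_U g.base i)) z)).isLt.trans_eq e
          have h2 := i.isLt.trans_eq e
          exact Fin.ext ((Nat.lt_one_iff.1 h1).trans (Nat.lt_one_iff.1 h2).symm))
      exact (congrFun key j).symm.trans (Fin.ext hj))
  fiber_fiberMap f g h w i j := fib_fibMap f g h w i j
  fiberMap_fiberMap f a b c g h hb hg hh hh' i hi j :=
    Hom.heq (fib_fibMap _ _ _ _ i j) (fib_fibMap _ _ _ _ i j)
      (fiberMap_fiberMap f.base a.base b.base c.base g.base h.base (congrArg Hom.base hb)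
        (congrArg Hom.base hg) (congrArg Hom.base hh) (congrArg Hom.base hh') i
        (congrArg Hom.base hi) j) (by
      intro x x' hx
      refine (res_heq _ _ _ _ _ j x).trans ((res_heq _ _ _ _ _ i _).trans
        (HEq.trans ?_ (res_heq _ _ _ _ _ _ x').symm))
      exact ε_heq rfl (incl_incl a.base c.base _ (congrArg Hom.base hg) i j x x' hx))

end Groth

end SetOperad

end Groth

/-! ### The coloured operad whose algebras are `O`-operads -/

section POperad

variable {O : Type u} [Category.{v} O] [OperadicCategory O]

open Bouquet

/-- The bouquet `(S, F₁,…,F_k; T)`, where `F₁,…,F_k` are the fibers of `f : T ⟶ S`. -/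
def genBouquet {T S : O} (f : T ⟶ S) : Bouquet O :=
  ⟨card S + 1, Fin.cons (α := fun _ => O) S (fiber f), T⟩

/-- The bouquet `(∅; T)`. -/
def nullary (T : O) : Bouquet O := ⟨0, Fin.elim0, T⟩

/-- The bouquet `(R, G₁,…,G_k, F₁,…,F_l; T)`, where `G₁,…,G_k` are the fibers of `g : S ⟶ R` and
`F₁,…,F_l` are the fibers of `f : T ⟶ S`. -/
def assocBouquet {T S R : O} (f : T ⟶ S) (g : S ⟶ R) : Bouquet O :=
  ⟨(card R + 1) + card S,
    Fin.append (Fin.cons (α := fun _ => O) R (fiber g)) (fiber f), T⟩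

/-- The map `(R, G₁,…,G_k, F₁,…,F_l; T) ⟶ (S, F₁,…,F_l; T)` which sends `R` and all `G_i` to `S`,
and `F_j` to `F_j`. Its fibers are `(R, G₁,…,G_k; S)` and the `(F_j; F_j)`. -/
def assocLeft {T S R : O} (f : T ⟶ S) (g : S ⟶ R) : assocBouquet f g ⟶ genBouquet f where
  map := Fin.append (fun _ : Fin (card R + 1) => (0 : Fin (card S + 1))) Fin.succ
  root_eq := rfl

/-- The map `(R, G₁,…,G_k, F₁,…,F_l; T) ⟶ (R, H₁,…,H_k; T)`, where the `H_i` are the fibers of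
`h = f ≫ g`, which sends `R` to `R`, and sends `G_i` and all `F_j` with `|g|(j) = i` to `H_i`. Its
fibers are `(R; R)` and the bouquets `(G_i, F_i¹, F_i²,…; H_i)`, where `F_i¹, F_i²,…` are the
fibers of `f_i : H_i ⟶ G_i`. -/
def assocRight {T S R : O} (f : T ⟶ S) (g : S ⟶ R) (h : T ⟶ R) :
    assocBouquet f g ⟶ genBouquet h where
  map := Fin.append (fun x : Fin (card R + 1) => x) (fun j => (cardMap g j).succ)
  root_eq := rfl

theorem assocBouquet_col_castAdd {T S R : O} (f : T ⟶ S) (g : S ⟶ R) (x : Fin (card R + 1)) :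
    (assocBouquet f g).col (Fin.castAdd (card S) x) =
      Fin.cons (α := fun _ => O) R (fiber g) x :=
  Fin.append_left (Fin.cons (α := fun _ => O) R (fiber g)) (fiber f) x

theorem assocBouquet_col_natAdd {T S R : O} (f : T ⟶ S) (g : S ⟶ R) (j : Fin (card S)) :
    (assocBouquet f g).col (Fin.natAdd (card R + 1) j) = fiber f j :=
  Fin.append_right (Fin.cons (α := fun _ => O) R (fiber g)) (fiber f) j

theorem assocLeft_castAdd {T S R : O} (f : T ⟶ S) (g : S ⟶ R) (x : Fin (card R + 1)) :
    (assocLeft f g).map (Fin.castAdd (card S) x) = (0 : Fin (card S + 1)) :=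
  Fin.append_left (fun _ : Fin (card R + 1) => (0 : Fin (card S + 1))) Fin.succ x

theorem assocLeft_natAdd {T S R : O} (f : T ⟶ S) (g : S ⟶ R) (j : Fin (card S)) :
    (assocLeft f g).map (Fin.natAdd (card R + 1) j) = Fin.succ j :=
  Fin.append_right (fun _ : Fin (card R + 1) => (0 : Fin (card S + 1))) Fin.succ j

theorem assocRight_castAdd {T S R : O} (f : T ⟶ S) (g : S ⟶ R) (h : T ⟶ R)
    (x : Fin (card R + 1)) : (assocRight f g h).map (Fin.castAdd (card S) x) = x :=
  Fin.append_left (fun x : Fin (card R + 1) => x) (fun j => (cardMap g j).succ) x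

theorem assocRight_natAdd {T S R : O} (f : T ⟶ S) (g : S ⟶ R) (h : T ⟶ R) (j : Fin (card S)) :
    (assocRight f g h).map (Fin.natAdd (card R + 1) j) = Fin.succ (cardMap g j) :=
  Fin.append_right (fun x : Fin (card R + 1) => x) (fun j => (cardMap g j).succ) j

theorem castAdd_ne_natAdd {a b : ℕ} (x : Fin a) (y : Fin b) :
    Fin.castAdd b x ≠ Fin.natAdd a y := by
  intro h
  have h1 := congrArg Fin.val h
  have h2 := x.isLt
  simp at h1
  omega

theorem fib_assocLeft_zero {T S R : O} (f : T ⟶ S) (g : S ⟶ R) :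
    fib (assocLeft f g) (0 : Fin (card S + 1)) = genBouquet g := by
  refine fib_eq (assocLeft f g) _ (genBouquet g) (Fin.castAdd (card S) : Fin (card R + 1) → _)
    (Fin.strictMono_castAdd _) ?_ (fun x => (assocBouquet_col_castAdd f g x).symm) rfl
  refine Fin.addCases (fun x => ?_) (fun j => ?_)
  · exact ⟨fun _ => ⟨x, rfl⟩, fun _ => assocLeft_castAdd f g x⟩
  · refine ⟨fun hj => ?_, fun ⟨x, hx⟩ => ?_⟩
    · exact absurd ((assocLeft_natAdd f g j).symm.trans hj) (Fin.succ_ne_zero j)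
    · exact absurd hx (castAdd_ne_natAdd (a := card R + 1) x j)

theorem fib_assocLeft_succ {T S R : O} (f : T ⟶ S) (g : S ⟶ R) (j : Fin (card S)) :
    fib (assocLeft f g) j.succ = corolla (fiber f j) := by
  refine fib_eq (assocLeft f g) _ (corolla (fiber f j)) (fun _ => Fin.natAdd (card R + 1) j)
    (Subsingleton.strictMono (α := Fin 1) _) ?_ (fun _ => (assocBouquet_col_natAdd f g j).symm) rfl
  refine Fin.addCases (fun x => ?_) (fun j' => ?_)
  · refine ⟨fun hj => ?_, fun ⟨_, hx⟩ => ?_⟩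
    · exact absurd ((assocLeft_castAdd f g x).symm.trans hj).symm (Fin.succ_ne_zero j)
    · exact absurd hx.symm (castAdd_ne_natAdd _ _)
  · refine ⟨fun hj => ⟨(0 : Fin 1), ?_⟩, fun ⟨_, hx⟩ => ?_⟩
    · rw [Fin.succ_injective _ ((assocLeft_natAdd f g j').symm.trans hj)]
    · obtain rfl := (Fin.natAdd_inj _).1 hx
      exact assocLeft_natAdd f g j

theorem fib_assocRight_zero {T S R : O} (f : T ⟶ S) (g : S ⟶ R) (h : T ⟶ R) :
    fib (assocRight f g h) (0 : Fin (card R + 1)) = corolla R := by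
  refine fib_eq (assocRight f g h) _ (corolla R)
    (fun _ => Fin.castAdd (card S) (0 : Fin (card R + 1)))
    (Subsingleton.strictMono (α := Fin 1) _) ?_
    (fun _ => (assocBouquet_col_castAdd f g 0).symm) rfl
  refine Fin.addCases (fun x => ?_) (fun j => ?_)
  · refine ⟨fun hj => ⟨(0 : Fin 1), ?_⟩, fun ⟨_, hx⟩ => ?_⟩
    · rw [show x = 0 from (assocRight_castAdd f g h x).symm.trans hj]
    · obtain rfl := Fin.castAdd_injective _ _ hx
      exact assocRight_castAdd f g h 0
  · refine ⟨fun hj => ?_, fun ⟨_, hx⟩ => ?_⟩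
    · exact absurd ((assocRight_natAdd f g h j).symm.trans hj) (Fin.succ_ne_zero _)
    · exact absurd hx (castAdd_ne_natAdd _ _)

/-- The enumeration of the fiber of `assocRight` over the element `i`. -/
def assocRightEnum {S R : O} (g : S ⟶ R) (i : Fin (card R)) :
    Fin (card (fiber g i) + 1) → Fin (card R + 1 + card S) :=
  Fin.cons (α := fun _ => Fin (card R + 1 + card S)) (Fin.castAdd (card S) i.succ)
    (fun j => Fin.natAdd (card R + 1) (incl g i j))

theorem assocRightEnum_strictMono {S R : O} (g : S ⟶ R) (i : Fin (card R)) :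
    StrictMono (assocRightEnum g i) := by
  intro a b hab
  revert a b
  refine Fin.cases (Fin.cases (fun h => absurd h (lt_irrefl _)) (fun j _ => ?_))
    (fun j => Fin.cases (fun h => ?_) (fun j' h => ?_))
  · rw [assocRightEnum, Fin.cons_zero, Fin.cons_succ, Fin.lt_def]
    have := i.succ.isLt
    simp only [Fin.val_castAdd, Fin.val_natAdd]
    omega
  · exact absurd h (Fin.not_lt_zero _)
  · rw [assocRightEnum, Fin.cons_succ, Fin.cons_succ]
    have h2 := (incl g i).strictMono (Fin.succ_lt_succ_iff.1 h)
    rw [Fin.lt_def] at h2 ⊢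
    simpa using h2

theorem fib_assocRight_succ {T S R : O} (f : T ⟶ S) (g : S ⟶ R) (h : T ⟶ R) (w : f ≫ g = h)
    (i : Fin (card R)) :
    fib (assocRight f g h) i.succ = genBouquet (fiberMap f g h w i) := by
  refine fib_eq (assocRight f g h) _ (genBouquet (fiberMap f g h w i)) (assocRightEnum g i)
    (assocRightEnum_strictMono g i) ?_ ?_ rfl
  · refine Fin.addCases (fun x => ?_) (fun j => ?_)
    · refine ⟨fun hj => ⟨(0 : Fin (_ + 1)), ?_⟩, fun ⟨y, hy⟩ => ?_⟩
      · rw [show x = i.succ from (assocRight_castAdd f g h x).symm.trans hj]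
        rfl
      · revert y
        refine Fin.cases (fun hy => ?_) (fun j hy => ?_)
        · obtain rfl := Fin.castAdd_injective _ _
            (show Fin.castAdd (card S) i.succ = Fin.castAdd (card S) x from hy)
          exact assocRight_castAdd f g h _
        · exact absurd (show Fin.natAdd (card R + 1) (incl g i j) = Fin.castAdd (card S) x
            from hy).symm (castAdd_ne_natAdd _ _)
    · refine ⟨fun hj => ?_, fun ⟨y, hy⟩ => ?_⟩
      · obtain ⟨x, rfl⟩ := exists_incl_eq g
          (Fin.succ_injective _ ((assocRight_natAdd f g h j).symm.trans hj))
        exact ⟨Fin.succ x, rfl⟩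
      · revert y
        refine Fin.cases (fun hy => ?_) (fun j' hy => ?_)
        · exact absurd (show Fin.castAdd (card S) i.succ = Fin.natAdd (card R + 1) j from hy)
            (castAdd_ne_natAdd _ _)
        · obtain rfl := (Fin.natAdd_inj _).1
            (show Fin.natAdd (card R + 1) (incl g i j') = Fin.natAdd (card R + 1) j from hy)
          exact (assocRight_natAdd f g h _).trans (congrArg Fin.succ (cardMap_incl g i j'))
  · refine Fin.cases ?_ (fun j => ?_)
    · exact (assocBouquet_col_castAdd f g i.succ).symm
    · exact (fiber_fiberMap' f g h w i j).trans (assocBouquet_col_natAdd f g _).symm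

/-- The map `(T; T) ⟶ (S, F₁,…,F_k; T)` with image the `i`th element. -/
def pickMap {T S : O} (f : T ⟶ S) (i : Fin (card S + 1)) : corolla T ⟶ genBouquet f where
  map := fun _ => i
  root_eq := rfl

theorem fib_pickMap_self {T S : O} (f : T ⟶ S) (i : Fin (card S + 1))
    (hT : (genBouquet f).col i = T) : fib (pickMap f i) i = corolla T :=
  fib_eq (pickMap f i) _ (corolla T) id strictMono_id (fun t => ⟨fun _ => ⟨t, rfl⟩, fun _ => rfl⟩)
    (fun _ => rfl) hT.symm

theorem fib_pickMap_of_ne {T S : O} (f : T ⟶ S) {i i' : Fin (card S + 1)} (h : i ≠ i') :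
    fib (pickMap f i) i' = nullary ((genBouquet f).col i') :=
  fib_eq (pickMap f i) _ (nullary _) Fin.elim0 (fun a => a.elim0)
    (fun _ => ⟨fun h' => absurd h' h, fun ⟨x, _⟩ => x.elim0⟩) (fun x => x.elim0) rfl

variable (O) in
/-- Formal operadic composites of the generators `Γ_f ∈ P(S, F₁,…,F_k; T)`, for the morphisms
`f : T ⟶ S` of `O` with fibers `F₁,…,F_k`, and `Γ_U ∈ P(∅; U)`, for the chosen local terminal
objects `U` of `O`. -/
inductive Term : Bouquet O → Type (max u v)
  | unit (T : O) : Term (corolla T)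
  | comp {b c : Bouquet O} (f : b ⟶ c) (p : ∀ y : Fin c.n, Term (fib f y)) (x : Term c) : Term b
  | gen {T S : O} (f : T ⟶ S) : Term (genBouquet f)
  | genU (c : π₀ O) : Term (nullary (U c))

/-- The congruence on formal composites which is generated by the axioms of an operad, and by the
relations (associativity)
`Γ_f(Γ_g, e_{F₁}, e_{F₂},…) = Γ_h(e_R, Γ_{f_1},…,Γ_{f_k})` (up to the permutation of the inputs),
(unitality 1) `Γ_{1_T}(e_T, Γ_{U₁},…,Γ_{U_n}) = e_T`, and (unitality 2) `Γ_{!_T}(Γ_U, e_T) = e_T`.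
-/
inductive Rel : ∀ {b : Bouquet O}, Term O b → Term O b → Prop
  | refl {b : Bouquet O} (x : Term O b) : Rel x x
  | symm {b : Bouquet O} {x y : Term O b} : Rel x y → Rel y x
  | trans {b : Bouquet O} {x y z : Term O b} : Rel x y → Rel y z → Rel x z
  | congr {b c : Bouquet O} (f : b ⟶ c) {p p' : ∀ y : Fin c.n, Term O (fib f y)}
      {x x' : Term O c} : (∀ y, Rel (p y) (p' y)) → Rel x x' →
      Rel (Term.comp f p x) (Term.comp f p' x')
  | assoc {a b c : Bouquet O} (f : a ⟶ b) (g : b ⟶ c) (h : a ⟶ c) (w : f ≫ g = h)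
      (ε' : ∀ i j, Term O (fib (fibMap f g h w i) j)) (ε : ∀ j, Term O (fib f j))
      (δ : ∀ i, Term O (fib g i)) (r : Term O c) :
      (∀ i j, HEq (ε' i j) (ε (inc g i j))) →
      Rel (Term.comp h (fun i => Term.comp (fibMap f g h w i) (ε' i) (δ i)) r)
        (Term.comp f ε (Term.comp g δ r))
  | unit_left {b : Bouquet O} (ε : ∀ i, Term O (fib (𝟙 b) i)) (x : Term O b) :
      (∀ i, HEq (ε i) (Term.unit (b.col i))) → Rel (Term.comp (𝟙 b) ε x) x
  | unit_right {b : Bouquet O} {T : O} (f : b ⟶ corolla T) (ε : ∀ i, Term O (fib f i))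
      (x : Term O b) : (∀ i, HEq (ε i) x) → Rel (Term.comp f ε (Term.unit T)) x
  | gen_assoc {T S R : O} (f : T ⟶ S) (g : S ⟶ R) (h : T ⟶ R) (w : f ≫ g = h)
      (p : ∀ y : Fin (card S + 1), Term O (fib (assocLeft f g) y))
      (q : ∀ y : Fin (card R + 1), Term O (fib (assocRight f g h) y)) :
      HEq (p 0) (Term.gen g) → (∀ j, HEq (p (Fin.succ j)) (Term.unit (fiber f j))) →
      HEq (q 0) (Term.unit R) → (∀ i, HEq (q (Fin.succ i)) (Term.gen (fiberMap f g h w i))) →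
      Rel (Term.comp (assocLeft f g) p (Term.gen f))
        (Term.comp (assocRight f g h) q (Term.gen h))
  | gen_unit_left (T : O) (p : ∀ y : Fin (card T + 1), Term O (fib (pickMap (𝟙 T) 0) y)) :
      HEq (p 0) (Term.unit T) →
      (∀ i, HEq (p (Fin.succ i)) (Term.genU (comp₀ (fiber (𝟙 T) i)))) →
      Rel (Term.comp (pickMap (𝟙 T) 0) p (Term.gen (𝟙 T))) (Term.unit T)
  | gen_unit_right {T : O} {c : π₀ O} (f : T ⟶ U c) (i : Fin (card (U c)))
      (p : ∀ y : Fin (card (U c) + 1), Term O (fib (pickMap f i.succ) y)) :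
      HEq (p 0) (Term.genU c) → HEq (p i.succ) (Term.unit T) →
      Rel (Term.comp (pickMap f i.succ) p (Term.gen f)) (Term.unit T)

/-- The equivalence relation on formal composites. -/
def termSetoid (b : Bouquet O) : Setoid (Term O b) :=
  ⟨Rel, Rel.refl, Rel.symm, Rel.trans⟩

/-- The operations of the operad: the equivalence classes of the formal composites. -/
def Oper (b : Bouquet O) : Type (max u v) := Quotient (termSetoid b)

/-- The class of a formal composite. -/
def Oper.mk {b : Bouquet O} (x : Term O b) : Oper b := Quotient.mk (termSetoid b) x

/-- A representative of an operation. -/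
def Oper.out {b : Bouquet O} (x : Oper b) : Term O b := Quotient.out x

theorem Oper.mk_out {b : Bouquet O} (x : Oper b) : Oper.mk x.out = x := Quotient.out_eq x

theorem Oper.sound {b : Bouquet O} {x y : Term O b} (h : Rel x y) : Oper.mk x = Oper.mk y :=
  Quotient.sound (s := termSetoid b) h

theorem Oper.rel_out {b : Bouquet O} (x : Term O b) : Rel (Oper.mk x).out x :=
  Quotient.exact (s := termSetoid b) (Oper.mk_out _)

/-- The composition of operations. -/
def Oper.comp {b c : Bouquet O} (f : b ⟶ c) (p : ∀ y : Fin c.n, Oper (fib f y)) (x : Oper c) :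
    Oper b :=
  Oper.mk (Term.comp f (fun y => (p y).out) x.out)

theorem Oper.comp_mk {b c : Bouquet O} (f : b ⟶ c) (p : ∀ y : Fin c.n, Term O (fib f y))
    (x : Term O c) : Oper.comp f (fun y => Oper.mk (p y)) (Oper.mk x) = Oper.mk (Term.comp f p x) :=
  Oper.sound (Rel.congr f (fun y => Oper.rel_out (p y)) (Oper.rel_out x))

theorem Oper.mk_heq {b c : Bouquet O} (h : b = c) {x : Term O b} {y : Term O c} (hxy : HEq x y) :
    HEq (Oper.mk x) (Oper.mk y) := by
  subst h; obtain rfl := eq_of_heq hxy; rfl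

variable (O) in
/-- The classical coloured operad `P(O)`, with the objects of `O` as colours, which is generated by
the operations `Γ_f` and `Γ_U` subject to the relations of associativity and unitality. -/
def POperad : SetOperad.{u, 0, max u v} (Bouquet O) where
  obj b := Oper b
  unit c := Oper.mk (Term.unit (compRoot c))
  γ f p x := Oper.comp f p x
  assoc {T S R} f g h w ε' ε δ r hε := by
    have hcast := fun (i : Fin R.n) (j : Fin (fib g i).n) =>
      congrArg (Term O) (fib_fibMap f g h w i j).symm
    have e1 : ε' = fun i j => Oper.mk (cast (hcast i j) (ε (inc g i j)).out) := by
      funext i j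
      apply eq_of_heq
      refine (hε i j).trans (HEq.trans ?_
        (Oper.mk_heq (fib_fibMap f g h w i j) (cast_heq _ _)).symm)
      exact heq_of_eq (Oper.mk_out (ε (inc g i j))).symm
    have e2 : ε = fun j => Oper.mk (ε j).out := funext fun j => (Oper.mk_out _).symm
    have e3 : δ = fun j => Oper.mk (δ j).out := funext fun j => (Oper.mk_out _).symm
    rw [e1, e3, ← Oper.mk_out r]
    conv_rhs => rw [e2]
    have h1 : ∀ i : Fin R.n, Oper.comp (fibMap f g h w i)
        (fun j => Oper.mk (cast (hcast i j) (ε (inc g i j)).out)) (Oper.mk (δ i).out) =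
        Oper.mk (Term.comp (fibMap f g h w i) (fun j => cast (hcast i j) (ε (inc g i j)).out)
          (δ i).out) := fun i => Oper.comp_mk _ _ _
    refine (congrArg (fun p => Oper.comp h p (Oper.mk r.out)) (funext h1)).trans ?_
    refine (Oper.comp_mk _ _ _).trans (Eq.trans ?_ (congrArg (Oper.comp f fun j =>
      Oper.mk (ε j).out) (Oper.comp_mk (O := O) g _ _)).symm)
    exact (Oper.sound (Rel.assoc f g h w (fun i j => cast (hcast i j) (ε (inc g i j)).out)
      (fun j => (ε j).out) (fun i => (δ i).out) r.out (fun i j => cast_heq _ _))).trans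
      (Oper.comp_mk _ _ _).symm
  unit_left b ε x hε := by
    have e1 : ε = fun i => Oper.mk (cast (congrArg (Term O) (fib_id b i).symm)
        (Term.unit (b.col i))) := by
      funext i
      apply eq_of_heq
      refine (hε i).trans (HEq.trans (Oper.mk_heq rfl HEq.rfl)
        (Oper.mk_heq (fib_id b i) (cast_heq _ _)).symm)
    rw [e1, ← Oper.mk_out x]
    exact (Oper.comp_mk _ _ _).trans
      (Oper.sound (Rel.unit_left _ _ (fun i => cast_heq _ _)))
  unit_right {b c} f ε x hε := by
    have e1 : ε = fun i => Oper.mk (cast (congrArg (Term O) (fib_corolla f i).symm) x.out) := by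
      funext i
      apply eq_of_heq
      refine (hε i).trans (HEq.trans (heq_of_eq (Oper.mk_out x).symm)
        (Oper.mk_heq (fib_corolla f i) (cast_heq _ _)).symm)
    rw [e1]
    refine (Oper.comp_mk _ _ _).trans ((Oper.sound ?_).trans (Oper.mk_out x))
    exact Rel.unit_right _ _ _ (fun i => cast_heq _ _)

end POperad

/-! ### Plus constructions -/

/-- The operadic category `O'` is a plus construction over `O`: for every symmetric monoidal
category `V`, the category of `O`-operads in `V` is equivalent to the category of algebras in `V`
over the terminal `O'`-operad. -/
def IsPlusConstruction.{v'', u'', v₁, u₁, v₂, u₂} (O : Type u₁) [Category.{v₁} O]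
    [OperadicCategory O] (O' : Type u₂) [Category.{v₂} O'] [OperadicCategory O'] : Prop :=
  ∀ (V : Type u'') [Category.{v''} V] [MonoidalCategory V] [SymmetricCategory V],
    Nonempty (Operad O V ≌ (SetOperad.terminal.{u₂, v₂, 0} O').Algebra V)

end OperadicCat

end

noncomputable section

namespace OperadicCat

/-! ### Coherence for reorderings of tensor products along lists -/

section Coherence

variable {V : Type u'} [Category.{v'} V] [MonoidalCategory V] {ι κ : Type}

/-! The operad `P(O)` is presented so that an algebra over it is an `O`-operad: a collection `A T`,
with `Γ_f` acting as a structure map `γ_f`, `Γ_U` acting as a unit, and the three families of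
relations expressing associativity and the two unit laws. An algebra over the terminal operad of `∫
P(O)` is in turn an algebra over `P(O)`. The objects of `∫ P(O)` are the operations of `P(O)`, a
morphism is a presentation of its source as a composite of its target with its fibers, and every
object maps to the unit of its output colour, so that connected components are the same as objects
of `O`.

The functor `Operad.toAlgebraFunctor` evaluates formal composites in an operad. It is well defined
(`Operad.eval_eq_of_rel`) because operations on a collection satisfy the axioms of a coloured operad
(`bouquetComp_assoc`, `bouquetComp_unit_left`, `bouquetComp_unit_right`), and because each
generating relation holds exactly when the corresponding operad axiom does
(`bouquetComp_gen_assoc_iff`, `bouquetComp_gen_unit_left_iff`, `bouquetComp_gen_unit_right_iff`).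
The same equivalences, read backwards, turn any action of the formal composites into an operad
(`TermAction.operad`), which gives essential surjectivity. For full faithfulness, a family of maps
commutes with all operations as soon as it commutes with the generators.

The difficulty lies in the permutations of tensor factors: `Γ_f` has `S` as its first input while
`γ_f` has it last, and both sides of each relation regroup their inputs differently. This is settled
by a coherence theorem for symmetric monoidal categories. Composites of adjacent exchanges between
lists without repetitions depend only on the two lists (`Reorder.unique`), since each has a normal
form that pulls the factors of the target to the front in turn, and distinct labels leave no choice
for these pulls. A `Presentation` labels the factors of an object, `Coherent` is closed under all
structural isomorphisms and under equalities that respect labels, and `Coherent.unique` then reduces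
an equality of rearrangements to the tracking of labels. -/

theorem append_rightUnitor (A : V) {L N : V} (e : N ⟶ L ⊗ 𝟙_ V) :
    (A ◁ e ≫ (α_ A L (𝟙_ V)).inv) ≫ (ρ_ (A ⊗ L)).hom = A ◁ (e ≫ (ρ_ L).hom) := by
  simp

theorem append_unit_associator {M K N : V} (e : N ≅ M ⊗ K) :
    e.hom ≫ (λ_ M).inv ▷ K ≫ (α_ (𝟙_ V) M K).hom ≫ 𝟙_ V ◁ e.inv ≫ (λ_ N).hom = 𝟙 _ := by
  simp

/-- This is the cons step of an induction over lists, with tensor products along lists replaced by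
arbitrary objects; `e` and `e'` stand for instances of `tensorListAppend` and its inverse. The next
two lemmas have the same role. -/
theorem append_whiskerLeft (A : V) {L M M' N N' : V} (e : N ⟶ L ⊗ M) (f : M ⟶ M')
    (e' : L ⊗ M' ⟶ N') :
    (A ◁ e ≫ (α_ A L M).inv) ≫ (A ⊗ L) ◁ f ≫ (α_ A L M').hom ≫ A ◁ e' =
      A ◁ (e ≫ L ◁ f ≫ e') := by
  simp

theorem append_whiskerRight (A : V) {L L' M N N' : V} (e : N ⟶ L ⊗ M) (f : L ⟶ L')
    (e' : L' ⊗ M ⟶ N') :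
    (A ◁ e ≫ (α_ A L M).inv) ≫ (A ◁ f) ▷ M ≫ (α_ A L' M).hom ≫ A ◁ e' =
      A ◁ (e ≫ f ▷ M ≫ e') := by
  simp

theorem append_associator (A : V) {L M K N N' P P' : V} (e : N ⟶ N' ⊗ K) (f : N' ⟶ L ⊗ M)
    (g : M ⊗ K ⟶ P) (h : L ⊗ P ⟶ P') :
    (A ◁ e ≫ (α_ A N' K).inv) ≫ (A ◁ f ≫ (α_ A L M).inv) ▷ K ≫ (α_ (A ⊗ L) M K).hom ≫
      (A ⊗ L) ◁ g ≫ (α_ A L P).hom ≫ A ◁ h =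
    A ◁ (e ≫ f ▷ K ≫ (α_ L M K).hom ≫ L ◁ g ≫ h) := by
  simp

theorem whiskerLeft_comp_of_comm {A L L' M N P : V} {f : L ⟶ L'} {q : L' ⟶ A ⊗ M} {q' : L ⟶ A ⊗ N}
    {f' : N ⟶ M} (e : f ≫ q = q' ≫ A ◁ f') (p : M ⟶ P) :
    q' ≫ A ◁ (f' ≫ p) = f ≫ q ≫ A ◁ p := by
  rw [reassoc_of% e, MonoidalCategory.whiskerLeft_comp]

variable [SymmetricCategory V]

/-- The symmetry which exchanges the first two factors. -/
def swapFront (A B C : V) : A ⊗ (B ⊗ C) ⟶ B ⊗ (A ⊗ C) :=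
  (α_ A B C).inv ≫ (β_ A B).hom ▷ C ≫ (α_ B A C).hom

@[simp]
-- Here the braiding has to be a symmetry; in a braided category the double exchange is a nontrivial
-- pure braid in general and coherence in the present form fails.
theorem swapFront_swapFront (A B C : V) : swapFront A B C ≫ swapFront B A C = 𝟙 _ := by
  simp only [swapFront, Category.assoc, Iso.hom_inv_id_assoc]
  rw [← comp_whiskerRight_assoc, SymmetricCategory.symmetry]
  simp

theorem swapFront_naturality (A B : V) {C D : V} (f : C ⟶ D) :
    A ◁ B ◁ f ≫ swapFront A B D = swapFront A B C ≫ B ◁ A ◁ f := by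
  simp only [swapFront, associator_inv_naturality_right_assoc, Category.assoc,
    whisker_exchange_assoc, associator_naturality_right]

/-- The braid relation on the three front factors. It makes pulling out a factor compatible with
exchanging two factors that precede it. -/
theorem swapFront_yang_baxter (A B C D : V) :
    swapFront A B (C ⊗ D) ≫ B ◁ swapFront A C D ≫ swapFront B C (A ⊗ D) =
      A ◁ swapFront B C D ≫ swapFront A C (B ⊗ D) ≫ C ◁ swapFront A B D := by
  simp only [swapFront]
  trans 𝟙 _ ⊗≫ ((β_ A B).hom ▷ C ⊗≫ B ◁ (β_ A C).hom ⊗≫ (β_ B C).hom ▷ A) ▷ D ⊗≫ 𝟙 _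
  · monoidal
  · rw [BraidedCategory.yang_baxter']
    monoidal

/-- A hexagon identity: passing the block `B ⊗ L` amounts to passing `B` and then `L`. -/
theorem swapFront_tensor (A B L M : V) :
    swapFront A (B ⊗ L) M = A ◁ (α_ _ _ _).hom ≫ swapFront A B (L ⊗ M) ≫
      B ◁ swapFront A L M ≫ (α_ _ _ _).inv := by
  simp only [swapFront, BraidedCategory.braiding_tensor_right_hom]
  monoidal

theorem swapFront_unit (A M : V) :
    swapFront A (𝟙_ V) M = A ◁ (λ_ M).hom ≫ (λ_ (A ⊗ M)).inv := by
  simp only [swapFront, braiding_tensorUnit_right]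
  monoidal

theorem append_unit_braiding {M N : V} (e : M ⊗ 𝟙_ V ⟶ N) :
    (λ_ M).inv ≫ (β_ (𝟙_ V) M).hom ≫ e = (ρ_ M).inv ≫ e := by
  simp

theorem swapFront_pull {A B C L L' : V} (q : L ⟶ C ⊗ L') :
    swapFront A B L ≫ B ◁ (A ◁ q ≫ swapFront A C L') ≫ swapFront B C (A ⊗ L') =
      (A ◁ (B ◁ q ≫ swapFront B C L') ≫ swapFront A C (B ⊗ L')) ≫ C ◁ swapFront A B L' := by
  simp only [MonoidalCategory.whiskerLeft_comp, Category.assoc]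
  rw [← swapFront_yang_baxter, reassoc_of% (swapFront_naturality A B q)]

theorem swapFront_cons {A C L L₀ L' L₁ : V} {f : L ⟶ L'} {q : L' ⟶ A ⊗ L₁} {q' : L ⟶ A ⊗ L₀}
    {f' : L₀ ⟶ L₁} (e : f ≫ q = q' ≫ A ◁ f') :
    C ◁ f ≫ C ◁ q ≫ swapFront C A L₁ = (C ◁ q' ≫ swapFront C A L₀) ≫ A ◁ C ◁ f' := by
  rw [Category.assoc, ← swapFront_naturality, ← MonoidalCategory.whiskerLeft_comp_assoc, ← MonoidalCategory.whiskerLeft_comp_assoc, e]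

theorem swapFront_append (A B L M : V) :
    (A ◁ (α_ B L M).inv ≫ (α_ A (B ⊗ L) M).inv) ≫ swapFront A B L ▷ M ≫ (α_ B (A ⊗ L) M).hom ≫
      B ◁ (α_ A L M).hom = swapFront A B (L ⊗ M) := by
  simp only [swapFront]
  monoidal

theorem append_swap (A B : V) {L M N : V} (e : N ≅ L ⊗ M) :
    (A ◁ (B ◁ e.hom ≫ (α_ B L M).inv) ≫ (α_ A (B ⊗ L) M).inv) ≫ swapFront A B L ▷ M ≫
      (α_ B (A ⊗ L) M).hom ≫ B ◁ ((α_ A L M).hom ≫ A ◁ e.inv) = swapFront A B N := by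
  have h := swapFront_append A B L M
  simp only [MonoidalCategory.whiskerLeft_comp, Category.assoc] at h ⊢
  rw [reassoc_of% h, ← swapFront_naturality]
  simp

theorem append_insert (A B : V) {L M N N' : V} (e : N ⟶ L ⊗ M) (e' : L ⊗ A ⊗ M ⟶ N') :
    A ◁ (B ◁ e ≫ (α_ B L M).inv) ≫ swapFront A (B ⊗ L) M ≫ (α_ B L (A ⊗ M)).hom ≫ B ◁ e' =
      swapFront A B N ≫ B ◁ (A ◁ e ≫ swapFront A L M ≫ e') := by
  rw [swapFront_tensor]
  simp only [MonoidalCategory.whiskerLeft_comp, Category.assoc, Iso.inv_hom_id_assoc]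
  rw [← reassoc_of% (swapFront_naturality A B e), ← MonoidalCategory.whiskerLeft_comp_assoc A (α_ B L M).inv]
  simp

theorem append_braiding (A : V) {L M N P P' : V} (e : N ⟶ L ⊗ M) (e' : M ⊗ L ≅ P)
    (e'' : M ⊗ A ⊗ L ⟶ P') :
    (A ◁ e ≫ (α_ A L M).inv) ≫ (β_ (A ⊗ L) M).hom ≫ e'' =
      A ◁ (e ≫ (β_ L M).hom ≫ e'.hom) ≫ A ◁ e'.inv ≫ swapFront A M L ≫ e'' := by
  simp only [swapFront, BraidedCategory.braiding_tensor_left_hom, MonoidalCategory.whiskerLeft_comp,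
    Category.assoc, whiskerLeft_hom_inv_assoc, Iso.inv_hom_id_assoc]

/-- The morphisms between tensor products along lists which are composites of exchanges of adjacent
factors. -/
inductive Reorder (X : ι → V) : ∀ l l' : List ι, (tensorList X l ⟶ tensorList X l') → Prop
  | id (l : List ι) : Reorder X l l (𝟙 _)
  | comp {l l' l'' : List ι} {f : tensorList X l ⟶ tensorList X l'}
      {g : tensorList X l' ⟶ tensorList X l''} :
      Reorder X l l' f → Reorder X l' l'' g → Reorder X l l'' (f ≫ g)
  | cons (a : ι) {l l' : List ι} {f : tensorList X l ⟶ tensorList X l'} :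
      Reorder X l l' f → Reorder X (a :: l) (a :: l') (X a ◁ f)
  | swap (a b : ι) (l : List ι) :
      Reorder X (a :: b :: l) (b :: a :: l) (swapFront (X a) (X b) (tensorList X l))

/-- The morphisms which move a factor `X a` to the front. -/
inductive Pull (X : ι → V) (a : ι) :
    ∀ l l' : List ι, (tensorList X l ⟶ X a ⊗ tensorList X l') → Prop
  | head (l : List ι) : Pull X a (a :: l) l (𝟙 _)
  | tail (b : ι) {l l' : List ι} {f : tensorList X l ⟶ X a ⊗ tensorList X l'} :
      Pull X a l l' f → Pull X a (b :: l) (b :: l') (X b ◁ f ≫ swapFront (X b) (X a) _)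

/-- The reorderings which move the factors of the target to the front one after the other. -/
inductive NormalReorder (X : ι → V) :
    ∀ l m : List ι, (tensorList X l ⟶ tensorList X m) → Prop
  | nil : NormalReorder X [] [] (𝟙 _)
  | cons {a : ι} {l l' m : List ι} {q : tensorList X l ⟶ X a ⊗ tensorList X l'}
      {p : tensorList X l' ⟶ tensorList X m} :
      Pull X a l l' q → NormalReorder X l' m p → NormalReorder X l (a :: m) (q ≫ X a ◁ p)

/-! ### Normal forms of reorderings, and coherence -/

variable {X : ι → V}

theorem Pull.perm {a : ι} {l l' : List ι} {f : tensorList X l ⟶ X a ⊗ tensorList X l'}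
    (hf : Pull X a l l' f) : l.Perm (a :: l') := by
  induction hf with
  | head l => exact .refl _
  | tail b _ ih => exact (ih.cons b).trans (.swap _ _ _)

/-- Without repetitions, `a` occurs at one position only, so at each step the choice between `head`
and `tail` is forced. With a repeated label, two different occurrences could be pulled. -/
theorem Pull.unique {a : ι} {l l₁ l₂ : List ι} {f : tensorList X l ⟶ X a ⊗ tensorList X l₁}
    {g : tensorList X l ⟶ X a ⊗ tensorList X l₂} (hf : Pull X a l l₁ f) (hg : Pull X a l l₂ g)
    (hl : l.Nodup) : l₁ = l₂ ∧ HEq f g := by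
  induction hf generalizing l₂ with
  | head l =>
    cases hg with
    | head => exact ⟨rfl, HEq.rfl⟩
    | tail _ h => exact absurd (h.perm.mem_iff.2 List.mem_cons_self) (List.nodup_cons.1 hl).1
  | tail b hf ih =>
    cases hg with
    | head => exact absurd (hf.perm.mem_iff.2 List.mem_cons_self) (List.nodup_cons.1 hl).1
    | tail _ h =>
      obtain ⟨rfl, h'⟩ := ih h (List.nodup_cons.1 hl).2
      obtain rfl := eq_of_heq h'
      exact ⟨rfl, HEq.rfl⟩

theorem NormalReorder.unique {l m : List ι} {f g : tensorList X l ⟶ tensorList X m}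
    (hf : NormalReorder X l m f) (hg : NormalReorder X l m g) (hl : l.Nodup) : f = g := by
  induction hf with
  | nil => cases hg; rfl
  | cons hq hp ih =>
    cases hg with
    | cons hq' hp' =>
      obtain ⟨rfl, h⟩ := hq.unique hq' hl
      obtain rfl := eq_of_heq h
      rw [ih hp' (List.nodup_cons.1 (hq.perm.nodup_iff.1 hl)).2]

/-- The main step of the normalisation: pulling a factor out after a reordering is the same as
pulling it out first and reordering the remaining factors. Only an elementary exchange needs an
argument, according to whether the pulled factor is one of the exchanged ones or lies behind both.
-/
theorem Reorder.pull {b : ι} {l l' l₁ : List ι} {f : tensorList X l ⟶ tensorList X l'}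
    (hf : Reorder X l l' f) {q : tensorList X l' ⟶ X b ⊗ tensorList X l₁}
    (hq : Pull X b l' l₁ q) :
    ∃ (l₀ : List ι) (q' : tensorList X l ⟶ X b ⊗ tensorList X l₀)
      (f' : tensorList X l₀ ⟶ tensorList X l₁),
      Pull X b l l₀ q' ∧ Reorder X l₀ l₁ f' ∧ f ≫ q = q' ≫ X b ◁ f' := by
  induction hf generalizing l₁ with
  | id l => exact ⟨l₁, q, 𝟙 _, hq, .id _, by simp⟩
  | comp _ _ ih ih' =>
    obtain ⟨_, q', f', hq', hf', e'⟩ := ih' hq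
    obtain ⟨_, q'', f'', hq'', hf'', e''⟩ := ih hq'
    exact ⟨_, q'', f'' ≫ f', hq'', .comp hf'' hf', by
      rw [Category.assoc, e', reassoc_of% e'', MonoidalCategory.whiskerLeft_comp]⟩
  | cons c hf ih =>
    cases hq with
    | head => exact ⟨_, 𝟙 _, _, .head _, hf, (Category.comp_id _).trans (Category.id_comp _).symm⟩
    | tail _ hq =>
      obtain ⟨_, q', f', hq', hf', e⟩ := ih hq
      refine ⟨_, _, _, .tail c hq', .cons c hf', ?_⟩
      exact swapFront_cons e
  | swap x y l =>
    cases hq with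
    | head =>
      -- The pulled factor was second before the exchange, so the exchange itself is the pull.
      refine ⟨_, _, 𝟙 _, .tail x (.head l), .id _, ?_⟩
      exact show swapFront (X x) (X b) (tensorList X l) ≫ 𝟙 _ =
        (X x ◁ 𝟙 (X b ⊗ tensorList X l) ≫ swapFront (X x) (X b) (tensorList X l)) ≫ X b ◁ 𝟙 _ by
        simp
    | tail _ hq =>
      cases hq with
      | head =>
        -- The pulled factor was already in front: exchanging it away and pulling it back cancel by
        -- symmetry.
        refine ⟨_, _, 𝟙 _, .head _, .id _, ?_⟩
        exact show swapFront (X b) (X y) (tensorList X l) ≫ X y ◁ 𝟙 (X b ⊗ tensorList X l) ≫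
          swapFront (X y) (X b) (tensorList X l) = 𝟙 _ ≫ X b ◁ 𝟙 (X y ⊗ tensorList X l) by
          simp
      | tail _ hq =>
        -- The pulled factor lies behind both exchanged ones; this is the Yang–Baxter case.
        exact ⟨_, _, _, .tail x (.tail y hq), .swap _ _ _, swapFront_pull _⟩

/-- The generators `cons` and `swap` have nonempty targets, so only identities and their composites
remain. The target is kept as a variable with an equation so that induction on the reordering is
possible. -/
theorem Reorder.normal_nil {l m : List ι} {f : tensorList X l ⟶ tensorList X m}
    (hf : Reorder X l m f) (hm : m = []) : NormalReorder X l m f := by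
  induction hf with
  | id l => subst hm; exact .nil
  | comp _ _ ih ih' =>
    subst hm
    cases ih' rfl with
    | nil => rw [Category.comp_id]; exact ih rfl
  | cons => cases hm
  | swap => cases hm

/-- By induction on the normal form: `Reorder.pull` moves its first pull in front of `f`, and what
remains of `f` is absorbed by the rest. Applied to the normal form of an identity, this normalises
every reordering. -/
theorem Reorder.comp_normal {l m k : List ι} {f : tensorList X l ⟶ tensorList X m}
    (hf : Reorder X l m f) {p : tensorList X m ⟶ tensorList X k} (hp : NormalReorder X m k p) :
    NormalReorder X l k (f ≫ p) := by
  induction hp generalizing l with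
  | nil => rw [Category.comp_id]; exact hf.normal_nil rfl
  | cons hq hp ih =>
    obtain ⟨_, q', f', hq', hf', e⟩ := hf.pull hq
    refine Eq.subst (motive := NormalReorder X l _) ?_ (NormalReorder.cons hq' (ih hf'))
    exact whiskerLeft_comp_of_comm e _

theorem NormalReorder.id (l : List ι) : NormalReorder X l l (𝟙 _) := by
  induction l with
  | nil => exact .nil
  | cons a l ih =>
    have := NormalReorder.cons (.head (X := X) (a := a) l) ih
    rw [MonoidalCategory.whiskerLeft_id] at this
    exact (Category.id_comp (𝟙 (X a ⊗ tensorList X l))) ▸ this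

theorem Reorder.normal {l m : List ι} {f : tensorList X l ⟶ tensorList X m}
    (hf : Reorder X l m f) : NormalReorder X l m f := by
  simpa using hf.comp_normal (NormalReorder.id m)

/-- Coherence: two reorderings between the same lists without repetitions are equal. -/
theorem Reorder.unique {l m : List ι} {f g : tensorList X l ⟶ tensorList X m}
    (hf : Reorder X l m f) (hg : Reorder X l m g) (hl : l.Nodup) : f = g :=
  hf.normal.unique hg.normal hl

theorem Reorder.exists_inv {l m : List ι} {f : tensorList X l ⟶ tensorList X m}
    (hf : Reorder X l m f) : ∃ g, Reorder X m l g ∧ f ≫ g = 𝟙 _ ∧ g ≫ f = 𝟙 _ := by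
  induction hf with
  | id l => exact ⟨_, .id l, by simp, by simp⟩
  | comp _ _ ih ih' =>
    obtain ⟨g, hg, e₁, e₂⟩ := ih
    obtain ⟨g', hg', e₁', e₂'⟩ := ih'
    exact ⟨_, .comp hg' hg, by simp [reassoc_of% e₁', e₁], by simp [reassoc_of% e₂, e₂']⟩
  | cons a _ ih =>
    obtain ⟨g, hg, e₁, e₂⟩ := ih
    exact ⟨_, .cons a hg, (MonoidalCategory.whiskerLeft_comp _ _ _).symm.trans (by rw [e₁]; exact MonoidalCategory.whiskerLeft_id _ _),
      (MonoidalCategory.whiskerLeft_comp _ _ _).symm.trans (by rw [e₂]; exact MonoidalCategory.whiskerLeft_id _ _)⟩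
  | swap a b l => exact ⟨_, .swap b a l, swapFront_swapFront _ _ _, swapFront_swapFront _ _ _⟩

theorem Reorder.isIso {l m : List ι} {f : tensorList X l ⟶ tensorList X m}
    (hf : Reorder X l m f) : IsIso f := by
  obtain ⟨g, -, h⟩ := hf.exists_inv
  exact ⟨g, h⟩

theorem Reorder.inv {l m : List ι} {f : tensorList X l ≅ tensorList X m}
    (hf : Reorder X l m f.hom) : Reorder X m l f.inv := by
  obtain ⟨g, hg, e, -⟩ := hf.exists_inv
  rwa [(Iso.eq_inv_comp f).2 e, Category.comp_id] at hg

/-! ### Reorderings and concatenation -/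

/-- The results of this group show that tensor products of reorderings, the right unitor, the
associator and the braiding become reorderings of concatenated lists after conjugation with
`tensorListAppend`. They are what makes `Coherent` stable under the symmetric monoidal structure. -/
theorem Reorder.whiskerLeft (l : List ι) {m m' : List ι} {f : tensorList X m ⟶ tensorList X m'}
    (hf : Reorder X m m' f) : Reorder X (l ++ m) (l ++ m')
      ((tensorListAppend X l m).hom ≫ tensorList X l ◁ f ≫ (tensorListAppend X l m').inv) := by
  induction l with
  | nil =>
    refine Eq.subst (motive := Reorder X m m') (Eq.symm ?_) hf
    exact show (λ_ _).inv ≫ 𝟙_ V ◁ f ≫ (λ_ _).hom = f by simp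
  | cons a l ih => exact append_whiskerLeft (X a) _ _ _ ▸ Reorder.cons a ih

theorem Reorder.whiskerRight {l l' : List ι} {f : tensorList X l ⟶ tensorList X l'}
    (hf : Reorder X l l' f) (m : List ι) : Reorder X (l ++ m) (l' ++ m)
      ((tensorListAppend X l m).hom ≫ f ▷ tensorList X m ≫ (tensorListAppend X l' m).inv) := by
  induction hf with
  | id l => simpa using Reorder.id (l ++ m)
  | comp _ _ ih ih' => simpa using Reorder.comp ih ih'
  | cons a _ ih => exact append_whiskerRight (X a) _ _ _ ▸ Reorder.cons a ih
  | swap a b l =>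
    refine Eq.subst (motive := Reorder X (a :: b :: (l ++ m)) (b :: a :: (l ++ m))) (Eq.symm ?_)
      (Reorder.swap a b (l ++ m))
    exact append_swap (X a) (X b) (tensorListAppend X l m)

theorem Reorder.tensorHom {l l' m m' : List ι} {f : tensorList X l ⟶ tensorList X l'}
    {g : tensorList X m ⟶ tensorList X m'} (hf : Reorder X l l' f) (hg : Reorder X m m' g) :
    Reorder X (l ++ m) (l' ++ m')
      ((tensorListAppend X l m).hom ≫ (f ⊗ₘ g) ≫ (tensorListAppend X l' m').inv) := by
  have := Reorder.comp (hf.whiskerRight m) (hg.whiskerLeft l')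
  simpa [MonoidalCategory.tensorHom_def] using this

theorem Reorder.rightUnitor (l : List ι) : Reorder X (l ++ []) l
    ((tensorListAppend X l []).hom ≫ (ρ_ (tensorList X l)).hom) := by
  induction l with
  | nil =>
    refine Eq.subst (motive := Reorder X [] []) (Eq.symm ?_) (Reorder.id [])
    exact show (λ_ (𝟙_ V)).inv ≫ (ρ_ (𝟙_ V)).hom = 𝟙 _ by simp [← unitors_equal]
  | cons a l ih =>
    refine Eq.subst (motive := Reorder X (a :: (l ++ [])) (a :: l)) (Eq.symm ?_)
      (Reorder.cons a ih)
    exact append_rightUnitor (X a) (tensorListAppend X l []).hom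

theorem Reorder.associator (l m k : List ι) : Reorder X ((l ++ m) ++ k) (l ++ (m ++ k))
    ((tensorListAppend X (l ++ m) k).hom ≫ (tensorListAppend X l m).hom ▷ tensorList X k ≫
      (α_ _ _ _).hom ≫ tensorList X l ◁ (tensorListAppend X m k).inv ≫
      (tensorListAppend X l (m ++ k)).inv) := by
  induction l with
  | nil =>
    refine Eq.subst (motive := Reorder X (m ++ k) (m ++ k)) (Eq.symm ?_) (Reorder.id (m ++ k))
    exact append_unit_associator (tensorListAppend X m k)
  | cons a l ih => exact append_associator (X a) _ _ _ _ ▸ Reorder.cons a ih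

/-- A single factor passes a block by adjacent exchanges, one for each factor of the block. This is
the inductive step for the braiding of two blocks. -/
theorem Reorder.insert (a : ι) (l m : List ι) : Reorder X (a :: (l ++ m)) (l ++ a :: m)
    (X a ◁ (tensorListAppend X l m).hom ≫ swapFront (X a) (tensorList X l) (tensorList X m) ≫
      (tensorListAppend X l (a :: m)).inv) := by
  induction l with
  | nil =>
    refine Eq.subst (motive := Reorder X (a :: m) (a :: m)) (Eq.symm ?_) (Reorder.id (a :: m))
    exact show X a ◁ (λ_ _).inv ≫ swapFront (X a) (𝟙_ V) (tensorList X m) ≫ (λ_ _).hom = 𝟙 _ by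
      simp [swapFront_unit]
  | cons b l ih =>
    exact append_insert (X a) (X b) _ _ ▸ Reorder.comp (.swap a b (l ++ m)) (.cons b ih)

theorem Reorder.braiding (l m : List ι) : Reorder X (l ++ m) (m ++ l)
    ((tensorListAppend X l m).hom ≫ (β_ _ _).hom ≫ (tensorListAppend X m l).inv) := by
  induction l with
  | nil =>
    have h : Reorder X (m ++ []) m ((tensorListAppend X m []) ≪≫ (ρ_ (tensorList X m))).hom :=
      Reorder.rightUnitor m
    refine Eq.subst (motive := Reorder X m (m ++ [])) (Eq.symm ?_) h.inv
    exact append_unit_braiding (tensorListAppend X m []).inv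
  | cons a l ih =>
    exact append_braiding (X a) _ (tensorListAppend X m l).symm _ ▸
      Reorder.comp (.cons a ih) (.insert a m l)

end Coherence

/-! ### Presentations of objects as tensor products of labelled factors -/

section Presentation

variable {V : Type u'} [Category.{v'} V] [MonoidalCategory V] {ι κ : Type}

/-- An identification of an object with the tensor product of the `X i`, for `i` in a list of
labels. -/
structure Presentation (X : ι → V) (A : V) where
  /-- the labels -/
  labels : List ι
  /-- the identification -/
  iso : A ≅ tensorList X labels

namespace Presentation

variable {X : ι → V}

/-- The presentation of the monoidal unit. -/
def unit : Presentation X (𝟙_ V) := ⟨[], Iso.refl _⟩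

/-- The presentation of a single factor. -/
def leaf {A : V} (i : ι) (h : A = X i) : Presentation X A :=
  ⟨[i], eqToIso h ≪≫ (ρ_ (X i)).symm⟩

/-- The presentation of a tensor product. -/
def tensor {A B : V} (p : Presentation X A) (q : Presentation X B) : Presentation X (A ⊗ B) :=
  ⟨p.labels ++ q.labels, (p.iso ⊗ᵢ q.iso) ≪≫ (tensorListAppend X p.labels q.labels).symm⟩

/-- The presentation of a tensor product along a list. -/
def list {Y : κ → V} (p : ∀ k, Presentation X (Y k)) :
    ∀ K : List κ, Presentation X (tensorList Y K)
  | [] => unit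
  | k :: K => (p k).tensor (list p K)

/-- The presentation of a finite tensor product. -/
abbrev fin {n : ℕ} {Y : Fin n → V} (p : ∀ k, Presentation X (Y k)) :
    Presentation X (tensorFin Y) := list p (List.finRange n)

theorem labels_list {Y : κ → V} (p : ∀ k, Presentation X (Y k)) (K : List κ) :
    (list p K).labels = K.flatMap (fun k => (p k).labels) := by
  induction K with
  | nil => rfl
  | cons k K ih => exact congrArg ((p k).labels ++ ·) ih

variable (X) in
/-- The tautological presentation of a finite tensor product. -/
abbrev self {n : ℕ} (X : Fin n → V) : Presentation X (tensorFin X) := fin fun i => leaf i rfl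

/-- Labelling every factor by its own position makes the labels distinct even if some of the objects
`X i` coincide, as `Coherent.unique` requires. -/
theorem self_nodup {n : ℕ} (X : Fin n → V) : (self X).labels.Nodup := by
  have : (self X).labels = List.finRange n :=
    (labels_list _ _).trans (List.flatMap_singleton' (List.finRange n))
  rw [this]
  exact List.nodup_finRange n

end Presentation

/-- Reduces transport along an equality of tensor products to transports of the single factors,
whose coherence is a matter of labels. -/
theorem eqToHom_tensorList {Y Y' : κ → V} {K : List κ} (h : ∀ k, Y k = Y' k)
    (e : tensorList Y K = tensorList Y' K) :
    eqToHom e = tensorListMap (fun k => eqToHom (h k)) K := by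
  obtain rfl : Y = Y' := funext h
  exact (tensorListMap_id Y K).symm

theorem eqToHom_whiskerLeft (A : V) {B C : V} (h : B = C) (e : A ⊗ B = A ⊗ C) :
    eqToHom e = A ◁ eqToHom h := by
  subst h; simp

theorem tensor_conj_associator {A A' B B' C C' M N P : V} (p : A ≅ A') (q : B ≅ B') (r : C ≅ C')
    (f : M ⟶ A' ⊗ B') (g : B' ⊗ C' ⟶ N) (h : A' ⊗ N ⟶ P) :
    (f ≫ (p.inv ⊗ₘ q.inv) ⊗ₘ r.inv) ≫ (α_ A B C).hom ≫ (p.hom ⊗ₘ (q.hom ⊗ₘ r.hom) ≫ g) ≫ h =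
      f ▷ C' ≫ (α_ A' B' C').hom ≫ A' ◁ g ≫ h := by
  rw [← Category.id_comp r.inv, ← tensorHom_comp_tensorHom, tensorHom_id, Category.assoc,
    associator_naturality_assoc, ← Category.comp_id p.hom]
  simp [tensorHom_comp_tensorHom_assoc]

theorem unit_rightUnitor {A B C : V} (e : A ≅ B) (f : C ⟶ B ⊗ 𝟙_ V) :
    (f ≫ (e.inv ⊗ₘ 𝟙 (𝟙_ V))) ≫ (ρ_ A).hom ≫ e.hom = f ≫ (ρ_ B).hom := by
  simp

open Presentation

variable [SymmetricCategory V] {X : ι → V}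

/-- A morphism between objects with presentations which is a composite of structural isomorphisms
of the symmetric monoidal category. -/
def Coherent {A B : V} (p : Presentation X A) (q : Presentation X B) (f : A ⟶ B) : Prop :=
  Reorder X p.labels q.labels (p.iso.inv ≫ f ≫ q.iso.hom)

namespace Coherent

variable {A B C D : V} {p : Presentation X A} {q : Presentation X B} {r : Presentation X C}
  {s : Presentation X D}

theorem congr {f g : A ⟶ B} (hf : Coherent p q f) (h : f = g) : Coherent p q g := h ▸ hf

/-- The working form of coherence: two structural morphisms agree once both are seen to respect the
same labellings. Distinctness is needed for the labels of the source alone. -/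
theorem unique {f g : A ⟶ B} (hf : Coherent p q f) (hg : Coherent p q g)
    (hp : p.labels.Nodup) : f = g := by
  simpa using Reorder.unique hf hg hp

theorem id (p : Presentation X A) : Coherent p p (𝟙 A) := by
  simpa [Coherent] using Reorder.id p.labels

theorem comp {f : A ⟶ B} {g : B ⟶ C} (hf : Coherent p q f) (hg : Coherent q r g) :
    Coherent p r (f ≫ g) := by
  simpa [Coherent] using Reorder.comp hf hg

theorem isIso {f : A ⟶ B} (hf : Coherent p q f) : IsIso f := by
  have := Reorder.isIso hf
  rw [show f = p.iso.hom ≫ (p.iso.inv ≫ f ≫ q.iso.hom) ≫ q.iso.inv by simp]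
  infer_instance

theorem inv {f : A ≅ B} (hf : Coherent p q f.hom) : Coherent q p f.inv :=
  Reorder.inv (f := p.iso.symm ≪≫ f ≪≫ q.iso) hf |> fun h => by
    simpa [Coherent] using h

theorem tensorHom {f : A ⟶ B} {g : C ⟶ D} (hf : Coherent p q f) (hg : Coherent r s g) :
    Coherent (p.tensor r) (q.tensor s) (f ⊗ₘ g) := by
  have := Reorder.tensorHom hf hg
  simpa [Coherent, Presentation.tensor, tensorHom_comp_tensorHom_assoc] using this

theorem whiskerLeft (p : Presentation X A) {f : C ⟶ D} (hf : Coherent r s f) :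
    Coherent (p.tensor r) (p.tensor s) (A ◁ f) :=
  ((Coherent.id p).tensorHom hf).congr (id_tensorHom _ _)

theorem whiskerRight {f : A ⟶ B} (hf : Coherent p q f) (r : Presentation X C) :
    Coherent (p.tensor r) (q.tensor r) (f ▷ C) :=
  (hf.tensorHom (Coherent.id r)).congr (tensorHom_id _ _)

theorem braiding (p : Presentation X A) (q : Presentation X B) :
    Coherent (p.tensor q) (q.tensor p) (β_ A B).hom := by
  have := Reorder.braiding (X := X) p.labels q.labels
  simpa [Coherent, Presentation.tensor] using this

theorem associator (p : Presentation X A) (q : Presentation X B) (r : Presentation X C) :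
    Coherent ((p.tensor q).tensor r) (p.tensor (q.tensor r)) (α_ A B C).hom := by
  refine Eq.subst (motive := Reorder X _ _) (Eq.symm ?_)
    (Reorder.associator p.labels q.labels r.labels)
  simp only [Presentation.tensor, Iso.trans_inv, Iso.trans_hom, Iso.symm_inv, Iso.symm_hom,
    tensorIso_hom, tensorIso_inv, Category.assoc]
  rw [tensor_conj_associator]

theorem leftUnitor (p : Presentation X A) : Coherent (unit.tensor p) p (λ_ A).hom := by
  refine Eq.subst (motive := Reorder X p.labels p.labels) (Eq.symm ?_) (Reorder.id p.labels)
  exact show ((λ_ _).inv ≫ (𝟙 (𝟙_ V) ⊗ₘ p.iso.inv)) ≫ (λ_ A).hom ≫ p.iso.hom = 𝟙 _ by simp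

theorem rightUnitor (p : Presentation X A) : Coherent (p.tensor unit) p (ρ_ A).hom := by
  refine Eq.subst (motive := Reorder X (p.labels ++ []) p.labels) (Eq.symm ?_)
    (Reorder.rightUnitor p.labels)
  exact unit_rightUnitor p.iso _

/-- Identifications of equal objects, such as those between fibers of `f_i` and fibers of `f`, count
as structural, provided that the two labels agree. -/
theorem leaf {i j : ι} (hA : A = X i) (hB : B = X j) (hij : i = j) (h : A = B) :
    Coherent (leaf i hA) (leaf j hB) (eqToHom h) := by
  subst hij h; exact Coherent.id _

theorem tensorListMap {Y Z : κ → V} {p : ∀ k, Presentation X (Y k)}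
    {q : ∀ k, Presentation X (Z k)} {f : ∀ k, Y k ⟶ Z k} (hf : ∀ k, Coherent (p k) (q k) (f k))
    (K : List κ) : Coherent (list p K) (list q K) (tensorListMap f K) := by
  induction K with
  | nil => exact Coherent.id _
  | cons k K ih => exact (hf k).tensorHom ih

variable {Y Z : κ → V} (p : ∀ k, Presentation X (Y k)) (q : ∀ k, Presentation X (Z k))

theorem list_eqToHom {K K' : List κ} (h : K = K') (e : tensorList Y K = tensorList Y K') :
    Coherent (list p K) (list p K') (eqToHom e) := by
  subst h; exact Coherent.id _

theorem tensorListAppend (K K' : List κ) : Coherent (list p (K ++ K'))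
    ((list p K).tensor (list p K')) (tensorListAppend Y K K').hom := by
  induction K with
  | nil => exact (leftUnitor (list p K')).inv
  | cons k K ih => exact (whiskerLeft _ ih).comp (associator (p k) (list p K) (list p K')).inv

theorem tensorListFlatMap {μ : Type} (L : μ → List κ) (M : List μ) :
    Coherent (list p (M.flatMap L)) (list (fun m => list p (L m)) M)
      (tensorListFlatMap Y L M).hom := by
  induction M with
  | nil => exact Coherent.id _
  | cons m M ih => exact (tensorListAppend p (L m) (M.flatMap L)).comp (whiskerLeft _ ih)

theorem tensorList_map {μ : Type} (e : μ → κ) (M : List μ)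
    (h : tensorList Y (M.map e) = tensorList (fun x => Y (e x)) M) :
    Coherent (list p (M.map e)) (list (fun x => p (e x)) M) (eqToHom h) := by
  induction M with
  | nil => exact Coherent.id _
  | cons m M ih =>
    exact (whiskerLeft (p (e m)) (ih (OperadicCat.tensorList_map Y e M))).congr
      (eqToHom_whiskerLeft _ _ h).symm

theorem tensorListShuffle (K : List κ) : Coherent ((list p K).tensor (list q K))
    (list (fun k => (p k).tensor (q k)) K) (tensorListShuffle Y Z K) := by
  induction K with
  | nil => exact leftUnitor unit
  | cons k K ih =>
    refine Coherent.comp (q := ((p k).tensor (q k)).tensor ((list p K).tensor (list q K))) ?_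
      (whiskerLeft _ ih)
    exact (associator _ _ _).comp <| (whiskerLeft _ (associator _ _ _).inv).comp <|
      (whiskerLeft _ (whiskerRight (braiding _ _) _)).comp <|
      (whiskerLeft _ (associator _ _ _)).comp (associator _ _ _).inv

variable [DecidableEq κ]

theorem tensorListPull (a : κ) (K : List κ) (h : a ∈ K) :
    Coherent (list p K) ((p a).tensor (list p (K.erase a))) (tensorListPull Y a K h).hom := by
  induction K with
  | nil => exact absurd h List.not_mem_nil
  | cons b K ih =>
    -- The lists compared by the transports in `tensorListPull` are not syntactically equal; with
    -- the list generalised, the equality can be substituted and the transport becomes an identity.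
    have key : ∀ {K' : List κ} (_ : K = K') (e : tensorList Y (a :: K) = Y a ⊗ tensorList Y K'),
        Coherent (list p (a :: K)) ((p a).tensor (list p K')) (eqToHom e) := by
      rintro _ rfl _; exact Coherent.id _
    have key' : ∀ {K' K'' : List κ} (_ : K' = b :: K'')
        (e : Y a ⊗ Y b ⊗ tensorList Y K'' = Y a ⊗ tensorList Y K'),
        Coherent ((p a).tensor ((p b).tensor (list p K''))) ((p a).tensor (list p K'))
          (eqToHom e) := by
      rintro _ _ rfl _; exact Coherent.id _
    unfold OperadicCat.tensorListPull
    split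
    · rename_i hb
      subst hb
      exact key (List.erase_cons_head _ _).symm (by rw [List.erase_cons_head]; rfl)
    · rename_i hb
      exact (whiskerLeft _ (ih _)).comp <| (associator _ _ _).inv.comp <|
        (whiskerRight (braiding _ _) _).comp <| (associator _ _ _).comp <|
        key' (List.erase_cons_tail (by simpa using hb))
          (by rw [List.erase_cons_tail (by simpa using hb)]; rfl)

theorem tensorListPerm (K K' : List κ) (h : K.Perm K') :
    Coherent (list p K) (list p K') (tensorListPerm Y K K' h).hom := by
  induction K generalizing K' with
  | nil => exact list_eqToHom p h.nil_eq (by rw [h.nil_eq])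
  | cons a K ih => exact (whiskerLeft _ (ih _ _)).comp (tensorListPull p a K' _).inv

end Coherent

namespace Coherent

theorem regroup {n m : ℕ} {k : Fin m → ℕ} (φ : Fin n → Fin m)
    (h : ∀ i, k i = (Finset.univ.filter (fun t => φ t = i)).card) {Y : Fin n → V}
    (p : ∀ t, Presentation X (Y t)) :
    Coherent (Presentation.fin p)
      (Presentation.fin fun i => Presentation.fin fun x => p (fiberEmb φ i (h i) x))
      (regroup φ h Y).hom :=
  (tensorListPerm p _ _ (regroup_perm φ h)).comp <|
    (tensorListFlatMap p (fun i => (List.finRange (k i)).map (fiberEmb φ i (h i)))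
      (List.finRange m)).comp <|
    (tensorListMap (fun i => tensorList_map p (fiberEmb φ i (h i)) (List.finRange (k i))
      (OperadicCat.tensorList_map _ _ _)) _).congr (eqToHom_tensorList _ (by simp only [OperadicCat.tensorList_map])).symm

theorem fin_eqToHom {n m : ℕ} {Y : Fin n → V} {Z : Fin m → V} {p : ∀ k, Presentation X (Y k)}
    {q : ∀ k, Presentation X (Z k)} (hnm : n = m) (hYZ : ∀ i j, i.val = j.val → Y i = Z j)
    (h : ∀ i j (hij : i.val = j.val), Coherent (p i) (q j) (eqToHom (hYZ i j hij)))
    (e : tensorFin Y = tensorFin Z) :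
    Coherent (Presentation.fin p) (Presentation.fin q) (eqToHom e) := by
  subst hnm
  obtain rfl : Y = Z := funext fun i => hYZ i i rfl
  exact (tensorListMap (fun i => h i i rfl) _).congr (tensorListMap_id _ _)

theorem tensorFinOne {n : ℕ} (hn : n = 1) {Y : Fin n → V} {B : V} (h : ∀ i, Y i = B)
    {p : ∀ k, Presentation X (Y k)} {q : Presentation X B}
    (hpq : ∀ i, Coherent (p i) q (eqToHom (h i))) :
    Coherent (Presentation.fin p) q (tensorFinOne hn Y B h).hom := by
  subst hn
  obtain rfl : Y = fun _ => B := funext h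
  -- The list `List.finRange 1` is generalised to `L` so that it can be replaced by the literal
  -- `[0]`.
  have key : ∀ (L : List (Fin 1)) (_ : L = [0]) (e : tensorList (fun _ => B) L = B ⊗ 𝟙_ V),
      Coherent (list p L) (q.tensor unit) (eqToHom e) := by
    rintro _ rfl e
    exact (hpq 0).tensorHom (Coherent.id _) |>.congr (by simp; rfl)
  exact (key _ (by simp [List.finRange_succ])
    (by simp [List.finRange_succ, tensorList])).comp (rightUnitor q)

end Coherent

end Presentation

/-! ### Naturality of the structural isomorphisms between finite tensor products -/

section Naturality

variable {V : Type u'} [Category.{v'} V] [MonoidalCategory V] {ι κ : Type}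

theorem append_cons_naturality {A A' L L' M M' N N' : V} {f : A ⟶ A'} {F : N ⟶ N'} {G : L ⟶ L'}
    {H : M ⟶ M'} {e : N ⟶ L ⊗ M} {e' : N' ⟶ L' ⊗ M'} (h : F ≫ e' = e ≫ (G ⊗ₘ H)) :
    (f ⊗ₘ F) ≫ A' ◁ e' ≫ (α_ A' L' M').inv =
      (A ◁ e ≫ (α_ A L M).inv) ≫ ((f ⊗ₘ G) ⊗ₘ H) := by
  rw [← id_tensorHom, tensorHom_comp_tensorHom_assoc, h, Category.comp_id, Category.assoc,
    ← associator_inv_naturality, ← id_tensorHom, tensorHom_comp_tensorHom_assoc, Category.id_comp]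

theorem tensorHom_whiskerLeft_of_comm {A A' M M' N N' : V} {f : A ⟶ A'} {F : M ⟶ M'} {G : N ⟶ N'}
    {e : M ⟶ N} {e' : M' ⟶ N'} (h : F ≫ e' = e ≫ G) :
    (f ⊗ₘ F) ≫ A' ◁ e' = A ◁ e ≫ (f ⊗ₘ G) := by
  rw [← id_tensorHom, ← id_tensorHom, tensorHom_comp_tensorHom, h, tensorHom_comp_tensorHom,
    Category.comp_id, Category.id_comp]

theorem tensorHom_comp_whiskerLeft_of_comm {L L' M M' N N' P P' : V} {F : P ⟶ P'} {G : L ⟶ L'}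
    {H : M ⟶ M'} {K : N ⟶ N'} {a : P ⟶ L ⊗ M} {a' : P' ⟶ L' ⊗ M'} {e : M ⟶ N} {e' : M' ⟶ N'}
    (h : F ≫ a' = a ≫ (G ⊗ₘ H)) (h' : H ≫ e' = e ≫ K) :
    F ≫ a' ≫ L' ◁ e' = (a ≫ L ◁ e) ≫ (G ⊗ₘ K) := by
  rw [reassoc_of% h, tensorHom_whiskerLeft_of_comm h', Category.assoc]

theorem perm_cons_naturality {A A' L L' M M' N N' : V} {f : A ⟶ A'} {F : L ⟶ L'} {G : M ⟶ M'}
    {H : N ⟶ N'} {e : L ⟶ M} {e' : L' ⟶ M'} {p : N ≅ A ⊗ M} {p' : N' ≅ A' ⊗ M'}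
    (h : F ≫ e' = e ≫ G) (h' : H ≫ p'.hom = p.hom ≫ (f ⊗ₘ G)) :
    (f ⊗ₘ F) ≫ A' ◁ e' ≫ p'.inv = (A ◁ e ≫ p.inv) ≫ H := by
  rw [reassoc_of% (tensorHom_whiskerLeft_of_comm (f := f) h), Category.assoc,
    (Iso.eq_comp_inv p').2 ((Category.assoc _ _ _).trans ((Iso.inv_comp_eq p).2 h'))]

theorem tensorListAppend_naturality {Y Z : κ → V} (f : ∀ k, Y k ⟶ Z k) (K K' : List κ) :
    tensorListMap f (K ++ K') ≫ (tensorListAppend Z K K').hom =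
      (tensorListAppend Y K K').hom ≫ (tensorListMap f K ⊗ₘ tensorListMap f K') := by
  induction K with
  | nil =>
    exact show tensorListMap f K' ≫ (λ_ _).inv = (λ_ _).inv ≫ (𝟙 (𝟙_ V) ⊗ₘ _) by simp
  | cons k K ih => exact append_cons_naturality ih

theorem tensorListFlatMap_naturality {μ : Type} {Y Z : κ → V} (f : ∀ k, Y k ⟶ Z k)
    (L : μ → List κ) (M : List μ) :
    tensorListMap f (M.flatMap L) ≫ (tensorListFlatMap Z L M).hom =
      (tensorListFlatMap Y L M).hom ≫ tensorListMap (fun m => tensorListMap f (L m)) M := by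
  induction M with
  | nil => exact show 𝟙 (𝟙_ V) ≫ 𝟙 (𝟙_ V) = 𝟙 _ ≫ 𝟙 _ from rfl
  | cons m M ih =>
    refine (tensorHom_comp_whiskerLeft_of_comm (tensorListAppend_naturality f (L m) _) ih)

theorem tensorListMap_map {μ : Type} {Y Z : κ → V} (f : ∀ k, Y k ⟶ Z k) (e : μ → κ) (M : List μ)
    (h : tensorList Y (M.map e) = tensorList (fun x => Y (e x)) M)
    (h' : tensorList Z (M.map e) = tensorList (fun x => Z (e x)) M) :
    tensorListMap f (M.map e) ≫ eqToHom h' = eqToHom h ≫ tensorListMap (fun x => f (e x)) M := by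
  induction M with
  | nil => rfl
  | cons m M ih =>
    have h₁ := tensorList_map Y e M
    have h₂ := tensorList_map Z e M
    have e₁ : eqToHom h = Y (e m) ◁ eqToHom h₁ := eqToHom_whiskerLeft _ _ _
    have e₂ : eqToHom h' = Z (e m) ◁ eqToHom h₂ := eqToHom_whiskerLeft _ _ _
    rw [e₁, e₂]
    exact tensorHom_whiskerLeft_of_comm (ih h₁ h₂)

variable [SymmetricCategory V]

theorem pull_tail_naturality {A A' B B' L L' M M' N N' : V} {f : A ⟶ A'} {g : B ⟶ B'}
    {F : L ⟶ L'} {G : M ⟶ M'} {H : N ⟶ N'} {p : L ⟶ A ⊗ M} {p' : L' ⟶ A' ⊗ M'}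
    {q : A ⊗ B ⊗ M ⟶ A ⊗ N} {q' : A' ⊗ B' ⊗ M' ⟶ A' ⊗ N'} (h : F ≫ p' = p ≫ (f ⊗ₘ G))
    (h' : (f ⊗ₘ (g ⊗ₘ G)) ≫ q' = q ≫ (f ⊗ₘ H)) :
    (g ⊗ₘ F) ≫ B' ◁ p' ≫ (α_ B' A' M').inv ≫ (β_ B' A').hom ▷ M' ≫ (α_ A' B' M').hom ≫ q' =
      (B ◁ p ≫ (α_ B A M).inv ≫ (β_ B A).hom ▷ M ≫ (α_ A B M).hom ≫ q) ≫ (f ⊗ₘ H) := by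
  simp only [Category.assoc]
  rw [← h', reassoc_of% (tensorHom_whiskerLeft_of_comm (f := g) h), ← associator_naturality_assoc,
    ← tensorHom_id, ← tensorHom_id, associator_inv_naturality_assoc,
    tensorHom_comp_tensorHom_assoc, tensorHom_comp_tensorHom_assoc, BraidedCategory.braiding_naturality,
    Category.comp_id, Category.id_comp]

variable [DecidableEq κ]

theorem tensorListPull_naturality {Y Z : κ → V} (f : ∀ k, Y k ⟶ Z k) (a : κ) (K : List κ)
    (h : a ∈ K) : tensorListMap f K ≫ (tensorListPull Z a K h).hom =
      (tensorListPull Y a K h).hom ≫ (f a ⊗ₘ tensorListMap f (K.erase a)) := by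
  induction K with
  | nil => exact absurd h List.not_mem_nil
  | cons b K ih =>
    unfold tensorListPull
    split
    · rename_i hb
      subst hb
      have key : ∀ {K' : List κ} (_ : K = K')
          (e : tensorList Y (b :: K) = Y b ⊗ tensorList Y K')
          (e' : tensorList Z (b :: K) = Z b ⊗ tensorList Z K'),
          tensorListMap f (b :: K) ≫ eqToHom e' =
            eqToHom e ≫ (f b ⊗ₘ tensorListMap f K') := by
        rintro _ rfl _ _
        exact (Category.comp_id _).trans (Category.id_comp _).symm
      exact key (List.erase_cons_head _ _).symm (by rw [List.erase_cons_head]; rfl)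
        (by rw [List.erase_cons_head]; rfl)
    · rename_i hb
      have key : ∀ {K' K'' : List κ} (_ : K' = b :: K'')
          (e : Y a ⊗ Y b ⊗ tensorList Y K'' = Y a ⊗ tensorList Y K')
          (e' : Z a ⊗ Z b ⊗ tensorList Z K'' = Z a ⊗ tensorList Z K'),
          (f a ⊗ₘ (f b ⊗ₘ tensorListMap f K'')) ≫ eqToHom e' =
            eqToHom e ≫ (f a ⊗ₘ tensorListMap f K') := by
        rintro _ _ rfl _ _
        exact (Category.comp_id _).trans (Category.id_comp _).symm
      exact pull_tail_naturality (ih _) (key (List.erase_cons_tail (by simpa using hb))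
        (by rw [List.erase_cons_tail (by simpa using hb)]; rfl)
        (by rw [List.erase_cons_tail (by simpa using hb)]; rfl))

theorem tensorListPerm_naturality {Y Z : κ → V} (f : ∀ k, Y k ⟶ Z k) (K K' : List κ)
    (h : K.Perm K') : tensorListMap f K ≫ (tensorListPerm Z K K' h).hom =
      (tensorListPerm Y K K' h).hom ≫ tensorListMap f K' := by
  induction K generalizing K' with
  | nil =>
    have key : ∀ {K K' : List κ} (_ : K = K') (e : tensorList Y K = tensorList Y K')
        (e' : tensorList Z K = tensorList Z K'), tensorListMap f K ≫ eqToHom e' =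
          eqToHom e ≫ tensorListMap f K' := by
      rintro _ _ rfl _ _
      exact (Category.comp_id _).trans (Category.id_comp _).symm
    exact key h.nil_eq (by rw [h.nil_eq]) (by rw [h.nil_eq])
  | cons a K ih =>
    exact perm_cons_naturality (ih _ _) (tensorListPull_naturality f a K' _)

/-- Coherence concerns structural morphisms only; naturality is needed to carry actual operations,
and morphisms of collections, through a regrouping of the factors. -/
theorem regroup_naturality {n m : ℕ} {k : Fin m → ℕ} (φ : Fin n → Fin m)
    (h : ∀ i, k i = (Finset.univ.filter (fun t => φ t = i)).card) {Y Z : Fin n → V}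
    (f : ∀ t, Y t ⟶ Z t) : tensorFinMap f ≫ (regroup φ h Z).hom =
      (regroup φ h Y).hom ≫ tensorFinMap (fun i => tensorFinMap fun x => f (fiberEmb φ i (h i) x)) := by
  let L := fun i => (List.finRange (k i)).map (fiberEmb φ i (h i))
  have h₁ := tensorListPerm_naturality f _ _ (regroup_perm φ h)
  have h₂ := tensorListFlatMap_naturality f L (List.finRange m)
  have h₃ : ∀ e e', tensorListMap (fun i => tensorListMap f (L i)) (List.finRange m) ≫ eqToHom e' =
      eqToHom e ≫ tensorFinMap (fun i => tensorFinMap fun x => f (fiberEmb φ i (h i) x)) := by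
    intro e e'
    rw [eqToHom_tensorList (fun i => tensorList_map Y _ _) e,
      eqToHom_tensorList (fun i => tensorList_map Z _ _) e', ← tensorListMap_comp,
      ← tensorListMap_comp]
    exact congrArg (fun F => tensorListMap F _) (funext fun i => tensorListMap_map _ _ _ _ _)
  simp only [regroup, Iso.trans_hom, eqToIso.hom, Category.assoc]
  rw [reassoc_of% h₁, reassoc_of% h₂, h₃]

end Naturality

/-! ### The endomorphism operad of a collection, over bouquets -/

section BouquetEnd

open Bouquet Presentation

variable {C : Type u} {V : Type u'} {A : C → V}

theorem root_congr {b c : Bouquet C} (h : b = c) : A b.root = A c.root := by rw [h]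

theorem col_congr {b c : Bouquet C} (h : b = c) (i : Fin b.n) (j : Fin c.n) (hij : i.val = j.val) :
    A (b.col i) = A (c.col j) := by
  subst h; rw [Fin.ext hij]

variable [Category.{v'} V]

theorem comp_congr_id {W X Y Z : V} {a : W ⟶ X} {b b' : X ⟶ Y} {x : Y ⟶ Z} (h : b = b') :
    a ≫ b ≫ x ≫ 𝟙 Z = a ≫ b' ≫ x := by
  rw [h, Category.comp_id]

theorem comp_of_comp_eq_id {X Y Z : V} {a : X ⟶ Y} {b : Y ⟶ X} (h : a ≫ b = 𝟙 X) (x : X ⟶ Z) :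
    a ≫ b ≫ x = x := by
  rw [reassoc_of% h]

theorem comp_assoc_of_comm {X Y Y' Y'' Q Q' R Z Z' W : V} {a : X ⟶ Y} {s : Y ⟶ Y'} {b : X ⟶ Q}
    {c : Q ⟶ Y'} {ε : Q ⟶ Q'} {g : Q' ⟶ Y''} {e : Y' ⟶ Y''} {d : Y'' ⟶ R} {r : R ⟶ Z} {t : Y ⟶ R}
    {i : Z ⟶ W} {j : Z ⟶ Z'} {k : Z' ⟶ W} (h : a ≫ s = b ≫ c) (h' : ε ≫ g = c ≫ e)
    (ht : t = s ≫ e ≫ d) (hi : i = j ≫ k) :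
    a ≫ t ≫ r ≫ i = b ≫ ε ≫ (g ≫ d ≫ r ≫ j) ≫ k := by
  simp only [ht, hi, Category.assoc]
  rw [reassoc_of% h, reassoc_of% h']

variable [MonoidalCategory V]

/-- The operations on the collection `A` whose colours are given by a bouquet. -/
abbrev BouquetEnd (A : C → V) (b : Bouquet C) : Type v' :=
  tensorFin (fun t => A (b.col t)) ⟶ A b.root

theorem tensorFin_bouquet_congr {b c : Bouquet C} (h : b = c) :
    tensorFin (fun t => A (b.col t)) = tensorFin (fun t => A (c.col t)) := by rw [h]

/-- The identity operation. -/
def bouquetUnit (A : C → V) (T : C) : BouquetEnd A (corolla T) :=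
  (tensorFinOne rfl (fun _ => A T) (A T) (fun _ => rfl)).hom

theorem tensorFinOne_naturality {n : ℕ} (hn : n = 1) {X Y : V} (f : X ⟶ Y) :
    tensorFinMap (fun _ : Fin n => f) ≫ (tensorFinOne hn (fun _ => Y) Y (fun _ => rfl)).hom =
      (tensorFinOne hn (fun _ => X) X (fun _ => rfl)).hom ≫ f := by
  subst hn
  have key : ∀ (L : List (Fin 1)) (_ : L = [0]) (e : tensorList (fun _ => X) L = X ⊗ 𝟙_ V)
      (e' : tensorList (fun _ => Y) L = Y ⊗ 𝟙_ V),
      tensorListMap (fun _ => f) L ≫ eqToHom e' = eqToHom e ≫ (f ⊗ₘ 𝟙 _) := by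
    rintro _ rfl e e'
    exact (Category.comp_id _).trans (Category.id_comp _).symm
  have e : ∀ Z : V, tensorFin (fun _ : Fin 1 => Z) = Z ⊗ 𝟙_ V := fun Z => by
    simp [tensorFin, List.finRange_succ, tensorList]
  have h := key (List.finRange 1) (by simp [List.finRange_succ]) (e X) (e Y)
  exact show tensorFinMap (fun _ : Fin 1 => f) ≫ eqToHom (e Y) ≫ (ρ_ Y).hom =
    (eqToHom (e X) ≫ (ρ_ X).hom) ≫ f by rw [reassoc_of% h]; simp

variable [SymmetricCategory V]

/-- The composition of operations along a map of bouquets. -/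
def bouquetComp {b c : Bouquet C} (f : b ⟶ c) (p : ∀ y, BouquetEnd A (fib f y))
    (x : BouquetEnd A c) : BouquetEnd A b :=
  (regroup (Hom.map f) (fun _ => rfl) (fun t => A (b.col t))).hom ≫ tensorFinMap p ≫ x ≫
    eqToHom (congrArg A (Hom.root_eq f).symm)

/-- The regrouping of a tensor product according to a map of bouquets whose fibers are `d y`. -/
def split (A : C → V) {b c : Bouquet C} (f : b ⟶ c) {d : Fin c.n → Bouquet C}
    (hd : ∀ y, fib f y = d y) :
    tensorFin (fun t => A (b.col t)) ⟶ tensorFin fun y => tensorFin fun x => A ((d y).col x) :=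
  (regroup (Hom.map f) (fun _ => rfl) (fun t => A (b.col t))).hom ≫
    tensorFinMap fun y => eqToHom (tensorFin_bouquet_congr (hd y))

theorem split_coherent {ι : Type} {X : ι → V} {b c : Bouquet C} (f : b ⟶ c)
    {d : Fin c.n → Bouquet C} (hd : ∀ y, fib f y = d y) (p : ∀ t, Presentation X (A (b.col t)))
    (q : ∀ y x, Presentation X (A ((d y).col x)))
    (hpq : ∀ y x x' (h : x.val = x'.val), Coherent (p (inc f y x)) (q y x')
      (eqToHom (col_congr (hd y) x x' h))) :
    Coherent (fin p) (fin fun y => fin fun x => q y x) (split A f hd) :=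
  (Coherent.regroup _ _ p).comp <| Coherent.tensorListMap (fun y =>
    Coherent.fin_eqToHom (congrArg n (hd y)) (fun i j hij => col_congr (hd y) i j hij) (hpq y) _) _

/-- Makes composites computable when the fibers are only propositionally equal to known bouquets `d
y`: the heterogeneous equalities turn into transports, with those on the inputs absorbed into
`split`. -/
theorem bouquetComp_eq {b c : Bouquet C} (f : b ⟶ c) {d : Fin c.n → Bouquet C}
    (hd : ∀ y, fib f y = d y) {p : ∀ y, BouquetEnd A (fib f y)} {q : ∀ y, BouquetEnd A (d y)}
    (h : ∀ y, HEq (p y) (q y)) (x : BouquetEnd A c) :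
    bouquetComp f p x = split A f hd ≫
      tensorFinMap (fun y => q y ≫ eqToHom (root_congr (hd y).symm)) ≫ x ≫
      eqToHom (congrArg A (Hom.root_eq f).symm) := by
  obtain rfl : d = fun y => fib f y := funext fun y => (hd y).symm
  obtain rfl : p = q := funext fun y => eq_of_heq (h y)
  have e := tensorFinMap_id fun y => tensorFin fun t => A ((fib f y).col t)
  simp only [bouquetComp, split, Category.assoc, eqToHom_refl, Category.comp_id]
  exact congrArg (CategoryStruct.comp _) (Eq.trans (Category.id_comp _).symm
    (congrArg (· ≫ tensorFinMap p ≫ x ≫ _) e.symm))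

theorem bouquetComp_assoc {a b c : Bouquet C} (f : a ⟶ b) (g : b ⟶ c) (h : a ⟶ c) (w : f ≫ g = h)
    (ε' : ∀ i j, BouquetEnd A (fib (fibMap f g h w i) j)) (ε : ∀ j, BouquetEnd A (fib f j))
    (δ : ∀ i, BouquetEnd A (fib g i)) (r : BouquetEnd A c)
    (hε : ∀ i j, HEq (ε' i j) (ε (inc g i j))) :
    bouquetComp h (fun i => bouquetComp (fibMap f g h w i) (ε' i) (δ i)) r =
      bouquetComp f ε (bouquetComp g δ r) := by
  have h₁ : ∀ i, bouquetComp (fibMap f g h w i) (ε' i) (δ i) =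
      split A (fibMap f g h w i) (fib_fibMap f g h w i) ≫
        tensorFinMap (fun j => ε (inc g i j)) ≫ δ i := fun i => by
    rw [bouquetComp_eq (fibMap f g h w i) (fib_fibMap f g h w i) (hε i)]
    exact comp_congr_id (congrArg (fun F => tensorListMap F _)
      (funext fun j => Category.comp_id (ε (inc g i j))))
  -- Grouping by `h` and then within each block by the induced map is the same as grouping by `f`
  -- and then by `g`. Every factor is labelled by its position among the inputs of `a`, and the
  -- labels agree by `inc_inc`.
  have h₂ : (regroup (Hom.map h) (fun _ => rfl) (fun t => A (a.col t))).hom ≫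
      tensorFinMap (fun i => split A (fibMap f g h w i) (fib_fibMap f g h w i)) =
    (regroup (Hom.map f) (fun _ => rfl) (fun t => A (a.col t))).hom ≫
      (regroup (Hom.map g) (fun _ => rfl) (fun j => tensorFin fun x => A ((fib f j).col x))).hom := by
    refine Coherent.unique (p := self _)
      (q := fin fun i => fin fun j => fin fun x => leaf (inc f (inc g i j) x) rfl) ?_ ?_
      (self_nodup _)
    · refine (Coherent.regroup _ _ _).comp (Coherent.tensorListMap (fun i => ?_) _)
      exact split_coherent (fibMap f g h w i) (fib_fibMap f g h w i)
        (fun x => leaf (inc h i x) rfl) (fun j x => leaf (inc f (inc g i j) x) rfl)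
        fun j x x' hx => Coherent.leaf _ _ (inc_inc f g h w i j x x' hx).symm _
    · exact (Coherent.regroup _ _ _).comp (Coherent.regroup _ _ _)
  -- The operations `ε j` are moved through the regrouping along `g`.
  have h₃ := regroup_naturality (Hom.map g) (fun _ => rfl) ε
  rw [bouquetComp, funext h₁]
  exact comp_assoc_of_comm h₂ h₃ ((tensorFinMap_comp _ _).trans
    (congrArg (tensorFinMap _ ≫ ·) (tensorFinMap_comp _ _))) (by simp)

theorem bouquetComp_unit_left {b : Bouquet C} (ε : ∀ i, BouquetEnd A (fib (𝟙 b) i))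
    (x : BouquetEnd A b) (hε : ∀ i, HEq (ε i) (bouquetUnit A (b.col i))) :
    bouquetComp (𝟙 b) ε x = x := by
  rw [bouquetComp_eq (𝟙 b) (fib_id b) hε]
  have h : split A (𝟙 b) (fib_id b) ≫ tensorFinMap (fun y => bouquetUnit A (b.col y)) = 𝟙 _ := by
    refine Coherent.unique (p := self _) (q := self _) ?_ (Coherent.id _) (self_nodup _)
    refine (split_coherent _ _ _ (fun y _ => leaf y rfl) fun y x x' _ =>
      Coherent.leaf _ _ (map_inc (𝟙 b) y x) _).comp (Coherent.tensorListMap (fun y => ?_) _)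
    exact Coherent.tensorFinOne _ _ fun _ => Coherent.id _
  exact (comp_congr_id (congrArg (fun F => tensorListMap F _)
      (funext fun y => Category.comp_id (bouquetUnit A (b.col y))))).trans
    (comp_of_comp_eq_id h x)

theorem bouquetComp_unit_right {b : Bouquet C} {T : C} (f : b ⟶ corolla T)
    (ε : ∀ i, BouquetEnd A (fib f i)) (x : BouquetEnd A b) (hε : ∀ i, HEq (ε i) x) :
    bouquetComp f ε (bouquetUnit A T) = x := by
  obtain rfl : b.root = T := Hom.root_eq f
  rw [bouquetComp_eq f (fib_corolla f) hε]
  have h : split A f (fib_corolla f) ≫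
      (tensorFinOne (n := 1) rfl (fun _ => tensorFin fun t => A (b.col t)) _ (fun _ => rfl)).hom = 𝟙 _ := by
    refine Coherent.unique (p := self _) (q := self _) ?_ (Coherent.id _) (self_nodup _)
    refine (split_coherent _ _ _ (fun _ x => leaf x rfl) fun y x x' hx =>
      Coherent.leaf _ _ (inc_corolla f y x' x hx.symm) _).comp ?_
    exact Coherent.tensorFinOne _ _ fun _ => Coherent.id _
  -- Naturality moves `x` past the identity operation, so that only rearrangements of its inputs
  -- remain on the other side.
  have h' := tensorFinOne_naturality (rfl : 1 = 1) x
  exact (comp_congr_id (congrArg (fun F => tensorListMap F _)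
      (funext fun _ => Category.comp_id x))).trans
    ((congrArg (split A f (fib_corolla f) ≫ ·) h').trans (comp_of_comp_eq_id h x))

end BouquetEnd

/-! ### The generating operations and relations in an endomorphism operad -/

section Generators

open Bouquet Presentation OperadicCategory

variable {V : Type u'} [Category.{v'} V] [MonoidalCategory V]

/-- The first factor of a finite tensor product. -/
def tensorFinSucc {n : ℕ} (X : Fin (n + 1) → V) :
    tensorFin X ≅ X 0 ⊗ tensorFin (fun i => X i.succ) :=
  eqToIso (congrArg (tensorList X) List.finRange_succ) ≪≫
    whiskerLeftIso (X 0) (eqToIso (tensorList_map X Fin.succ (List.finRange n)))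

omit [MonoidalCategory V] in
theorem comp_comm_of_comm {X X' Y Y' Z Z' : V} {f : X ⟶ X'} {g : Y ⟶ Y'} {k : Z ⟶ Z'}
    {a : X ⟶ Y} {a' : X' ⟶ Y'} {b : Y ⟶ Z} {b' : Y' ⟶ Z'} (h : f ≫ a' = a ≫ g)
    (h' : g ≫ b' = b ≫ k) : f ≫ a' ≫ b' = (a ≫ b) ≫ k := by
  rw [reassoc_of% h, h', Category.assoc]

theorem tensorFinSucc_naturality {n : ℕ} {X Y : Fin (n + 1) → V} (f : ∀ i, X i ⟶ Y i) :
    tensorFinMap f ≫ (tensorFinSucc Y).hom =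
      (tensorFinSucc X).hom ≫ (f 0 ⊗ₘ tensorFinMap fun i => f i.succ) := by
  have key : ∀ (L : List (Fin (n + 1))) (h : L = 0 :: (List.finRange n).map Fin.succ),
      tensorListMap f L ≫ eqToHom (congrArg (tensorList Y) h) =
      eqToHom (congrArg (tensorList X) h) ≫
        (f 0 ⊗ₘ tensorListMap f ((List.finRange n).map Fin.succ)) := by
    rintro _ rfl
    exact (Category.comp_id _).trans (Category.id_comp _).symm
  have h₁ := key _ List.finRange_succ
  have h₂ := tensorHom_whiskerLeft_of_comm (f := f 0)
    (tensorListMap_map f Fin.succ (List.finRange n) (tensorList_map X _ _) (tensorList_map Y _ _))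
  exact comp_comm_of_comm h₁ h₂

/-- A finite tensor product without factors is the monoidal unit. -/
def tensorFinZero (X : Fin 0 → V) : tensorFin X ≅ 𝟙_ V :=
  eqToIso (congrArg (tensorList X) List.finRange_zero)

theorem bouquetComp_genOp_aux {X Y Y' Z Z' K K' M N : V} {r : X ⟶ Y} {p : Y ⟶ Y'}
    {e : Y ≅ Z ⊗ K} {e' : Y' ≅ Z' ⊗ K'} {q q' : Z ⟶ Z'} {q₀ : K ⟶ K'} {i : Z ⟶ Z}
    {γ : Z' ⊗ K' ⟶ M} {j : M ⟶ N} (h : p ≫ e'.hom = e.hom ≫ (q ⊗ₘ q₀)) (hi : i = 𝟙 _)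
    (hq : q' = q) :
    r ≫ p ≫ (e'.hom ≫ γ) ≫ j =
      (r ≫ e.hom ≫ (i ⊗ₘ 𝟙 _)) ≫ (q' ⊗ₘ q₀ ≫ 𝟙 _) ≫ γ ≫ j := by
  simp only [Category.assoc, hi, hq]
  rw [reassoc_of% h]
  simp

variable [SymmetricCategory V]

/-- The isomorphism which moves the first factor of a finite tensor product to the end. -/
def headLast {n : ℕ} (X : Fin (n + 1) → V) :
    tensorFin X ≅ tensorFin (fun i => X i.succ) ⊗ X 0 :=
  tensorFinSucc X ≪≫ β_ _ _

theorem headLast_naturality {n : ℕ} {X Y : Fin (n + 1) → V} (f : ∀ i, X i ⟶ Y i) :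
    tensorFinMap f ≫ (headLast Y).hom =
      (headLast X).hom ≫ (tensorFinMap (fun i => f i.succ) ⊗ₘ f 0) := by
  simp only [headLast, Iso.trans_hom, Category.assoc]
  rw [reassoc_of% (tensorFinSucc_naturality f), BraidedCategory.braiding_naturality]

namespace Coherent

variable {ι : Type} {X : ι → V}

theorem tensorFinSucc {n : ℕ} {Y : Fin (n + 1) → V} (p : ∀ k, Presentation X (Y k)) :
    Coherent (fin p) ((p 0).tensor (fin fun k => p k.succ)) (tensorFinSucc Y).hom :=
  (list_eqToHom p List.finRange_succ (congrArg (tensorList Y) List.finRange_succ)).comp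
    (whiskerLeft (p 0) (tensorList_map p Fin.succ (List.finRange n)
      (OperadicCat.tensorList_map _ _ _)))

theorem headLast {n : ℕ} {Y : Fin (n + 1) → V} (p : ∀ k, Presentation X (Y k)) :
    Coherent (fin p) ((fin fun k => p k.succ).tensor (p 0)) (headLast Y).hom :=
  (tensorFinSucc p).comp (braiding _ _)

theorem tensorFinZero {Y : Fin 0 → V} (p : ∀ k, Presentation X (Y k)) :
    Coherent (fin p) unit (tensorFinZero Y).hom :=
  list_eqToHom p (K' := []) List.finRange_zero (congrArg (tensorList Y) List.finRange_zero)

theorem tensorListUnit {κ : Type} (K : List κ) :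
    Coherent (X := X) unit (list (fun _ => unit) K) (tensorListUnit K).hom := by
  induction K with
  | nil => exact Coherent.id _
  | cons k K ih => exact (leftUnitor unit).inv.comp (whiskerLeft _ ih)

end Coherent

variable {O : Type u} [Category.{v} O] [OperadicCategory O] {A : O → V}

/-- The operation of arity `(S, F₁,…,F_k; T)` given by a structure map of an operad. -/
def genOp {T S : O} {f : T ⟶ S} (γ : fiberTensor A f ⊗ A S ⟶ A T) : BouquetEnd A (genBouquet f) :=
  (headLast (fun t => A ((genBouquet f).col t))).hom ≫ γ

/-- The operation without inputs given by a unit of an operad. -/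
def nullaryOp {T : O} (u : 𝟙_ V ⟶ A T) : BouquetEnd A (nullary T) :=
  (tensorFinZero _).hom ≫ u

theorem fiberTensorIso_coherent {ι : Type} {X : ι → V} {T S R : O} (f : T ⟶ S) (g : S ⟶ R)
    (h : T ⟶ R) (w : f ≫ g = h) (p : ∀ j, Presentation X (A (fiber f j)))
    (q : ∀ i j, Presentation X (A (fiber (fiberMap f g h w i) j)))
    (hpq : ∀ i j, Coherent (q i j) (p (incl g i j))
      (eqToHom (congrArg A (fiber_fiberMap' f g h w i j)))) :
    Coherent (fin fun i => fin (q i)) (fin p) (fiberTensorIso A f g h w).hom := by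
  refine Coherent.comp (q := fin fun i => fin fun j => p (incl g i j)) ?_
    (Coherent.regroup (cardMap g) (card_fiber g) p).inv
  have e : ∀ i, fiberTensor A (fiberMap f g h w i) = tensorFin fun j => A (fiber f (incl g i j)) :=
    fun i => congrArg tensorFin (funext fun j => congrArg A (fiber_fiberMap' f g h w i j))
  refine (Coherent.tensorListMap (fun i => ?_) _).congr
    (eqToHom_tensorList e (congrArg (fun F => tensorList F _) (funext e))).symm
  exact (Coherent.tensorListMap (hpq i) _).congr (eqToHom_tensorList _ _).symm

theorem inc_eq_of_strictMono {C : Type u} {b c : Bouquet C} (f : b ⟶ c) (i : Fin c.n) {k : ℕ}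
    (hk : (fib f i).n = k) (e : Fin k → Fin b.n) (he : StrictMono e)
    (hf : ∀ x, Hom.map f (e x) = i) (y : Fin (fib f i).n) (x : Fin k) (hxy : y.val = x.val) :
    inc f i y = e x := by
  subst hk
  obtain rfl := Fin.ext hxy
  exact (congrFun (fiberEmb_unique (h := rfl) he hf) y).symm

theorem bouquetUnit_coherent {C : Type u} {A : C → V} {ι : Type} {X : ι → V} {T : C}
    (p : Presentation X (A T)) : Coherent (fin fun _ => p) p (bouquetUnit A T) :=
  Coherent.tensorFinOne _ _ fun _ => Coherent.id _

/-- The presentation of the inputs of a generating operation. -/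
def genPres {ι : Type} {X : ι → V} {T S : O} {f : T ⟶ S} (p : Presentation X (A S))
    (q : ∀ j, Presentation X (A (fiber f j))) :
    ∀ x, Presentation X (A ((genBouquet f).col x)) :=
  Fin.cases p q

theorem headLast_genPres_coherent {ι : Type} {X : ι → V} {T S : O} {f : T ⟶ S}
    (p : Presentation X (A S)) (q : ∀ j, Presentation X (A (fiber f j))) :
    Coherent (fin (genPres p q)) ((fin q).tensor p)
      (headLast (fun t => A ((genBouquet f).col t))).hom :=
  Coherent.headLast (genPres p q)

section Split

variable {b : Bouquet O} {T S : O} {k : T ⟶ S} (φ : b ⟶ genBouquet k) {d₀ : Bouquet O}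
  {d : Fin (card S) → Bouquet O} (h₀ : fib φ (0 : Fin (card S + 1)) = d₀)
  (h : ∀ j : Fin (card S), fib φ j.succ = d j)

/-- The regrouping of a tensor product along a map to the arity of a generating operation, whose
fibers are `d₀` and `d j`. -/
def splitGen (A : O → V) : tensorFin (fun t => A (b.col t)) ⟶
    tensorFin (fun j => tensorFin fun x => A ((d j).col x)) ⊗ tensorFin fun x => A (d₀.col x) :=
  (regroup (Hom.map φ) (fun _ => rfl) (fun t => A (b.col t))).hom ≫
    (headLast (n := card S) fun y => tensorFin fun x => A ((fib φ y).col x)).hom ≫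
    (tensorFinMap (fun j => eqToHom (tensorFin_bouquet_congr (h j))) ⊗ₘ
      eqToHom (tensorFin_bouquet_congr h₀))

/-- Nontrivial composites in the generating relations have a generator `Γ_k` at the root. This
brings them to a common shape: a structural rearrangement of the inputs, then the plugged operations
in parallel, in the order expected by `γ`, then `γ` itself. -/
theorem bouquetComp_genOp {p : ∀ y : Fin (card S + 1), BouquetEnd A (fib φ y)}
    {q₀ : BouquetEnd A d₀} {q : ∀ j, BouquetEnd A (d j)} (hp₀ : HEq (p 0) q₀)
    (hp : ∀ j : Fin (card S), HEq (p j.succ) (q j)) (γ : fiberTensor A k ⊗ A S ⟶ A T) :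
    bouquetComp φ p (genOp γ) = splitGen φ h₀ h A ≫
      (tensorFinMap (fun j => q j ≫ eqToHom (root_congr (h j).symm)) ⊗ₘ
        q₀ ≫ eqToHom (root_congr h₀.symm)) ≫ γ ≫
      eqToHom (congrArg A (Hom.root_eq φ).symm) := by
  subst h₀
  obtain rfl : d = fun j => fib φ j.succ := funext fun j => (h j).symm
  obtain rfl := eq_of_heq hp₀
  obtain rfl : q = fun j : Fin (card S) => p j.succ := funext fun j => (eq_of_heq (hp j)).symm
  have h₁ := headLast_naturality (n := card S) p
  have h₂ := tensorFinMap_id fun j : Fin (card S) =>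
    tensorFin fun x => A ((fib φ j.succ).col x)
  have h₃ : tensorFinMap (fun j : Fin (card S) => p j.succ ≫ 𝟙 _) =
      tensorFinMap (fun j : Fin (card S) => p j.succ) :=
    congrArg (fun F => tensorListMap F _) (funext fun j => Category.comp_id (p j.succ))
  exact bouquetComp_genOp_aux h₁ h₂ h₃

theorem splitGen_coherent {ι : Type} {X : ι → V} (p : ∀ t, Presentation X (A (b.col t)))
    (q₀ : ∀ x, Presentation X (A (d₀.col x))) (q : ∀ j x, Presentation X (A ((d j).col x)))
    (hpq₀ : ∀ x x' (hx : x.val = x'.val), Coherent (p (inc φ (0 : Fin (card S + 1)) x)) (q₀ x')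
      (eqToHom (col_congr h₀ x x' hx)))
    (hpq : ∀ (j : Fin (card S)) x x' (hx : x.val = x'.val),
      Coherent (p (inc φ j.succ x)) (q j x') (eqToHom (col_congr (h j) x x' hx))) :
    Coherent (fin p) ((fin fun j => fin (q j)).tensor (fin q₀)) (splitGen φ h₀ h A) :=
  (Coherent.regroup _ _ p).comp <| (Coherent.headLast _).comp <|
    (Coherent.tensorListMap (fun j => Coherent.fin_eqToHom (congrArg Bouquet.n (h j))
      (fun x y hxy => col_congr (h j) x y hxy) (hpq j) _) _).tensorHom
    (Coherent.fin_eqToHom (congrArg Bouquet.n h₀) (fun x y hxy => col_congr h₀ x y hxy) hpq₀ _)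

end Split

section Assoc

variable {T S R : O} (f : T ⟶ S) (g : S ⟶ R)

/-- The presentation of the factor `A R`. -/
def assocPresBase (A : O → V) :
    Presentation (fun t => A ((assocBouquet f g).col t)) (A R) :=
  leaf (Fin.castAdd (card S) (0 : Fin (card R + 1))) (congrArg A (assocBouquet_col_castAdd f g 0).symm)

/-- The presentation of the factors given by the fibers of `g`. -/
def assocPresRight (A : O → V) (i : Fin (card R)) :
    Presentation (fun t => A ((assocBouquet f g).col t)) (A (fiber g i)) :=
  leaf (Fin.castAdd (card S) i.succ) (congrArg A (assocBouquet_col_castAdd f g i.succ).symm)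

/-- The presentation of the factors given by the fibers of `f`. -/
def assocPresLeft (A : O → V) (j : Fin (card S)) :
    Presentation (fun t => A ((assocBouquet f g).col t)) (A (fiber f j)) :=
  leaf (Fin.natAdd (card R + 1) j) (congrArg A (assocBouquet_col_natAdd f g j).symm)

/-- The rearrangement of the inputs on the left hand side of the associativity relation. -/
def assocLeftMap (A : O → V) : tensorFin (fun t => A ((assocBouquet f g).col t)) ⟶
    fiberTensor A f ⊗ (fiberTensor A g ⊗ A R) :=
  splitGen (assocLeft f g) (fib_assocLeft_zero f g) (fib_assocLeft_succ f g) A ≫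
    (tensorFinMap (fun j => bouquetUnit A (fiber f j)) ⊗ₘ
      (headLast (fun t => A ((genBouquet g).col t))).hom)

theorem assocLeftMap_coherent : Coherent (self fun t => A ((assocBouquet f g).col t))
    ((fin (assocPresLeft f g A)).tensor
      ((fin (assocPresRight f g A)).tensor (assocPresBase f g A)))
    (assocLeftMap f g A) := by
  refine (splitGen_coherent (assocLeft f g) (fib_assocLeft_zero f g) (fib_assocLeft_succ f g) _
    (genPres (assocPresBase f g A) (assocPresRight f g A)) (fun j _ => assocPresLeft f g A j)
    (fun x x' hx => ?_) (fun j x x' hx => ?_)).comp <|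
    (Coherent.tensorListMap (fun j => bouquetUnit_coherent (assocPresLeft f g A j)) _).tensorHom
      (headLast_genPres_coherent _ _)
  -- The inclusion of a fiber is its only increasing enumeration, hence the explicit one; the case
  -- distinction separates the input `R` from the fibers of `g`.
  · have hinc := inc_eq_of_strictMono (assocLeft f g) (0 : Fin (card S + 1))
      (congrArg Bouquet.n (fib_assocLeft_zero f g)) (Fin.castAdd (card S))
      (Fin.strictMono_castAdd (card S)) (assocLeft_castAdd f g) x x' hx
    revert hx hinc
    refine Fin.cases (fun _ _ => ?_) (fun i _ _ => ?_) x'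
    · exact Coherent.leaf _ _ ‹_› _
    · exact Coherent.leaf _ _ ‹_› _
  · exact Coherent.leaf _ _ (inc_eq_of_strictMono (assocLeft f g) j.succ
      (congrArg Bouquet.n (fib_assocLeft_succ f g j)) (fun _ => Fin.natAdd (card R + 1) j)
      (Subsingleton.strictMono (α := Fin 1) _) (fun _ => assocLeft_natAdd f g j) x x' hx) _

variable {h : T ⟶ R} (w : f ≫ g = h)

/-- The presentation of the factors given by the fibers of the maps induced on fibers. -/
def assocPresFiber (A : O → V) (i : Fin (card R)) (j : Fin (card (fiber g i))) :
    Presentation (fun t => A ((assocBouquet f g).col t)) (A (fiber (fiberMap f g h w i) j)) :=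
  leaf (Fin.natAdd (card R + 1) (incl g i j)) (congrArg A
    ((fiber_fiberMap' f g h w i j).trans (assocBouquet_col_natAdd f g _).symm))

/-- The rearrangement of the inputs on the right hand side of the associativity relation. -/
def assocRightMap (A : O → V) : tensorFin (fun t => A ((assocBouquet f g).col t)) ⟶
    tensorFin (fun i => fiberTensor A (fiberMap f g h w i) ⊗ A (fiber g i)) ⊗ A R :=
  splitGen (assocRight f g h) (fib_assocRight_zero f g h) (fib_assocRight_succ f g h w) A ≫
    (tensorFinMap (fun i => (headLast (fun t => A ((genBouquet (fiberMap f g h w i)).col t))).hom)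
      ⊗ₘ bouquetUnit A R)

theorem assocRight_assocRightEnum (i : Fin (card R)) (x : Fin (card (fiber g i) + 1)) :
    Hom.map (assocRight f g h) (assocRightEnum g i x) = i.succ :=
  Fin.cases (assocRight_castAdd f g h i.succ)
    (fun j => (assocRight_natAdd f g h _).trans (congrArg Fin.succ (cardMap_incl g i j))) x

theorem assocRightMap_coherent : Coherent (self fun t => A ((assocBouquet f g).col t))
    ((fin fun i => (fin (assocPresFiber f g w A i)).tensor (assocPresRight f g A i)).tensor
      (assocPresBase f g A)) (assocRightMap f g w A) := by
  refine (splitGen_coherent (assocRight f g h) (fib_assocRight_zero f g h)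
    (fib_assocRight_succ f g h w) _ (fun _ => assocPresBase f g A)
    (fun i => genPres (assocPresRight f g A i) (assocPresFiber f g w A i))
    (fun x x' hx => ?_) (fun i x x' hx => ?_)).comp <|
    (Coherent.tensorListMap (fun i => headLast_genPres_coherent _ _) _).tensorHom
      (bouquetUnit_coherent _)
  · exact Coherent.leaf _ _ (inc_eq_of_strictMono (assocRight f g h) (0 : Fin (card R + 1))
      (congrArg Bouquet.n (fib_assocRight_zero f g h))
      (fun _ => Fin.castAdd (card S) (0 : Fin (card R + 1)))
      (Subsingleton.strictMono (α := Fin 1) _) (fun _ => assocRight_castAdd f g h 0) x x' hx) _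
  · have hinc := inc_eq_of_strictMono (assocRight f g h) i.succ
      (congrArg Bouquet.n (fib_assocRight_succ f g h w i)) _ (assocRightEnum_strictMono g i)
      (assocRight_assocRightEnum f g i) x x' hx
    revert hx hinc
    refine Fin.cases (fun _ _ => ?_) (fun i _ _ => ?_) x'
    · exact Coherent.leaf _ _ ‹_› _
    · exact Coherent.leaf _ _ ‹_› _

/-- The rearrangements of `R, G₁,…,G_k, F₁,…,F_l` on the two sides of the relation differ precisely
by the isomorphisms in the associativity axiom: both are coherent for the same labels. -/
theorem assocRightMap_eq : assocRightMap f g w A = assocLeftMap f g A ≫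
    (fiberTensorIso A f g h w).inv ▷ _ ≫ (α_ _ _ _).inv ≫
      tensorListShuffle (fun i => fiberTensor A (fiberMap f g h w i)) (fun i => A (fiber g i))
        (List.finRange (card R)) ▷ A R := by
  refine Coherent.unique (assocRightMap_coherent f g w) ?_ (self_nodup _)
  exact (assocLeftMap_coherent f g).comp <| (Coherent.whiskerRight
    (fiberTensorIso_coherent f g h w (assocPresLeft f g A) (assocPresFiber f g w A)
      fun i j => Coherent.leaf _ _ rfl _).inv _).comp <| (Coherent.associator _ _ _).inv.comp <|
    Coherent.whiskerRight (Coherent.tensorListShuffle _ _ _) _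

end Assoc

end Generators

/-! ### The generating relations are equivalent to the operad axioms -/

section Relations

open Bouquet Presentation OperadicCategory

variable {V : Type u'} [Category.{v'} V] [MonoidalCategory V]

/-- Since the rearrangement `l` of the inputs is invertible, it can be cancelled from the relation;
what remains is the associativity axiom. Invertibility is what yields an equivalence instead of an
implication. -/
theorem assoc_iff_aux {X A B C D E G H T : V} {l : X ⟶ B ⊗ (C ⊗ D)} {r : X ⟶ G ⊗ D} [IsIso l]
    {t : A ≅ B} {s : A ⊗ C ⟶ G} (hr : r = l ≫ t.inv ▷ _ ≫ (α_ A C D).inv ≫ s ▷ D)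
    {m : G ⟶ H} {γh : H ⊗ D ⟶ T} {γg : C ⊗ D ⟶ E} {γf : B ⊗ E ⟶ T} :
    l ≫ B ◁ γg ≫ γf = r ≫ m ▷ D ≫ γh ↔
      ((s ≫ m) ▷ D) ≫ γh = (α_ A C D).hom ≫ (A ◁ γg) ≫ (t.hom ▷ E) ≫ γf := by
  have h₁ : l ≫ B ◁ γg ≫ γf = (l ≫ t.inv ▷ _ ≫ (α_ A C D).inv) ≫
      (α_ A C D).hom ≫ (A ◁ γg) ≫ (t.hom ▷ E) ≫ γf := by
    simp only [Category.assoc, Iso.inv_hom_id_assoc]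
    rw [← whisker_exchange_assoc, ← comp_whiskerRight_assoc, Iso.inv_hom_id, id_whiskerRight,
      Category.id_comp]
  have h₂ : r ≫ m ▷ D ≫ γh = (l ≫ t.inv ▷ _ ≫ (α_ A C D).inv) ≫ ((s ≫ m) ▷ D) ≫ γh := by
    rw [hr]; simp
  rw [h₁, h₂, cancel_epi]
  exact eq_comm

theorem assoc_left_aux {X Y Z B C D E T : V} {s : X ⟶ Y ⊗ Z} {b b' : Y ⟶ B} {l : Z ⟶ C ⊗ D}
    {γg : C ⊗ D ⟶ E} {γf : B ⊗ E ⟶ T} (h : b' = b) :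
    s ≫ (b' ⊗ₘ (l ≫ γg) ≫ 𝟙 _) ≫ γf ≫ 𝟙 _ = (s ≫ (b ⊗ₘ l)) ≫ B ◁ γg ≫ γf := by
  simp [h, MonoidalCategory.tensorHom_def]

theorem assoc_right_aux {X Y Z D G H T : V} {s : X ⟶ Y ⊗ Z} {a : Y ⟶ G} {m : G ⟶ H} {e : Z ⟶ D}
    {γh : H ⊗ D ⟶ T} {q : Y ⟶ H} (h : q = a ≫ m) :
    s ≫ (q ⊗ₘ e ≫ 𝟙 _) ≫ γh ≫ 𝟙 _ = (s ≫ (a ⊗ₘ e)) ≫ m ▷ D ≫ γh := by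
  subst h
  rw [← tensorHom_id, Category.assoc, tensorHom_comp_tensorHom_assoc, Category.comp_id,
    Category.comp_id]

theorem unit_left_aux {X Y Z D G G' T : V} {s : X ⟶ Y ⊗ Z} {a : Y ⟶ G} {m : G ⟶ G'} {e : Z ⟶ D}
    {b : X ⟶ D} (_ : IsIso b) {l : D ⟶ T ⊗ D} {t : T ⟶ G} {q : Y ⟶ G'} {γ : G' ⊗ D ⟶ D}
    (h : s ≫ (a ⊗ₘ e) = b ≫ l ≫ t ▷ D) (hq : q = a ≫ m) :
    s ≫ (q ⊗ₘ e ≫ 𝟙 _) ≫ γ ≫ 𝟙 _ = b ↔ l ≫ ((t ≫ m) ▷ D) ≫ γ = 𝟙 D := by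
  rw [assoc_right_aux hq, h, ← cancel_epi b]
  simp

theorem unit_right_aux {X Y Z D G H K : V} {s : X ⟶ Y ⊗ Z} {a : Y ⟶ G} {e : Z ⟶ K} {u : K ⟶ H}
    {b : X ⟶ D} (_ : IsIso b) {r : D ⟶ D ⊗ K} {t : D ⟶ G} {γ : G ⊗ H ⟶ D}
    (h : s ≫ (a ⊗ₘ e) = b ≫ r ≫ t ▷ K) :
    s ≫ (a ⊗ₘ (e ≫ u) ≫ 𝟙 _) ≫ γ ≫ 𝟙 _ = b ↔ r ≫ D ◁ u ≫ (t ▷ H) ≫ γ = 𝟙 D := by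
  have h' : s ≫ (a ⊗ₘ (e ≫ u) ≫ 𝟙 _) ≫ γ ≫ 𝟙 _ = (s ≫ (a ⊗ₘ e)) ≫ G ◁ u ≫ γ := by
    rw [← id_tensorHom, Category.comp_id, Category.comp_id, Category.assoc,
      tensorHom_comp_tensorHom_assoc, Category.comp_id]
  rw [h', h, ← cancel_epi b, Category.assoc, Category.assoc, ← whisker_exchange_assoc,
    Category.comp_id]

variable [SymmetricCategory V] {O : Type u} {A : O → V}

theorem bouquetUnit_coherent_self (T : O) : Coherent (self fun t => A ((corolla T).col t))
    (leaf (0 : Fin 1) rfl) (bouquetUnit A T) :=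
  Coherent.tensorFinOne _ _ fun _ => Coherent.leaf _ _ (Subsingleton.elim (α := Fin 1) _ _) _

variable [Category.{v} O] [OperadicCategory O]

/-- The maps `γ` are an arbitrary family, not yet an operad. One direction shows that evaluation in
an operad respects the relation; the other extracts the axiom from an algebra. -/
theorem bouquetComp_gen_assoc_iff {T S R : O} (f : T ⟶ S) (g : S ⟶ R) (h : T ⟶ R) (w : f ≫ g = h)
    (γ : ∀ {T S : O} (f : T ⟶ S), fiberTensor A f ⊗ A S ⟶ A T)
    (p : ∀ y : Fin (card S + 1), BouquetEnd A (fib (assocLeft f g) y))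
    (q : ∀ y : Fin (card R + 1), BouquetEnd A (fib (assocRight f g h) y))
    (hp₀ : HEq (p 0) (genOp (γ g)))
    (hp : ∀ j : Fin (card S), HEq (p j.succ) (bouquetUnit A (fiber f j)))
    (hq₀ : HEq (q 0) (bouquetUnit A R))
    (hq : ∀ i : Fin (card R), HEq (q i.succ) (genOp (γ (fiberMap f g h w i)))) :
    bouquetComp (assocLeft f g) p (genOp (γ f)) = bouquetComp (assocRight f g h) q (genOp (γ h)) ↔
      ((tensorListShuffle (fun i => fiberTensor A (fiberMap f g h w i)) (fun i => A (fiber g i))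
          (List.finRange (card R)) ≫
        tensorFinMap (fun i => γ (fiberMap f g h w i))) ▷ A R) ≫ γ h =
      (α_ _ _ _).hom ≫
        (tensorFin (fun i => fiberTensor A (fiberMap f g h w i)) ◁ γ g) ≫
        ((fiberTensorIso A f g h w).hom ▷ A S) ≫ γ f := by
  have := (assocLeftMap_coherent (A := A) f g).isIso
  rw [← assoc_iff_aux (assocRightMap_eq f g w),
    bouquetComp_genOp (assocLeft f g) (fib_assocLeft_zero f g) (fib_assocLeft_succ f g) hp₀ hp,
    bouquetComp_genOp (assocRight f g h) (fib_assocRight_zero f g h)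
      (fib_assocRight_succ f g h w) hq₀ hq]
  have h₁ : tensorFinMap (fun j => bouquetUnit A (fiber f j) ≫ 𝟙 (A (fiber f j))) =
    tensorFinMap (fun j => bouquetUnit A (fiber f j)) :=
      congrArg (fun F => tensorListMap F _) (funext fun j => Category.comp_id _)
  have h₂ : tensorFinMap (fun i => genOp (γ (fiberMap f g h w i)) ≫ 𝟙 (A (fiber h i))) =
      tensorFinMap (fun i => (headLast (fun t => A ((genBouquet (fiberMap f g h w i)).col t))).hom) ≫
        tensorFinMap (fun i => γ (fiberMap f g h w i)) :=
    (congrArg (fun F => tensorListMap F _) (funext fun j => Category.comp_id _)).trans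
      (tensorFinMap_comp _ _)
  exact Eq.congr (assoc_left_aux h₁) (assoc_right_aux h₂)

theorem bouquetComp_gen_unit_left_iff (T : O) (u : ∀ c : π₀ O, 𝟙_ V ⟶ A (U c))
    (γ : fiberTensor A (𝟙 T) ⊗ A T ⟶ A T)
    (p : ∀ y : Fin (card T + 1), BouquetEnd A (fib (pickMap (𝟙 T) 0) y))
    (hp₀ : HEq (p 0) (bouquetUnit A T))
    (hp : ∀ i : Fin (card T), HEq (p i.succ) (nullaryOp (u (comp₀ (fiber (𝟙 T) i))))) :
    bouquetComp (pickMap (𝟙 T) 0) p (genOp γ) = bouquetUnit A T ↔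
      (λ_ (A T)).inv ≫
        (((tensorListUnit (List.finRange (card T))).hom ≫
          tensorFinMap (fun i => u (comp₀ (fiber (𝟙 T) i)) ≫
            eqToHom (congrArg A (U_comp₀_fiber_id T i)))) ▷ A T) ≫ γ = 𝟙 (A T) := by
  have h₀ : fib (pickMap (𝟙 T) 0) (0 : Fin (card T + 1)) = corolla T :=
    fib_pickMap_self (𝟙 T) 0 rfl
  have h : ∀ i : Fin (card T), fib (pickMap (𝟙 T) 0) i.succ =
      nullary (U (comp₀ (fiber (𝟙 T) i))) := fun i =>
    (fib_pickMap_of_ne (𝟙 T) (Fin.succ_ne_zero i).symm).trans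
      (congrArg nullary (U_comp₀_fiber_id T i).symm)
  rw [bouquetComp_genOp (pickMap (𝟙 T) 0) h₀ h hp₀ hp]
  -- The only input is `T`: it forms the fiber over `0`, and all other fibers are empty and
  -- contribute monoidal units. The rearrangement is therefore the insertion of units.
  have key : splitGen (pickMap (𝟙 T) 0) h₀ h A ≫
      (tensorFinMap (fun i => (tensorFinZero _).hom) ⊗ₘ bouquetUnit A T) =
      bouquetUnit A T ≫ (λ_ (A T)).inv ≫
        (tensorListUnit (List.finRange (card T))).hom ▷ A T := by
    let l : Presentation (fun t => A ((corolla T).col t)) (A T) := leaf (0 : Fin 1) rfl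
    refine Coherent.unique (p := self _) (q := (fin fun _ => unit).tensor l) ?_ ?_ (self_nodup _)
    · refine (splitGen_coherent (pickMap (𝟙 T) 0) h₀ h _ (fun _ => l) (fun _ (x : Fin 0) => x.elim0)
        (fun x x' _ => Coherent.leaf _ _ (Subsingleton.elim (α := Fin 1) _ _) _)
        (fun _ _ (x' : Fin 0) => x'.elim0)).comp <|
        (Coherent.tensorListMap (fun _ => Coherent.tensorFinZero _) _).tensorHom
          (bouquetUnit_coherent _)
    · exact (bouquetUnit_coherent_self T).comp <| (Coherent.leftUnitor l).inv.comp <|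
        Coherent.whiskerRight (Coherent.tensorListUnit _) l
  have hq : tensorFinMap (fun i => nullaryOp (u (comp₀ (fiber (𝟙 T) i))) ≫
      eqToHom (root_congr (h i).symm)) = tensorFinMap (fun i => (tensorFinZero
        (fun t => A ((nullary (U (comp₀ (fiber (𝟙 T) i)))).col t))).hom) ≫
        tensorFinMap (fun i => u (comp₀ (fiber (𝟙 T) i)) ≫
          eqToHom (congrArg A (U_comp₀_fiber_id T i))) :=
    (congrArg (fun F => tensorListMap F _) (funext fun _ => Category.assoc _ _ _)).trans
      (tensorFinMap_comp _ _)
  exact unit_left_aux (bouquetUnit_coherent_self T).isIso key hq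

theorem bouquetComp_gen_unit_right_iff {T : O} {c : π₀ O} (f : T ⟶ U c) (i : Fin (card (U c)))
    (u : 𝟙_ V ⟶ A (U c)) (γ : fiberTensor A f ⊗ A (U c) ⟶ A T)
    (p : ∀ y : Fin (card (U c) + 1), BouquetEnd A (fib (pickMap f i.succ) y))
    (hp₀ : HEq (p 0) (nullaryOp u)) (hp : HEq (p i.succ) (bouquetUnit A T)) :
    bouquetComp (pickMap f i.succ) p (genOp γ) = bouquetUnit A T ↔
      (ρ_ (A T)).inv ≫ (A T ◁ u) ≫
      ((tensorFinOne (card_U c) (fun i => A (fiber f i)) (A T)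
        (fun i => congrArg A (fiber_U f i))).inv ▷ A (U c)) ≫ γ = 𝟙 (A T) := by
  -- Since `|U c| = 1`, the single input occupies the only place belonging to a fiber of `f`.
  have hi : ∀ j : Fin (card (U c)), j = i := fun j => by
    have : Subsingleton (Fin (card (U c))) := by rw [card_U]; infer_instance
    exact Subsingleton.elim j i
  have h₀ : fib (pickMap f i.succ) (0 : Fin (card (U c) + 1)) = nullary (U c) :=
    fib_pickMap_of_ne f (Fin.succ_ne_zero i)
  have h : ∀ j : Fin (card (U c)), fib (pickMap f i.succ) j.succ = corolla T := fun j => by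
    rw [hi j]; exact fib_pickMap_self f i.succ (fiber_U f i)
  rw [bouquetComp_genOp (pickMap f i.succ) h₀ h hp₀
    (q := fun _ => bouquetUnit A T) (fun j => by rw [hi j]; exact hp)]
  -- The nullary operation sits at the place of `U c`, so only a unit on the right is inserted; the
  -- identification of the fiber of `f` with `T` respects the single label.
  have key : splitGen (pickMap f i.succ) h₀ h A ≫
      (tensorFinMap (fun j => bouquetUnit A T ≫ eqToHom (congrArg A (fiber_U f j)).symm) ⊗ₘ
        (tensorFinZero _).hom) =
      bouquetUnit A T ≫ (ρ_ (A T)).inv ≫ (tensorFinOne (card_U c) (fun i => A (fiber f i)) (A T)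
        (fun i => congrArg A (fiber_U f i))).inv ▷ 𝟙_ V := by
    let l : Presentation (fun t => A ((corolla T).col t)) (A T) := leaf (0 : Fin 1) rfl
    let l' : ∀ j, Presentation (fun t => A ((corolla T).col t)) (A (fiber f j)) :=
      fun j => leaf (0 : Fin 1) (congrArg A (fiber_U f j))
    refine Coherent.unique (p := self _) (q := (fin l').tensor unit) ?_ ?_ (self_nodup _)
    · refine (splitGen_coherent (pickMap f i.succ) h₀ h _ (fun (x : Fin 0) => x.elim0)
        (fun _ _ => l) (fun _ (x' : Fin 0) => x'.elim0)
        (fun _ x x' _ => Coherent.leaf _ _ (Subsingleton.elim (α := Fin 1) _ _) _)).comp <|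
        (Coherent.tensorListMap (fun j => (bouquetUnit_coherent l).comp
          (Coherent.leaf _ _ rfl _)) _).tensorHom (Coherent.tensorFinZero _)
    · exact (bouquetUnit_coherent_self T).comp <| (Coherent.rightUnitor l).inv.comp <|
        Coherent.whiskerRight (Coherent.tensorFinOne _ _ fun j =>
          Coherent.leaf _ _ rfl _).inv _
  exact unit_right_aux (bouquetUnit_coherent_self T).isIso key

end Relations

section Evaluation

open Bouquet OperadicCategory

variable {V : Type u'} [Category.{v'} V] [MonoidalCategory V] [SymmetricCategory V]
  {O : Type u} [Category.{v} O] [OperadicCategory O]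

/-! ### The evaluation of formal composites in an operad -/

namespace Operad

variable (P : Operad O V)

/-- The operation on the components of an operad given by a formal composite. -/
def eval {b : Bouquet O} (t : Term O b) : BouquetEnd P.obj b :=
  match t with
  | .unit T => bouquetUnit P.obj T
  | .comp f p x => bouquetComp f (fun y => eval (p y)) (eval x)
  | .gen f => genOp (P.γ f)
  | .genU c => nullaryOp (P.unit c)

theorem eval_heq {b c : Bouquet O} (h : b = c) {t : Term O b} {s : Term O c} (hts : HEq t s) :
    HEq (P.eval t) (P.eval s) := by
  subst h; obtain rfl := eq_of_heq hts; rfl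

/-- The relations that hold in every coloured operad are verified by the composition laws of
operations on a collection, and the three families special to `P(O)` by the three axioms of `P`. -/
theorem eval_eq_of_rel {b : Bouquet O} {t s : Term O b} (h : Rel t s) : P.eval t = P.eval s := by
  induction h with
  | refl => rfl
  | symm _ ih => exact ih.symm
  | trans _ _ ih ih' => exact ih.trans ih'
  | congr f _ _ ih ih' =>
    simp only [eval]
    rw [funext ih, ih']
  | assoc f g h w ε' ε δ r hε =>
    simp only [eval]
    exact bouquetComp_assoc f g h w _ _ _ _ fun i j => P.eval_heq (fib_fibMap f g h w i j) (hε i j)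
  | unit_left ε x hε =>
    simp only [eval]
    exact bouquetComp_unit_left _ _ fun i => by
      have := P.eval_heq (fib_id _ i) (hε i)
      simpa only [eval] using this
  | unit_right f ε x hε =>
    simp only [eval]
    exact bouquetComp_unit_right f _ _ fun i => P.eval_heq (fib_corolla f i) (hε i)
  | gen_assoc f g h w p q hp₀ hp hq₀ hq =>
    simp only [eval]
    refine (bouquetComp_gen_assoc_iff f g h w P.γ _ _ ?_ ?_ ?_ ?_).2 (P.assoc f g h w)
    · simpa only [eval] using P.eval_heq (fib_assocLeft_zero f g) hp₀
    · exact fun j => by simpa only [eval] using P.eval_heq (fib_assocLeft_succ f g j) (hp j)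
    · simpa only [eval] using P.eval_heq (fib_assocRight_zero f g h) hq₀
    · exact fun i => by simpa only [eval] using P.eval_heq (fib_assocRight_succ f g h w i) (hq i)
  | gen_unit_left T p hp₀ hp =>
    simp only [eval]
    refine (bouquetComp_gen_unit_left_iff T P.unit _ _ ?_ ?_).2 (P.unit_left T)
    · simpa only [eval] using P.eval_heq (fib_pickMap_self (𝟙 T) 0 rfl) hp₀
    · exact fun i => by
        simpa only [eval] using P.eval_heq ((fib_pickMap_of_ne (𝟙 T) (Fin.succ_ne_zero i).symm).trans
          (congrArg nullary (U_comp₀_fiber_id T i).symm)) (hp i)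
  | gen_unit_right f i p hp₀ hp =>
    simp only [eval]
    refine (bouquetComp_gen_unit_right_iff f i (P.unit _) _ _ ?_ ?_).2 (P.unit_right f)
    · simpa only [eval] using
        P.eval_heq (c := nullary (U _)) (fib_pickMap_of_ne f (Fin.succ_ne_zero i)) hp₀
    · simpa only [eval] using P.eval_heq (fib_pickMap_self f i.succ (fiber_U f i)) hp

/-- The operation on the components of an operad given by an element of `P(O)`. -/
def evalOper {b : Bouquet O} (x : Oper b) : BouquetEnd P.obj b :=
  Quotient.lift (s := termSetoid b) P.eval (fun _ _ h => P.eval_eq_of_rel h) x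

theorem evalOper_mk {b : Bouquet O} (t : Term O b) : P.evalOper (Oper.mk t) = P.eval t := rfl

theorem eval_out {b : Bouquet O} (x : Oper b) : P.eval x.out = P.evalOper x :=
  congrArg P.evalOper (Oper.mk_out x)

/-- Composition in `P(O)` is defined through chosen representatives, and evaluation does not depend
on the choice. -/
theorem evalOper_comp {b c : Bouquet O} (f : b ⟶ c) (p : ∀ y : Fin c.n, Oper (fib f y))
    (x : Oper c) : P.evalOper (Oper.comp f p x) =
      bouquetComp f (fun y => P.evalOper (p y)) (P.evalOper x) := by
  simp only [Oper.comp, evalOper_mk, eval, eval_out]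

end Operad

/-! ### Algebras over the terminal operad of the plus construction -/

/-- The object of `O` which corresponds to a connected component of the plus construction. -/
def plusColor : π₀ (POperad O).Groth → O :=
  fun c => compRoot ((SetOperad.Groth.proj (POperad O)).mapConnectedComponents c)

/-- The connected component of the plus construction which corresponds to an object of `O`. -/
def plusComp (T : O) : π₀ (POperad O).Groth :=
  comp₀ (⟨corolla T, Oper.mk (Term.unit T)⟩ : (POperad O).Groth)

/-- Every operation maps to the unit of its output colour, so a component is determined by that
colour. The algebras over the terminal operad thus have one underlying object for each object of
`O`. -/
theorem comp₀_eq_plusComp (X : (POperad O).Groth) : comp₀ X = plusComp X.base.root :=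
  comp₀_eq_of_hom (SetOperad.Groth.toUnit X)

theorem plusComp_plusColor (c : π₀ (POperad O).Groth) : plusComp (plusColor c) = c := by
  induction c using Quotient.inductionOn' with
  | h X => exact (comp₀_eq_plusComp X).symm

/-- Cardinalities, fibers and the colours of sources in `∫ P(O)` reduce to those of the underlying
bouquets. The two compositions then differ only by transports along identities. -/
theorem endComp_eq_bouquetComp (A : O → V) {X Y : (POperad O).Groth} (f : X ⟶ Y)
    (p : ∀ i, BouquetEnd A (fib (SetOperad.Groth.Hom.base f) i)) (x : BouquetEnd A Y.base) :
    endComp (fun c => A (plusColor c)) f p x = bouquetComp (SetOperad.Groth.Hom.base f) p x := by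
  have h : tensorFinMap (fun i => 𝟙 _ ≫ p i ≫ 𝟙 _) = tensorFinMap p :=
    congrArg (fun F => tensorListMap F _) (funext fun i =>
      (Category.id_comp _).trans (Category.comp_id _))
  exact congrArg (fun F => (regroup (Hom.map (SetOperad.Groth.Hom.base f)) (fun _ => rfl)
    (fun t => A (X.base.col t))).hom ≫ F ≫ x ≫
      eqToHom (congrArg A (Hom.root_eq (SetOperad.Groth.Hom.base f)).symm)) h

namespace Operad

/-- The algebra over the terminal operad of the plus construction given by an operad. -/
def toAlgebra (P : Operad O V) : (SetOperad.terminal.{_, _, 0} (POperad O).Groth).Algebra V where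
  carrier c := P.obj (plusColor c)
  act {X} _ := P.evalOper X.elt
  act_unit c := rfl
  act_γ {X Y} f p x := by
    -- The morphism `f` carries an equation that presents `X.elt` as a composite of `Y.elt` with the
    -- fibers of `f`; compatibility of the action is the multiplicativity of the evaluation on that
    -- composite.
    have h := P.evalOper_comp (SetOperad.Groth.Hom.base f) (SetOperad.Groth.Hom.ε f) Y.elt
    have h' := congrArg P.evalOper (SetOperad.Groth.Hom.eq f)
    exact h'.symm.trans (h.trans (endComp_eq_bouquetComp P.obj f _ _).symm)

end Operad

end Evaluation

/-! ### The equivalence between operads and algebras -/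

section Equivalence

open Bouquet OperadicCategory

/-! ### Morphisms -/

variable {V : Type u'} [Category.{v'} V]

theorem comp_naturality_aux {X X' Y Y' Z Z' W W' T T' : V} {r : X ⟶ Y} {r' : X' ⟶ Y'} {f : X ⟶ X'}
    {g : Y ⟶ Y'} {p : Y ⟶ Z} {p' : Y' ⟶ Z'} {h : Z ⟶ Z'} {x : Z ⟶ W} {x' : Z' ⟶ W'} {k : W ⟶ W'}
    {e : W ⟶ T} {e' : W' ⟶ T'} {l : T ⟶ T'} (h₁ : f ≫ r' = r ≫ g) (h₂ : p ≫ h = g ≫ p')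
    (h₃ : x ≫ k = h ≫ x') (h₄ : e ≫ l = k ≫ e') :
    (r ≫ p ≫ x ≫ e) ≫ l = f ≫ r' ≫ p' ≫ x' ≫ e' := by
  rw [reassoc_of% h₁, ← reassoc_of% h₂, ← reassoc_of% h₃, ← h₄]
  simp only [Category.assoc]

theorem eqToHom_naturality' {C : Type u} {A B : C → V} (φ : ∀ T, A T ⟶ B T) {T S : C} (h : T = S) :
    eqToHom (congrArg A h) ≫ φ S = φ T ≫ eqToHom (congrArg B h) := by
  subst h; simp

theorem comp_iso_naturality_iff {X X' Y Y' Z Z' : V} {p : X ⟶ X'} {e : X ≅ Y} {e' : X' ≅ Y'}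
    {q : Y ⟶ Y'} {k : Z ⟶ Z'} {γ : Y ⟶ Z} {γ' : Y' ⟶ Z'} (h : p ≫ e'.hom = e.hom ≫ q) :
    (e.hom ≫ γ) ≫ k = p ≫ e'.hom ≫ γ' ↔ γ ≫ k = q ≫ γ' := by
  rw [reassoc_of% h, Category.assoc, cancel_epi]

variable [MonoidalCategory V]

theorem tensorFinZero_naturality {X Y : Fin 0 → V} (f : ∀ i, X i ⟶ Y i) :
    tensorFinMap f ≫ (tensorFinZero Y).hom = (tensorFinZero X).hom := by
  have key : ∀ (L : List (Fin 0)) (h : L = []),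
      tensorListMap f L ≫ eqToHom (congrArg (tensorList Y) h) =
        eqToHom (congrArg (tensorList X) h) := by
    rintro _ rfl
    exact Category.comp_id _
  exact key _ List.finRange_zero

theorem bouquetUnit_naturality {C : Type u} {A B : C → V} (φ : ∀ T, A T ⟶ B T) (T : C) :
    bouquetUnit A T ≫ φ T = tensorFinMap (fun _ => φ T) ≫ bouquetUnit B T :=
  (tensorFinOne_naturality rfl (φ T)).symm

theorem nullaryOp_naturality_iff {C : Type u} {A B : C → V} (φ : ∀ T, A T ⟶ B T) (T : C)
    (γ : 𝟙_ V ⟶ A T) (γ' : 𝟙_ V ⟶ B T) :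
    nullaryOp γ ≫ φ T = tensorFinMap (fun t => φ ((nullary T).col t)) ≫ nullaryOp γ' ↔
      γ ≫ φ T = γ' :=
  (comp_iso_naturality_iff ((tensorFinZero_naturality fun t => φ ((nullary T).col t)).trans
    (Category.comp_id _).symm)).trans (Eq.congr_right (Category.id_comp γ'))

variable [SymmetricCategory V]

theorem bouquetComp_naturality {C : Type u} {A B : C → V} (φ : ∀ T, A T ⟶ B T) {b c : Bouquet C}
    (f : b ⟶ c) {p : ∀ y, BouquetEnd A (fib f y)} {q : ∀ y, BouquetEnd B (fib f y)}
    {x : BouquetEnd A c} {z : BouquetEnd B c}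
    (hp : ∀ y, p y ≫ φ (fib f y).root = tensorFinMap (fun t => φ ((fib f y).col t)) ≫ q y)
    (hx : x ≫ φ c.root = tensorFinMap (fun t => φ (c.col t)) ≫ z) :
    bouquetComp f p x ≫ φ b.root = tensorFinMap (fun t => φ (b.col t)) ≫ bouquetComp f q z := by
  refine comp_naturality_aux (regroup_naturality (Hom.map f) (fun _ => rfl) fun t => φ (b.col t))
    ?_ hx (eqToHom_naturality' φ (Hom.root_eq f).symm)
  exact (tensorFinMap_comp p fun y => φ (fib f y).root).symm.trans
    ((congrArg (fun F => tensorListMap F _) (funext hp)).trans (tensorFinMap_comp _ _))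

variable {O : Type u} [Category.{v} O] [OperadicCategory O]

/-- Passing between `γ` and `genOp γ` is composition with an isomorphism natural in the collection.
Both directions matter: one for sending morphisms of operads to morphisms of algebras, the other for
fullness. -/
theorem genOp_naturality_iff {A B : O → V} (φ : ∀ T, A T ⟶ B T) {T S : O} (f : T ⟶ S)
    (γ : fiberTensor A f ⊗ A S ⟶ A T) (γ' : fiberTensor B f ⊗ B S ⟶ B T) :
    genOp γ ≫ φ T = tensorFinMap (fun t => φ ((genBouquet f).col t)) ≫ genOp γ' ↔
      γ ≫ φ T = (tensorFinMap (fun i => φ (fiber f i)) ⊗ₘ φ S) ≫ γ' :=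
  comp_iso_naturality_iff (headLast_naturality (n := card S) fun t => φ ((genBouquet f).col t))

namespace Operad

/-- Families commuting with given operations commute with their composites, so the defining
properties of a morphism of operads are needed at the generators only. -/
theorem eval_naturality {P Q : Operad O V} (φ : P ⟶ Q) {b : Bouquet O} (t : Term O b) :
    P.eval t ≫ Hom.app φ b.root = tensorFinMap (fun i => Hom.app φ (b.col i)) ≫ Q.eval t := by
  induction t with
  | unit T => exact bouquetUnit_naturality (Hom.app φ) T
  | comp f p x ih ih' => exact bouquetComp_naturality (Hom.app φ) f ih ih'
  | gen f => exact (genOp_naturality_iff (Hom.app φ) f _ _).2 (Hom.γ φ f)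
  | genU c => exact (nullaryOp_naturality_iff (Hom.app φ) _ _ _).2 (Hom.unit φ c)

theorem evalOper_naturality {P Q : Operad O V} (φ : P ⟶ Q) {b : Bouquet O} (x : Oper b) :
    P.evalOper x ≫ Hom.app φ b.root =
      tensorFinMap (fun i => Hom.app φ (b.col i)) ≫ Q.evalOper x := by
  rw [← eval_out, ← eval_out]
  exact eval_naturality φ x.out

variable (O V) in
/-- The functor from operads to algebras over the terminal operad of the plus construction. -/
def toAlgebraFunctor :
    Operad O V ⥤ (SetOperad.terminal.{_, _, 0} (POperad O).Groth).Algebra V where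
  obj P := P.toAlgebra
  map {_ _} φ :=
    { app := fun c => Hom.app φ (plusColor c)
      act := fun {X} _ => evalOper_naturality φ X.elt }
  map_id _ := rfl
  map_comp _ _ := rfl

end Operad

theorem algebraHom_app_heq {P : SetOperad.{u, v, w} O} {A B : P.Algebra V}
    (ψ : SetOperad.Algebra.Hom A B) {c c' : π₀ O} (h : c = c') : HEq (ψ.app c) (ψ.app c') := by
  subst h; rfl

/-- A component of the plus construction equals the one of its colour only propositionally, so the
corresponding components of `ψ` have to be identified by transport. -/
theorem algebraHom_app_plusColor {P Q : Operad O V}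
    (ψ : SetOperad.Algebra.Hom P.toAlgebra Q.toAlgebra) (c : π₀ (POperad O).Groth) :
    ψ.app (plusComp (plusColor c)) = ψ.app c :=
  eq_of_heq (algebraHom_app_heq ψ (plusComp_plusColor c))

/-- The morphism of operads given by a morphism of algebras. -/
def Operad.homOfAlgebraHom {P Q : Operad O V}
    (ψ : SetOperad.Algebra.Hom P.toAlgebra Q.toAlgebra) : Operad.Hom P Q := by
  let φ : ∀ T, P.obj T ⟶ Q.obj T := fun T => ψ.app (plusComp T)
  have key : ∀ {b : Bouquet O} (t : Term O b),
      P.eval t ≫ φ b.root = tensorFinMap (fun i => φ (b.col i)) ≫ Q.eval t := fun {b} t => by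
    -- The class of a term is itself an object of the plus construction, so `ψ` commutes with its
    -- action. The next rewriting replaces components of `ψ` by values of `φ`.
    have h := ψ.act (T := (⟨b, Oper.mk t⟩ : (POperad O).Groth)) PUnit.unit
    rw [← algebraHom_app_plusColor ψ (comp₀ _), ← funext fun i =>
      algebraHom_app_plusColor ψ (src (⟨b, Oper.mk t⟩ : (POperad O).Groth) i)] at h
    exact h
  exact
    { app := φ
      unit := fun c => (nullaryOp_naturality_iff φ _ _ _).1 (key (Term.genU c))
      γ := fun f => (genOp_naturality_iff φ f _ _).1 (key (Term.gen f)) }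

/-- The component at `T` is recovered at `plusComp T`, whose colour is `T` by definition. -/
instance : (Operad.toAlgebraFunctor V O).Faithful where
  map_injective {_ _ _ _} h := Operad.Hom.ext (funext fun T =>
    congrArg (fun k => SetOperad.Algebra.Hom.app k (plusComp T)) h)

instance : (Operad.toAlgebraFunctor V O).Full where
  map_surjective ψ := ⟨Operad.homOfAlgebraHom ψ, SetOperad.Algebra.Hom.ext (funext fun c =>
    algebraHom_app_plusColor ψ c)⟩

/-! ### The operad given by an action of the formal composites -/

/-- A compatible interpretation of formal composites as operations on a collection. -/
structure TermAction (A : O → V) where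
  /-- the interpretation -/
  ev : ∀ {b : Bouquet O}, Term O b → BouquetEnd A b
  rel : ∀ {b : Bouquet O} {t s : Term O b}, Rel t s → ev t = ev s
  unit : ∀ T, ev (Term.unit T) = bouquetUnit A T
  comp : ∀ {b c : Bouquet O} (f : b ⟶ c) (p : ∀ y : Fin c.n, Term O (fib f y)) (x : Term O c),
    ev (Term.comp f p x) = bouquetComp f (fun y => ev (p y)) (ev x)

namespace TermAction

variable {A : O → V} (E : TermAction A)

theorem ev_heq {b c : Bouquet O} (h : b = c) {t : Term O b} {s : Term O c} (hts : HEq t s) :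
    HEq (E.ev t) (E.ev s) := by
  subst h; obtain rfl := eq_of_heq hts; rfl

/-- The structure maps of the operad given by an action of the formal composites. -/
def γ {T S : O} (f : T ⟶ S) : fiberTensor A f ⊗ A S ⟶ A T :=
  (headLast (fun t => A ((genBouquet f).col t))).inv ≫ E.ev (Term.gen f)

/-- The units of the operad given by an action of the formal composites. -/
def u (c : π₀ O) : 𝟙_ V ⟶ A (U c) := (tensorFinZero _).inv ≫ E.ev (Term.genU c)

theorem genOp_γ {T S : O} (f : T ⟶ S) : genOp (E.γ f) = E.ev (Term.gen f) :=
  Iso.hom_inv_id_assoc _ _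

theorem nullaryOp_u (c : π₀ O) : nullaryOp (E.u c) = E.ev (Term.genU c) :=
  Iso.hom_inv_id_assoc _ _

/-- The generating relations speak of arbitrary families of terms that are heterogeneously equal to
prescribed ones; this provides such families. -/
theorem exists_terms {n : ℕ} {d : Fin (n + 1) → Bouquet O} {b₀ : Bouquet O} {b : Fin n → Bouquet O}
    (h₀ : d 0 = b₀) (h : ∀ j : Fin n, d j.succ = b j) (t₀ : Term O b₀) (t : ∀ j, Term O (b j)) :
    ∃ p : ∀ y, Term O (d y), HEq (p 0) t₀ ∧ ∀ j : Fin n, HEq (p j.succ) (t j) :=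
  ⟨Fin.cases (motive := fun y => Term O (d y)) (cast (congrArg (Term O) h₀.symm) t₀)
      fun j => cast (congrArg (Term O) (h j).symm) (t j),
    cast_heq (congrArg (Term O) h₀.symm) t₀,
    fun j => cast_heq (congrArg (Term O) (h j).symm) (t j)⟩

/-- The two sides of the relation `gen_assoc` are formed as terms, their interpretations agree
because the action respects `Rel`, and `bouquetComp_gen_assoc_iff` turns this equality into the
axiom. The unit laws follow in the same way. -/
theorem assoc {T S R : O} (f : T ⟶ S) (g : S ⟶ R) (h : T ⟶ R) (w : f ≫ g = h) :
    ((tensorListShuffle (fun i => fiberTensor A (fiberMap f g h w i)) (fun i => A (fiber g i))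
          (List.finRange (card R)) ≫
        tensorFinMap (fun i => E.γ (fiberMap f g h w i))) ▷ A R) ≫ E.γ h =
      (α_ _ _ _).hom ≫
        (tensorFin (fun i => fiberTensor A (fiberMap f g h w i)) ◁ E.γ g) ≫
        ((fiberTensorIso A f g h w).hom ▷ A S) ≫ E.γ f := by
  obtain ⟨p, hp₀, hp⟩ := exists_terms (fib_assocLeft_zero f g) (fib_assocLeft_succ f g)
    (Term.gen g) fun j => Term.unit (fiber f j)
  obtain ⟨q, hq₀, hq⟩ := exists_terms (fib_assocRight_zero f g h) (fib_assocRight_succ f g h w)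
    (Term.unit R) fun i => Term.gen (fiberMap f g h w i)
  refine (bouquetComp_gen_assoc_iff f g h w E.γ (fun y => E.ev (p y)) (fun y => E.ev (q y))
    ?_ (fun j => ?_) ?_ (fun i => ?_)).1 ?_
  · rw [genOp_γ]; exact E.ev_heq (fib_assocLeft_zero f g) hp₀
  · rw [← E.unit]; exact E.ev_heq (fib_assocLeft_succ f g j) (hp j)
  · rw [← E.unit]; exact E.ev_heq (fib_assocRight_zero f g h) hq₀
  · rw [genOp_γ]; exact E.ev_heq (fib_assocRight_succ f g h w i) (hq i)
  · rw [genOp_γ, genOp_γ]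
    exact (E.comp _ _ _).symm.trans ((E.rel (.gen_assoc f g h w p q hp₀ hp hq₀ hq)).trans
      (E.comp _ _ _))

theorem unit_left (T : O) : (λ_ (A T)).inv ≫
    (((tensorListUnit (List.finRange (card T))).hom ≫
      tensorFinMap (fun i => E.u (comp₀ (fiber (𝟙 T) i)) ≫
        eqToHom (congrArg A (U_comp₀_fiber_id T i)))) ▷ A T) ≫ E.γ (𝟙 T) = 𝟙 (A T) := by
  have h₀ : fib (pickMap (𝟙 T) 0) (0 : Fin (card T + 1)) = corolla T :=
    fib_pickMap_self (𝟙 T) 0 rfl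
  have h : ∀ i : Fin (card T), fib (pickMap (𝟙 T) 0) i.succ =
      nullary (U (comp₀ (fiber (𝟙 T) i))) := fun i =>
    (fib_pickMap_of_ne (𝟙 T) (Fin.succ_ne_zero i).symm).trans
      (congrArg nullary (U_comp₀_fiber_id T i).symm)
  obtain ⟨p, hp₀, hp⟩ := exists_terms h₀ h (Term.unit T) fun i =>
    Term.genU (comp₀ (fiber (𝟙 T) i))
  refine (bouquetComp_gen_unit_left_iff T E.u (E.γ (𝟙 T)) (fun y => E.ev (p y))
    ?_ (fun i => ?_)).1 ?_
  · rw [← E.unit]; exact E.ev_heq h₀ hp₀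
  · rw [nullaryOp_u]; exact E.ev_heq (h i) (hp i)
  · rw [genOp_γ, ← E.unit]
    exact (E.comp _ _ _).symm.trans (E.rel (.gen_unit_left T p hp₀ hp))

theorem unit_right {T : O} {c : π₀ O} (f : T ⟶ U c) : (ρ_ (A T)).inv ≫ (A T ◁ E.u c) ≫
    ((tensorFinOne (card_U c) (fun i => A (fiber f i)) (A T)
      (fun i => congrArg A (fiber_U f i))).inv ▷ A (U c)) ≫ E.γ f = 𝟙 (A T) := by
  -- The relation `gen_unit_right` names the place of the input `T` explicitly; it is the only
  -- element of `|U c|`.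
  let i : Fin (card (U c)) := ⟨0, by rw [card_U]; exact Nat.one_pos⟩
  have h₀ : fib (pickMap f i.succ) (0 : Fin (card (U c) + 1)) = nullary (U c) :=
    fib_pickMap_of_ne f (Fin.succ_ne_zero i)
  have h : ∀ j : Fin (card (U c)), fib (pickMap f i.succ) j.succ = corolla T := fun j => by
    have : Subsingleton (Fin (card (U c))) := by rw [card_U]; infer_instance
    rw [Subsingleton.elim j i]; exact fib_pickMap_self f i.succ (fiber_U f i)
  obtain ⟨p, hp₀, hp⟩ := exists_terms h₀ h (Term.genU c) fun _ => Term.unit T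
  refine (bouquetComp_gen_unit_right_iff f i (E.u c) (E.γ f) (fun y => E.ev (p y)) ?_ ?_).1 ?_
  · rw [nullaryOp_u]; exact E.ev_heq h₀ hp₀
  · rw [← E.unit]; exact E.ev_heq (h i) (hp i)
  · rw [genOp_γ, ← E.unit]
    exact (E.comp _ _ _).symm.trans (E.rel (.gen_unit_right f i p hp₀ (hp i)))

/-- The operad given by an action of the formal composites. -/
def operad : Operad O V where
  obj := A
  unit := E.u
  γ := E.γ
  assoc := E.assoc
  unit_left := E.unit_left
  unit_right := E.unit_right

/-- An action of formal composites is determined by its values on the generators, and on these the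
two sides agree by the choice of `γ` and `u`. -/
theorem eval_operad {b : Bouquet O} (t : Term O b) : E.operad.eval t = E.ev t := by
  induction t with
  | unit T => exact (E.unit T).symm
  | comp f p x ih ih' =>
    rw [E.comp, ← ih', ← funext ih]
    rfl
  | gen f => exact E.genOp_γ f
  | genU c => exact E.nullaryOp_u c

end TermAction

theorem algebra_mk_eq {P : SetOperad.{u, v, w} O} {A : π₀ O → V}
    {a a' : ∀ {T : O}, P.obj T → EndObj A T} {hu hu' hγ hγ'}
    (h : ∀ {T : O} (x : P.obj T), a x = a' x) :
    (⟨A, a, hu, hγ⟩ : P.Algebra V) = ⟨A, a', hu', hγ'⟩ := by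
  obtain rfl : @a = @a' := by funext T x; exact h x
  rfl

/-- The action of an algebra on classes of terms is a `TermAction`; the operad built from it gives
back the same algebra, so that the required isomorphism comes from an equality. -/
instance : (Operad.toAlgebraFunctor V O).EssSurj where
  mem_essImage B := by
    obtain ⟨carrier, act, act_unit, act_γ⟩ := B
    -- Substituting this form of the carrier makes the components of its endomorphism operad reduce
    -- to `BouquetEnd A`, so that no transports along `plusComp_plusColor` are needed below.
    obtain ⟨A, rfl⟩ : ∃ A : O → V, carrier = fun c => A (plusColor c) :=
      ⟨fun T => carrier (plusComp T), funext fun c => (congrArg carrier (plusComp_plusColor c)).symm⟩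
    let E : TermAction A :=
      { ev := fun {b} t => act (T := ⟨b, Oper.mk t⟩) PUnit.unit
        rel := fun {b t s} h => by rw [Oper.sound h]
        unit := fun T => act_unit (plusComp T)
        comp := fun {b c} f p x => by
          -- A formal composite is turned into a morphism of the plus construction whose fibers are
          -- the classes of the plugged terms; compatibility of the action along it is compatibility
          -- with `Term.comp`.
          let F : (⟨b, Oper.mk (Term.comp f p x)⟩ : (POperad O).Groth) ⟶ ⟨c, Oper.mk x⟩ :=
            ⟨f, fun y => Oper.mk (p y), Oper.comp_mk f p x⟩
          exact (act_γ F (fun _ => PUnit.unit) PUnit.unit).trans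
            (endComp_eq_bouquetComp A F _ _) }
    have h : ∀ {X : (POperad O).Groth} (y : PUnit), E.operad.toAlgebra.act (T := X) y = act y := by
      rintro ⟨b, x⟩ y
      -- Every operation is the class of a formal composite, so it suffices to compare the two
      -- actions on terms.
      induction x using Quotient.inductionOn with
      | h t => exact E.eval_operad t
    exact ⟨E.operad, ⟨eqToIso (algebra_mk_eq h)⟩⟩

end Equivalence

end OperadicCat

end

/-- For every operadic category `O`, the domain of the operadic Grothendieck construction of the
coloured operad `P(O)` is a plus construction over `O`. -/
theorem theorem5p3 (O : Type u) [Category.{v} O]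
    [OperadicCat.OperadicCategory O] :
    OperadicCat.IsPlusConstruction.{v', u'} O (OperadicCat.POperad O).Groth := by
  intro V _ _ _
  have : (OperadicCat.Operad.toAlgebraFunctor V O).IsEquivalence := {}
  exact ⟨(OperadicCat.Operad.toAlgebraFunctor V O).asEquivalence⟩
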